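/- Let $\Omega\subset\mathbb R^2$ be an open ellipse (the image of the open unit disk under an invertible affine map; its axes need not be parallel to the coordinate axes) or a nondegenerate open rectangle with sides parallel to the coordinate axes. Let $\Delta_\Omega:H^1_0(\Omega)\to H^{-1}(\Omega)$ be the Dirichlet Laplacian (an isomorphism) and let $P=\partial_{x_2}^2\Delta_\Omega^{-1}:H^{-1}(\Omega)\to H^{-1}(\Omega)$, which is bounded and self-adjoint for the inner product $\langle u,w\rangle_{H^{-1}(\Omega)}=\langle\nabla\Delta_\Omega^{-1}u,\nabla\Delta_\Omega^{-1}w\rangle_{L^2(\Omega)}$. For $\lambda\in(0,1)$ put $\ell^\pm(x,\lambda)=\pm\frac{x_1}{\lambda}+\frac{x_2}{\sqrt{1-\lambda^2}}$ and let $\gamma^\pm:\partial\Omega\to\partial\Omega$ send $x$ to the other point of $\partial\Omega$ on the level line of $\ell^\pm(\cdot,\lambda)$ through $x$ (and to $x$ itself if there is no other point). Let $b(\cdot,\lambda)=\gamma^+\circ\gamma^-$ be the chess billiard map, and let $\mathbf r(\lambda)=\lim_{k\to\infty}\frac{\mathbf b^k(x_0)-x_0}{k}\in\mathbb R/\mathbb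 Z$ be its rotation number, where $\mathbf b:\mathbb R\to\mathbb R$ is a lift of $b(\cdot,\lambda)$ with respect to a positively oriented parametrization of $\partial\Omega$ by $\mathbb R/\mathbb Z$; the limit exists and does not depend on $x_0$, the lift or the parametrization. Then the spectrum of $P$ is $[0,1]$ and is pure point: the eigenvectors of $P$ span a dense subspace of $H^{-1}(\Omega)$, and the eigenvalues are dense in $[0,1]$. Moreover, the eigenvalues of $P$ are exactly the numbers $\lambda^2$ with $\lambda\in(0,1)$ and $\mathbf r(\lambda)$ rational (modulo $1$). -/

import Mathlib

open Set Filter Topology MeasureTheory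

noncomputable section

namespace InternalWaves

/-- The Euclidean plane. The coordinate `x₁` of the text is `x 0`, and `x₂` is `x 1`. -/
abbrev Plane := EuclideanSpace ℝ (Fin 2)

/-! ### Domains -/

/-- Open ellipses: the images of the open unit disk under an invertible affine map. -/
def IsEllipse (Ω : Set Plane) : Prop :=
  ∃ (A : Plane ≃ₗ[ℝ] Plane) (v : Plane), Ω = (fun x => A x + v) '' Metric.ball (0 : Plane) 1

/-- Nondegenerate open rectangles whose sides are parallel to the coordinate axes. -/
def IsAxisParallelRectangle (Ω : Set Plane) : Prop :=
  ∃ a₁ b₁ a₂ b₂ : ℝ, a₁ < b₁ ∧ a₂ < b₂ ∧ Ω = {x : Plane | x 0 ∈ Ioo a₁ b₁ ∧ x 1 ∈ Ioo a₂ b₂}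

/-! ### Sobolev spaces and the operator `P = ∂₂² Δ_Ω⁻¹` -/

/-- Complex-valued square integrable functions on `Ω`. -/
abbrev L2 (Ω : Set Plane) := Lp ℂ 2 ((volume : Measure Plane).restrict Ω)

/-- Triples `(u, g₁, g₂)` of `L²` functions on `Ω`, with the Hilbert space structure of the
direct sum. The index `none` stands for `u`, the index `some j` for the candidate `g_j` of the
partial derivative `∂_j u`. -/
abbrev Jet (Ω : Set Plane) := PiLp 2 (fun _ : Option (Fin 2) => L2 Ω)

/-- The partial derivative of `φ` in the direction of the coordinate `j`. -/
def partialDeriv (j : Fin 2) (φ : Plane → ℂ) (x : Plane) : ℂ :=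
  fderiv ℝ φ x (EuclideanSpace.single j 1)

/-- Smooth functions with compact support in `Ω`. -/
structure IsTestFunction (Ω : Set Plane) (φ : Plane → ℂ) : Prop where
  smooth : ContDiff ℝ ((⊤ : ℕ∞) : WithTop ℕ∞) φ
  compact : HasCompactSupport φ
  support : tsupport φ ⊆ Ω

/-- The triple `J` is `(φ, ∂₁ φ, ∂₂ φ)`, almost everywhere on `Ω`. -/
def IsJetOf (Ω : Set Plane) (J : Jet Ω) (φ : Plane → ℂ) : Prop :=
  J none =ᵐ[volume.restrict Ω] φ ∧
    ∀ j : Fin 2, J (some j) =ᵐ[volume.restrict Ω] partialDeriv j φ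

/-- The triples `(φ, ∂₁ φ, ∂₂ φ)` of test functions `φ ∈ C_c^∞(Ω)`. -/
def testJets (Ω : Set Plane) : Submodule ℂ (Jet Ω) where
  carrier := {J | ∃ φ : Plane → ℂ, IsTestFunction Ω φ ∧ IsJetOf Ω J φ}
  zero_mem' := by
    refine ⟨0, ⟨contDiff_const, HasCompactSupport.zero, by simp [tsupport]⟩, ?_, fun j => ?_⟩
    · exact Lp.coeFn_zero _ _ _
    · refine (Lp.coeFn_zero _ _ _).trans (Eventually.of_forall fun x => ?_)
      simp [partialDeriv]
  add_mem' := by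
    rintro J K ⟨φ, hφ, hJ, hJ'⟩ ⟨ψ, hψ, hK, hK'⟩
    refine ⟨φ + ψ, ⟨hφ.smooth.add hψ.smooth, hφ.compact.add hψ.compact,
      (tsupport_add φ ψ).trans (union_subset hφ.support hψ.support)⟩, ?_, fun j => ?_⟩
    · exact (Lp.coeFn_add _ _).trans (hJ.add hK)
    · refine ((Lp.coeFn_add _ _).trans ((hJ' j).add (hK' j))).trans
        (Eventually.of_forall fun x => ?_)
      have h1 : DifferentiableAt ℝ φ x := (hφ.smooth.differentiable (by simp)).differentiableAt
      have h2 : DifferentiableAt ℝ ψ x := (hψ.smooth.differentiable (by simp)).differentiableAt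
      simp [partialDeriv, fderiv_add h1 h2]
  smul_mem' := by
    rintro c J ⟨φ, hφ, hJ, hJ'⟩
    refine ⟨c • φ, ⟨hφ.smooth.const_smul c, hφ.compact.mono (Function.support_const_smul_subset c φ),
      (closure_mono (Function.support_const_smul_subset c φ)).trans hφ.support⟩, ?_, fun j => ?_⟩
    · exact (Lp.coeFn_smul _ _).trans (hJ.const_smul c)
    · refine ((Lp.coeFn_smul _ _).trans ((hJ' j).const_smul c)).trans
        (Eventually.of_forall fun x => ?_)
      have h1 : DifferentiableAt ℝ φ x := (hφ.smooth.differentiable (by simp)).differentiableAt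
      simp [partialDeriv, fderiv_const_smul h1]

/-- `H¹₀(Ω)`: the closure of `C_c^∞(Ω)` in the norm
`(‖u‖² + ‖∂₁ u‖² + ‖∂₂ u‖²)^(1/2)`. An element is recorded together with its (weak) partial
derivatives, which are determined by it. -/
abbrev H10 (Ω : Set Plane) : Submodule ℂ (Jet Ω) := (testJets Ω).topologicalClosure

/-- `H⁻¹(Ω)`: the space of continuous linear functionals on `H¹₀(Ω)`. -/
abbrev Hm1 (Ω : Set Plane) := H10 Ω →L[ℂ] ℂ

/-- The partial derivative `∂_j : H¹₀(Ω) → L²(Ω)`. -/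
def weakDeriv (Ω : Set Plane) (j : Fin 2) : H10 Ω →L[ℂ] L2 Ω :=
  (PiLp.proj 2 (fun _ : Option (Fin 2) => L2 Ω) (some j)).comp (H10 Ω).subtypeL

/-- The bilinear pairing `∫_Ω f g` of two `L²` functions. -/
def L2pairing (Ω : Set Plane) : L2 Ω →L[ℂ] L2 Ω →L[ℂ] ℂ :=
  (ContinuousLinearMap.mul ℂ ℂ).lpPairing ((volume : Measure Plane).restrict Ω) 2 2

/-- The second distributional derivative `∂_j² : H¹₀(Ω) → H⁻¹(Ω)`,
`⟨∂_j² u, v⟩ = - ∫_Ω ∂_j u ∂_j v`. -/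
def secondDeriv (Ω : Set Plane) (j : Fin 2) : H10 Ω →L[ℂ] Hm1 Ω :=
  -(L2pairing Ω).bilinearComp (weakDeriv Ω j) (weakDeriv Ω j)

theorem secondDeriv_apply (Ω : Set Plane) (j : Fin 2) (u v : H10 Ω) :
    secondDeriv Ω j u v = -∫ x in Ω, weakDeriv Ω j u x * weakDeriv Ω j v x := by
  simp [secondDeriv, L2pairing, ContinuousLinearMap.lpPairing_eq_integral]

/-- The Dirichlet Laplacian `Δ_Ω : H¹₀(Ω) → H⁻¹(Ω)`. -/
def dirichletLaplacian (Ω : Set Plane) : H10 Ω →L[ℂ] Hm1 Ω :=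
  secondDeriv Ω 0 + secondDeriv Ω 1

/-- The inverse `Δ_Ω⁻¹ : H⁻¹(Ω) → H¹₀(Ω)`; it is the genuine two-sided inverse whenever
`Δ_Ω` is invertible. -/
def solutionOperator (Ω : Set Plane) : Hm1 Ω →L[ℂ] H10 Ω :=
  (dirichletLaplacian Ω).inverse

/-- The Poincaré operator `P = ∂₂² Δ_Ω⁻¹ : H⁻¹(Ω) → H⁻¹(Ω)`. -/
def poincareOperator (Ω : Set Plane) : Hm1 Ω →L[ℂ] Hm1 Ω :=
  (secondDeriv Ω 1).comp (solutionOperator Ω)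

/-- The inner product `⟨∇ Δ_Ω⁻¹ w, ∇ Δ_Ω⁻¹ z⟩` of `L²(Ω)` on `H⁻¹(Ω)`, linear in `w` and
conjugate linear in `z`. -/
def hm1Inner (Ω : Set Plane) (w z : Hm1 Ω) : ℂ :=
  ∑ j : Fin 2, ∫ x in Ω, weakDeriv Ω j (solutionOperator Ω w) x *
    (starRingEnd ℂ) (weakDeriv Ω j (solutionOperator Ω z) x)

/-- The set of eigenvalues of a bounded operator. -/
def eigenvalues {H : Type*} [AddCommGroup H] [Module ℂ H] [TopologicalSpace H] (T : H →L[ℂ] H) : Set ℂ :=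
  {μ | Module.End.HasEigenvalue (T : H →ₗ[ℂ] H) μ}

/-- A bounded (self-adjoint) operator has pure point spectrum if the linear span of its
eigenvectors is dense. -/
def HasPurePointSpectrum {H : Type*} [AddCommGroup H] [Module ℂ H] [TopologicalSpace H]
    (T : H →L[ℂ] H) : Prop :=
  Dense ((⨆ μ : ℂ, Module.End.eigenspace (T : H →ₗ[ℂ] H) μ : Submodule ℂ H) : Set H)

/-! ### The chess billiard map and its rotation number -/

/-- The linear form `ℓ⁺(x, λ) = x₁ / λ + x₂ / √(1 - λ²)`. -/
def ellPlus (lam : ℝ) (x : Plane) : ℝ := x 0 / lam + x 1 / √(1 - lam ^ 2)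

/-- The linear form `ℓ⁻(x, λ) = - x₁ / λ + x₂ / √(1 - λ²)`. -/
def ellMinus (lam : ℝ) (x : Plane) : ℝ := -(x 0 / lam) + x 1 / √(1 - lam ^ 2)

open Classical in
/-- The involution `γ` of `∂Ω` with `ℓ (γ x) = ℓ x`, for a linear form `ℓ` whose level lines meet
`∂Ω` in at most two points: `γ x` is the other point of `∂Ω` on the level line of `ℓ`
through `x`, and `γ x = x` if there is no other point. -/
def boundaryInvolution (Ω : Set Plane) (ℓ : Plane → ℝ) (x : Plane) : Plane :=
  if h : ∃ y ∈ frontier Ω, y ≠ x ∧ ℓ y = ℓ x then h.choose else x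

/-- The chess billiard map `b(·, λ) = γ⁺ ∘ γ⁻` on `∂Ω`. -/
def chessBilliard (Ω : Set Plane) (lam : ℝ) : Plane → Plane :=
  boundaryInvolution Ω (ellPlus lam) ∘ boundaryInvolution Ω (ellMinus lam)

/-- Positively oriented parametrizations of `∂Ω` by the circle `ℝ/ℤ`: continuous injective maps
onto `∂Ω` that wind once, counterclockwise, around each point of `Ω`. -/
structure IsPositiveParametrization (Ω : Set Plane) (p : UnitAddCircle → Plane) : Prop where
  continuous : Continuous p
  injective : Function.Injective p
  range_eq : range p = frontier Ω
  winding : ∀ c ∈ Ω, ∃ θ : ℝ → ℝ, Continuous θ ∧ (∀ t, θ (t + 1) = θ t + 2 * Real.pi) ∧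
    ∀ t : ℝ, p (t : UnitAddCircle) 0 = c 0 + dist (p (t : UnitAddCircle)) c * Real.cos (θ t) ∧
      p (t : UnitAddCircle) 1 = c 1 + dist (p (t : UnitAddCircle)) c * Real.sin (θ t)

/-- `F : ℝ → ℝ` is a lift of the map `b` of `∂Ω` through the parametrization `p`. -/
structure IsLift (p : UnitAddCircle → Plane) (b : Plane → Plane) (F : ℝ → ℝ) : Prop where
  continuous : Continuous F
  semiconj : ∀ t : ℝ, p (F t : UnitAddCircle) = b (p (t : UnitAddCircle))

/-- `r ∈ ℝ/ℤ` is the rotation number of the chess billiard map `b(·, λ)`: there are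
parametrizations and lifts, and for each of them and each initial point `x₀` the limit of
`(F^k(x₀) - x₀) / k` exists and represents `r`. -/
def IsRotationNumber (Ω : Set Plane) (lam : ℝ) (r : UnitAddCircle) : Prop :=
  (∃ p F, IsPositiveParametrization Ω p ∧ IsLift p (chessBilliard Ω lam) F) ∧
    ∀ p F, IsPositiveParametrization Ω p → IsLift p (chessBilliard Ω lam) F → ∀ x₀ : ℝ,
      ∃ ρ : ℝ, Tendsto (fun k : ℕ => (F^[k] x₀ - x₀) / k) atTop (𝓝 ρ) ∧ (ρ : UnitAddCircle) = r

open Classical in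
/-- The rotation number `r(λ) ∈ ℝ/ℤ` of the chess billiard map (with the value `0` where it is
not defined). -/
def rotationNumber (Ω : Set Plane) (lam : ℝ) : UnitAddCircle :=
  if h : ∃ r, IsRotationNumber Ω lam r then h.choose else 0

/-- An element of `ℝ/ℤ` is rational if it is the class of a rational number. -/
def IsRationalMod (r : UnitAddCircle) : Prop := ∃ q : ℚ, ((q : ℝ) : UnitAddCircle) = r

end InternalWaves

end

/-!
Both kinds of domain have an explicit complete family of eigenvectors, and in both the chess billiard
map is conjugate to a rotation.

*Reduction to a complete family.* The forms `∂₁²`, `∂₂²` on `H¹₀(Ω)` are abstracted into `GradientForms`.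
By the Poincaré inequality and Lax–Milgram, `c₀ ∂₁² + c₁ ∂₂²` is an isomorphism onto `H⁻¹(Ω)` whenever it
is coercive, which gives the invertibility of the Laplacian and confines the spectrum of `P` to `[0, 1]`.
An eigenvector of `P` is `Δ u` with `∂₂² u = μ Δ u`; the eigenvalue is a Rayleigh quotient, hence lies in
`(0, 1)`. If the eigenpairs `(μ, u)` of a family are complete, in the sense that `⟨Δ u, v⟩ = 0` for all `u`
forces `v = 0`, then the spectrum is pure point and there are no other eigenvalues. A smooth function which
vanishes on the boundary to first order belongs to `H¹₀(Ω)` (`IsBoundedOpen.jet_mem_H10`), so explicit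
functions can be used; completeness is reduced to vanishing moments and the Stone–Weierstrass theorem
(`IsBoundedOpen.ae_eq_zero_of_moments`).

*Rectangles.* The eigenfunctions are `sin (j π x / L₁) sin (k π y / L₂)`, with eigenvalue
`λ² = k² L₁² / (j² L₂² + k² L₁²)`, that is `λ L₂ / (√(1 - λ²) L₁) = k / j`.

*Ellipses.* In a complex coordinate `Z` for which the ellipse is the unit disk, `∂_j² ((1 - |Z|²) ·)` maps
the polynomials in `Z`, `Z̄` of degree less than `n` to themselves. Uniqueness for the Dirichlet problem
makes the Laplacian invertible there, and the ratio is diagonalizable because a Jordan block would be one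
in `H¹₀(Ω)` (`iSup_eigenspace_eq_top`). So there is a complete family of polynomial eigenfunctions. The
operator `∂₂² - μ Δ` with `μ = λ²` is triangular with respect to the degree, so its kernel is detected by
leading forms, whose coefficients satisfy a recurrence of order two; it has a nonzero solution vanishing
at both ends if and only if `(ω̄⁺ / ω⁺) ^ N = (ω̄⁻ / ω⁻) ^ N` for some `N ≥ 2`, where `ω^±` is the covector
`ℓ^±` in the coordinate `Z`.

*Rotation numbers.* In a suitable parameter `t` of the boundary both involutions are reflections
`t ↦ c^± - t`, so the billiard map is the translation by `c⁺ - c⁻`, and this is the rotation number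
(`isRotationNumber_of_reflections`). For a rectangle, `t` is a weighted length, and for an ellipse it is
the argument of `Z`, with `c^± = arg ω^± / π`. In both cases the rotation number is rational exactly when
`λ²` is one of the eigenvalues above. It is a function of a quantity that is continuous and strictly
monotone in `λ`, which yields the density of the eigenvalues.
-/

open Set Filter Topology MeasureTheory

noncomputable section

namespace InternalWaves

/-! ### Pairs of forms on a Hilbert space and their ratio -/

/-- The Hilbert space `H`, two operators `D₀, D₁ : H → L`, a conjugation `σ` of `H`, and the symmetric
bilinear forms `S_j(u, v) = -⟪D_j σ v, D_j u⟫`, considered as operators from `H` to its dual. Each of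
the `D_j` is injective, and together they are coercive. In the application `H = H¹₀(Ω)`, `D_j` is the
partial derivative `∂_j`, and `S_j` is `∂_j² : H¹₀(Ω) → H⁻¹(Ω)`. -/
structure GradientForms (H L : Type*) [NormedAddCommGroup H] [InnerProductSpace ℂ H]
    [NormedAddCommGroup L] [InnerProductSpace ℂ L] where
  D₀ : H →L[ℂ] L
  D₁ : H →L[ℂ] L
  S₀ : H →L[ℂ] (H →L[ℂ] ℂ)
  S₁ : H →L[ℂ] (H →L[ℂ] ℂ)
  σ : H → H
  σ_σ : ∀ u, σ (σ u) = u
  inner_σ : ∀ u v, inner ℂ (σ u) (σ v) = inner ℂ v u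
  D₀_σ : ∀ u v, inner ℂ (D₀ (σ u)) (D₀ (σ v)) = inner ℂ (D₀ v) (D₀ u)
  D₁_σ : ∀ u v, inner ℂ (D₁ (σ u)) (D₁ (σ v)) = inner ℂ (D₁ v) (D₁ u)
  S₀_σ : ∀ u v, S₀ u (σ v) = -inner ℂ (D₀ v) (D₀ u)
  S₁_σ : ∀ u v, S₁ u (σ v) = -inner ℂ (D₁ v) (D₁ u)
  inj₀ : ∀ u, D₀ u = 0 → u = 0
  inj₁ : ∀ u, D₁ u = 0 → u = 0
  coercive : ∃ C > 0, ∀ u, ‖u‖ ^ 2 ≤ C * (‖D₀ u‖ ^ 2 + ‖D₁ u‖ ^ 2)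

theorem isInvertible_of_bijective {E F : Type*} [NormedAddCommGroup E] [NormedSpace ℂ E]
    [CompleteSpace E] [NormedAddCommGroup F] [NormedSpace ℂ F] [CompleteSpace F] {f : E →L[ℂ] F}
    (hf : Function.Bijective f) : f.IsInvertible :=
  ⟨ContinuousLinearEquiv.ofBijective f (LinearMap.ker_eq_bot.2 hf.1) (LinearMap.range_eq_top.2 hf.2),
    ContinuousLinearEquiv.coe_ofBijective _ _ _⟩

theorem closure_eigenvalues_subset_spectrum {V : Type*} [NormedAddCommGroup V] [NormedSpace ℂ V]
    [CompleteSpace V] (T : V →L[ℂ] V) : closure (eigenvalues T) ⊆ spectrum ℂ T := by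
  refine closure_minimal (fun μ hμ hu => ?_) (spectrum.isClosed T)
  obtain ⟨w, hw, hw0⟩ := Module.End.HasEigenvalue.exists_hasEigenvector hμ
  rw [Module.End.mem_eigenspace_iff] at hw
  have hb := (ContinuousLinearMap.isUnit_iff_bijective).1 hu
  refine hw0 ((injective_iff_map_eq_zero _).1 hb.1 _ ?_)
  change algebraMap ℂ (V →L[ℂ] V) μ w - T w = 0
  rw [ContinuousLinearMap.algebraMap_apply, sub_eq_zero]
  exact hw.symm

theorem notMem_spectrum_of_bijective {V : Type*} [NormedAddCommGroup V] [NormedSpace ℂ V]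
    [CompleteSpace V] (T : V →L[ℂ] V) {z : ℂ} (h : Function.Bijective fun w => T w - z • w) :
    z ∉ spectrum ℂ T := by
  rw [spectrum.notMem_iff, ← IsUnit.neg_iff, neg_sub, ContinuousLinearMap.isUnit_iff_bijective]
  convert h using 2 with w
  change T w - algebraMap ℂ (V →L[ℂ] V) z w = _
  rw [ContinuousLinearMap.algebraMap_apply]

namespace GradientForms

variable {H L : Type*} [NormedAddCommGroup H] [InnerProductSpace ℂ H] [NormedAddCommGroup L]
  [InnerProductSpace ℂ L] (G : GradientForms H L)

theorem S₀_symm (u v : H) : G.S₀ u v = G.S₀ v u := by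
  have h1 := G.S₀_σ u (G.σ v)
  have h2 := G.S₀_σ v (G.σ u)
  rw [G.σ_σ] at h1 h2
  rw [h1, h2, ← G.D₀_σ u (G.σ v), G.σ_σ]

theorem S₁_symm (u v : H) : G.S₁ u v = G.S₁ v u := by
  have h1 := G.S₁_σ u (G.σ v)
  have h2 := G.S₁_σ v (G.σ u)
  rw [G.σ_σ] at h1 h2
  rw [h1, h2, ← G.D₁_σ u (G.σ v), G.σ_σ]

/-- The sum `S₀ + S₁` of the two forms; the Laplacian in the application. -/
def lap : H →L[ℂ] (H →L[ℂ] ℂ) := G.S₀ + G.S₁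

theorem lap_apply (u v : H) : G.lap u v = G.S₀ u v + G.S₁ u v := rfl

theorem lap_symm (u v : H) : G.lap u v = G.lap v u := by
  rw [lap_apply, lap_apply, S₀_symm, S₁_symm]

/-- The ratio `S₁ (S₀ + S₁)⁻¹`, an operator on the dual of `H`. -/
def ratio : (H →L[ℂ] ℂ) →L[ℂ] (H →L[ℂ] ℂ) := G.S₁.comp G.lap.inverse

/-! ### Eigenpairs -/

/-- The pairs `(μ, u)` with `S₁ u = μ (S₀ + S₁) u`. The eigenvectors of the ratio with eigenvalue `μ`
are the `(S₀ + S₁) u` for the non-zero `u` of this kind. -/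
def IsEigenpair (μ : ℂ) (u : H) : Prop :=
  G.S₁ u = μ • G.lap u

/-- Eigenvalues lie strictly between `0` and `1`: the eigenvalue of `u` is the Rayleigh quotient
`‖D₁ u‖² / (‖D₀ u‖² + ‖D₁ u‖²)`, and neither `D_j u` vanishes. -/
theorem IsEigenpair.exists_mem_Ioo {G : GradientForms H L} {μ : ℂ} {u : H}
    (h : G.IsEigenpair μ u) (hu : u ≠ 0) : ∃ m ∈ Ioo (0 : ℝ) 1, μ = m := by
  have h1 : G.S₁ u (G.σ u) = μ * G.lap u (G.σ u) := by rw [h]; rfl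
  rw [lap_apply, S₀_σ, S₁_σ, inner_self_eq_norm_sq_to_K, inner_self_eq_norm_sq_to_K] at h1
  have a0 : 0 < ‖G.D₀ u‖ := norm_pos_iff.2 fun h => hu (G.inj₀ u h)
  have a1 : 0 < ‖G.D₁ u‖ := norm_pos_iff.2 fun h => hu (G.inj₁ u h)
  have hs : (0 : ℝ) < ‖G.D₀ u‖ ^ 2 + ‖G.D₁ u‖ ^ 2 := by positivity
  refine ⟨‖G.D₁ u‖ ^ 2 / (‖G.D₀ u‖ ^ 2 + ‖G.D₁ u‖ ^ 2), ⟨by positivity, ?_⟩, ?_⟩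
  · rw [div_lt_one hs]
    have : 0 < ‖G.D₀ u‖ ^ 2 := by positivity
    linarith
  · rw [Complex.ofReal_div, eq_div_iff (by exact_mod_cast hs.ne')]
    push_cast
    linear_combination h1

/-- Eigenvectors for different eigenvalues are orthogonal. -/
theorem IsEigenpair.lap_eq_zero {G : GradientForms H L} {μ ν : ℂ} {u v : H}
    (hu : G.IsEigenpair μ u) (hv : G.IsEigenpair ν v) (hne : μ ≠ ν) : G.lap u v = 0 := by
  have h1 : G.S₁ u v = μ * G.lap u v := by rw [hu]; rfl
  have h2 : G.S₁ v u = ν * G.lap v u := by rw [hv]; rfl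
  rw [G.S₁_symm v, G.lap_symm v, h1] at h2
  by_contra h0
  exact hne (mul_right_cancel₀ h0 h2)

/-- There are no Jordan blocks: testing the equation for `v` with the conjugate of `u`, which is again an
eigenvector for the same real eigenvalue, shows that the energy of `u` vanishes. -/
theorem IsEigenpair.eq_zero_of_jordan {G : GradientForms H L} {μ : ℂ} {u v : H}
    (hu : G.IsEigenpair μ u) (hv : G.S₁ v = μ • G.lap v + G.lap u) : u = 0 := by
  by_contra hu0
  obtain ⟨m, -, rfl⟩ := hu.exists_mem_Ioo hu0
  -- The conjugate of `u` is an eigenvector too, since the eigenvalue is real.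
  have hconj : ∀ w, G.S₁ (G.σ u) w = m * G.lap (G.σ u) w := by
    intro w
    have h1 : G.S₁ u (G.σ w) = m * G.lap u (G.σ w) := by rw [hu]; rfl
    have h2 := congrArg (starRingEnd ℂ) h1
    rw [lap_apply, S₀_σ, S₁_σ, map_mul, map_neg, map_add, map_neg, map_neg, inner_conj_symm,
      inner_conj_symm, Complex.conj_ofReal] at h2
    rw [lap_symm, lap_apply, S₁_symm, S₀_σ, S₁_σ]
    exact h2
  have h3 : G.S₁ v (G.σ u) = m * G.lap v (G.σ u) + G.lap u (G.σ u) := by rw [hv]; rfl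
  rw [S₁_symm, hconj, G.lap_symm v, left_eq_add, lap_apply, S₀_σ, S₁_σ,
    inner_self_eq_norm_sq_to_K, inner_self_eq_norm_sq_to_K] at h3
  have h4 : ‖G.D₀ u‖ ^ 2 + ‖G.D₁ u‖ ^ 2 = 0 := by
    have : ((‖G.D₀ u‖ ^ 2 + ‖G.D₁ u‖ ^ 2 : ℝ) : ℂ) = 0 := by
      push_cast
      linear_combination -h3
    exact_mod_cast this
  refine hu0 (G.inj₀ u (norm_eq_zero.1 ?_))
  nlinarith [sq_nonneg ‖G.D₀ u‖, sq_nonneg ‖G.D₁ u‖]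

variable [CompleteSpace H] [CompleteSpace L]

/-! ### The spectrum of the ratio -/

/-- The Lax–Milgram argument: `c₀ S₀ + c₁ S₁` is an isomorphism from `H` onto its dual as soon as its
form is coercive. -/
theorem bijective_of_coercive (c₀ c₁ : ℂ) {κ : ℝ} (hκ : 0 < κ)
    (hc : ∀ s t : ℝ, 0 ≤ s → 0 ≤ t → κ * (s + t) ≤ ‖c₀ * s + c₁ * t‖) :
    Function.Bijective (c₀ • G.S₀ + c₁ • G.S₁) := by
  obtain ⟨C, hC0, hC⟩ := G.coercive
  let B : H →L[ℂ] H := c₀ • (ContinuousLinearMap.adjoint G.D₀).comp G.D₀ +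
    c₁ • (ContinuousLinearMap.adjoint G.D₁).comp G.D₁
  have hBi : ∀ u v, inner ℂ v (B u) =
      c₀ * inner ℂ (G.D₀ v) (G.D₀ u) + c₁ * inner ℂ (G.D₁ v) (G.D₁ u) := by
    intro u v
    change inner ℂ v (c₀ • ContinuousLinearMap.adjoint G.D₀ (G.D₀ u) +
      c₁ • ContinuousLinearMap.adjoint G.D₁ (G.D₁ u)) = _
    simp only [inner_add_right, inner_smul_right, ContinuousLinearMap.adjoint_inner_right]
  have hB : Function.Bijective B := by
    rw [← ContinuousLinearMap.isUnit_iff_bijective]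
    refine ContinuousLinearMap.isUnit_of_forall_le_norm_inner_map B (c := ⟨κ / C, by positivity⟩)
      (by change (0:ℝ) < κ / C; positivity) fun u => ?_
    rw [← inner_conj_symm, RCLike.norm_conj, hBi, inner_self_eq_norm_sq_to_K,
      inner_self_eq_norm_sq_to_K]
    have h1 := hc (‖G.D₀ u‖ ^ 2) (‖G.D₁ u‖ ^ 2) (by positivity) (by positivity)
    push_cast at h1
    refine le_trans ?_ h1
    have h2 := hC u
    change ‖u‖ ^ 2 * (κ / C) ≤ _
    rw [mul_div_assoc', div_le_iff₀ hC0]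
    nlinarith
  have hM : ∀ u v, (c₀ • G.S₀ + c₁ • G.S₁) u (G.σ v) = -inner ℂ v (B u) := by
    intro u v
    rw [hBi]
    change c₀ * G.S₀ u (G.σ v) + c₁ * G.S₁ u (G.σ v) = _
    rw [S₀_σ, S₁_σ]
    ring
  constructor
  · rw [injective_iff_map_eq_zero]
    intro u hu
    apply (injective_iff_map_eq_zero B).1 hB.1
    refine ext_inner_left ℂ fun v => ?_
    have := hM u v
    rw [hu] at this
    simpa using this.symm
  · intro f
    obtain ⟨u, hu⟩ := hB.2 (-G.σ ((InnerProductSpace.toDual ℂ H).symm f))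
    refine ⟨u, ContinuousLinearMap.ext fun v => ?_⟩
    have h1 := hM u (G.σ v)
    rw [G.σ_σ] at h1
    rw [h1, hu, inner_neg_right, G.inner_σ, neg_neg, InnerProductSpace.toDual_symm_apply]

theorem lap_bijective : Function.Bijective G.lap := by
  have h : G.lap = (1 : ℂ) • G.S₀ + (1 : ℂ) • G.S₁ := by rw [one_smul, one_smul]; rfl
  rw [h]
  refine G.bijective_of_coercive 1 1 one_pos fun s t hs ht => ?_
  rw [one_mul, one_mul, one_mul, ← Complex.ofReal_add, Complex.norm_real]
  exact le_abs_self _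

theorem lap_isInvertible : G.lap.IsInvertible := isInvertible_of_bijective G.lap_bijective

theorem lap_inverse (w : H →L[ℂ] ℂ) : G.lap (G.lap.inverse w) = w :=
  G.lap_isInvertible.self_apply_inverse w

theorem inverse_lap (u : H) : G.lap.inverse (G.lap u) = u :=
  G.lap_isInvertible.inverse_apply_self u

theorem ratio_lap (u : H) : G.ratio (G.lap u) = G.S₁ u := by
  rw [ratio, ContinuousLinearMap.comp_apply, inverse_lap]

/-- The ratio is symmetric for the energy inner product `⟪D₀ Δ⁻¹ w, D₀ Δ⁻¹ z⟫ + ⟪D₁ Δ⁻¹ w, D₁ Δ⁻¹ z⟫`: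
the form of the left-hand side is `⟪D₁ Δ⁻¹ w, D₁ Δ⁻¹ z⟫`. -/
theorem inner_ratio (w z : H →L[ℂ] ℂ) :
    inner ℂ (G.D₀ (G.lap.inverse z)) (G.D₀ (G.lap.inverse (G.ratio w))) +
      inner ℂ (G.D₁ (G.lap.inverse z)) (G.D₁ (G.lap.inverse (G.ratio w))) =
    inner ℂ (G.D₁ (G.lap.inverse z)) (G.D₁ (G.lap.inverse w)) := by
  have h := G.lap_inverse (G.ratio w)
  have h2 := congrArg (fun f => f (G.σ (G.lap.inverse z))) h
  beta_reduce at h2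
  rw [lap_apply, S₀_σ, S₁_σ, ratio, ContinuousLinearMap.comp_apply, S₁_σ, ← neg_add, neg_inj] at h2
  exact h2

/-- A version of `inner_ratio` in which the operators occur as functions. -/
theorem inner_ratio_of_eq {d₀ d₁ : H → L} {R : (H →L[ℂ] ℂ) → H} {P : (H →L[ℂ] ℂ) → (H →L[ℂ] ℂ)}
    (h₀ : ∀ u, d₀ u = G.D₀ u) (h₁ : ∀ u, d₁ u = G.D₁ u) (hR : ∀ w, R w = G.lap.inverse w)
    (hP : ∀ w, P w = G.ratio w) (w z : H →L[ℂ] ℂ) :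
    inner ℂ (d₀ (R z)) (d₀ (R (P w))) + inner ℂ (d₁ (R z)) (d₁ (R (P w))) =
      inner ℂ (d₁ (R z)) (d₁ (R w)) := by
  simp only [h₀, h₁, hR, hP, inner_ratio]

theorem spectrum_ratio_subset : spectrum ℂ G.ratio ⊆ Complex.ofReal '' Icc (0 : ℝ) 1 := by
  intro z hz
  by_contra hzn
  refine notMem_spectrum_of_bijective G.ratio ?_ hz
  -- The distance of `z` to the segment is the coercivity constant.
  have hcl : IsClosed (Complex.ofReal '' Icc (0 : ℝ) 1) :=
    (isCompact_Icc.image Complex.continuous_ofReal).isClosed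
  obtain ⟨κ, hκ, hball⟩ := Metric.isOpen_iff.1 hcl.isOpen_compl z hzn
  have hd : ∀ s ∈ Icc (0 : ℝ) 1, κ ≤ ‖(s : ℂ) - z‖ := by
    intro s hs
    by_contra! h
    refine hball (a := (s : ℂ)) ?_ ⟨s, hs, rfl⟩
    rwa [Metric.mem_ball, dist_eq_norm]
  have hbij := G.bijective_of_coercive (-z) (1 - z) hκ (by
    intro s t hs ht
    rcases (add_nonneg hs ht).eq_or_lt with h | h
    · rw [← h, mul_zero]; exact norm_nonneg _
    · have hne : ((s : ℂ) + t) ≠ 0 := by exact_mod_cast h.ne'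
      have e : -z * s + (1 - z) * t = (((t / (s + t) : ℝ) : ℂ) - z) * ((s + t : ℝ) : ℂ) := by
        push_cast
        field_simp
        ring
      rw [e, norm_mul, Complex.norm_real, Real.norm_of_nonneg h.le]
      gcongr
      apply hd
      exact ⟨by positivity, div_le_one_of_le₀ (by linarith) h.le⟩)
  have e : (fun w => G.ratio w - z • w) ∘ G.lap = ⇑((-z) • G.S₀ + (1 - z) • G.S₁) := by
    funext u
    refine ContinuousLinearMap.ext fun v => ?_
    change G.ratio (G.lap u) v - z * G.lap u v = -z * G.S₀ u v + (1 - z) * G.S₁ u v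
    rw [ratio_lap, lap_apply]
    ring
  rw [← e] at hbij
  exact (Function.Bijective.of_comp_iff _ G.lap_bijective).1 hbij

theorem lap_mem_eigenspace {μ : ℂ} {u : H} (h : G.IsEigenpair μ u) :
    G.lap u ∈ Module.End.eigenspace (G.ratio : (H →L[ℂ] ℂ) →ₗ[ℂ] (H →L[ℂ] ℂ)) μ := by
  rw [Module.End.mem_eigenspace_iff, ← h]
  exact G.ratio_lap u

theorem mem_eigenvalues_iff (μ : ℂ) :
    μ ∈ eigenvalues G.ratio ↔ ∃ u, G.IsEigenpair μ u ∧ u ≠ 0 := by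
  constructor
  · intro h
    obtain ⟨w, hw, hw0⟩ := Module.End.HasEigenvalue.exists_hasEigenvector h
    rw [Module.End.mem_eigenspace_iff] at hw
    refine ⟨G.lap.inverse w, ?_, fun h0 => hw0 ?_⟩
    · rw [IsEigenpair, lap_inverse]; exact hw
    · rw [← G.lap_inverse w, h0, map_zero]
  · rintro ⟨u, hu, hu0⟩
    refine Module.End.hasEigenvalue_of_hasEigenvector (x := G.lap u)
      ⟨G.lap_mem_eigenspace hu, fun h0 => hu0 ?_⟩
    rw [← G.inverse_lap u, h0, map_zero]

/-- A family of eigenpairs is complete if only `0` is orthogonal to it. -/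
def IsComplete {H L : Type*} [NormedAddCommGroup H] [InnerProductSpace ℂ H] [NormedAddCommGroup L]
    [InnerProductSpace ℂ L] (G : GradientForms H L) (E : Set (ℂ × H)) : Prop :=
  (∀ e ∈ E, G.IsEigenpair e.1 e.2 ∧ e.2 ≠ 0) ∧ ∀ v, (∀ e ∈ E, G.lap e.2 v = 0) → v = 0

/-- There are no other eigenvalues, since an eigenvector for another one is orthogonal to the family. -/
theorem IsComplete.eigenvalues_eq {G : GradientForms H L} {E : Set (ℂ × H)} (hE : G.IsComplete E) :
    eigenvalues G.ratio = Prod.fst '' E := by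
  ext μ
  rw [mem_eigenvalues_iff]
  constructor
  · rintro ⟨u, hu, hu0⟩
    by_contra hμ
    refine hu0 (hE.2 u fun e he => ?_)
    exact (hE.1 e he).1.lap_eq_zero hu fun h => hμ ⟨e, he, h⟩
  · rintro ⟨e, he, rfl⟩
    exact ⟨e.2, hE.1 e he⟩

theorem IsComplete.hasPurePointSpectrum {G : GradientForms H L} {E : Set (ℂ × H)}
    (hE : G.IsComplete E) : HasPurePointSpectrum G.ratio := by
  have hd : Dense ((Submodule.span ℂ (Prod.snd '' E) : Submodule ℂ H) : Set H) := by
    rw [Submodule.dense_iff_topologicalClosure_eq_top, Submodule.topologicalClosure_eq_top_iff,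
      Submodule.eq_bot_iff]
    intro x hx
    -- Represent the functional `⟪x, ·⟫` as `Δ v`.
    obtain ⟨v, hv⟩ := G.lap_bijective.2 (InnerProductSpace.toDual ℂ H x)
    have hvx : ∀ u, G.lap v u = inner ℂ x u := fun u => by
      rw [hv, InnerProductSpace.toDual_apply_apply]
    have hv0 : v = 0 := hE.2 v fun e he => by
      rw [lap_symm, hvx]
      exact (Submodule.mem_orthogonal' _ x).1 hx _ (Submodule.subset_span ⟨e, he, rfl⟩)
    have := hvx x
    rw [hv0, map_zero] at this
    exact inner_self_eq_zero.1 this.symm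
  refine (G.lap_bijective.2.denseRange.dense_image G.lap.continuous hd).mono ?_
  rintro _ ⟨u, hu, rfl⟩
  have : Submodule.span ℂ (Prod.snd '' E) ≤ (⨆ μ : ℂ, Module.End.eigenspace
      (G.ratio : (H →L[ℂ] ℂ) →ₗ[ℂ] (H →L[ℂ] ℂ)) μ).comap (G.lap : H →ₗ[ℂ] (H →L[ℂ] ℂ)) := by
    rw [Submodule.span_le]
    rintro _ ⟨e, he, rfl⟩
    exact Submodule.mem_iSup_of_mem e.1 (G.lap_mem_eigenspace (hE.1 e he).1)
  exact this hu

theorem IsComplete.spectrum_eq {G : GradientForms H L} {E : Set (ℂ × H)} (hE : G.IsComplete E)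
    (h : closure (Prod.fst '' E) = Complex.ofReal '' Icc (0 : ℝ) 1) :
    spectrum ℂ G.ratio = Complex.ofReal '' Icc (0 : ℝ) 1 := by
  refine G.spectrum_ratio_subset.antisymm ?_
  rw [← h, ← hE.eigenvalues_eq]
  exact closure_eigenvalues_subset_spectrum _

end GradientForms

section

variable {Ω : Set Plane}

/-! ### Complex conjugation on `H¹₀(Ω)` -/

/-- Complex conjugation on `L²(Ω)`. -/
def conjL2 (Ω : Set Plane) : L2 Ω →L[ℝ] L2 Ω :=
  (Complex.conjCLE : ℂ →L[ℝ] ℂ).compLpL 2 ((volume : Measure Plane).restrict Ω)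

theorem coeFn_conjL2 (f : L2 Ω) :
    conjL2 Ω f =ᵐ[volume.restrict Ω] fun x => (starRingEnd ℂ) (f x) := by
  filter_upwards [(Complex.conjCLE : ℂ →L[ℝ] ℂ).coeFn_compLpL f] with x hx
  simpa [conjL2] using hx

theorem conjL2_conjL2 (f : L2 Ω) : conjL2 Ω (conjL2 Ω f) = f := by
  apply Lp.ext
  filter_upwards [coeFn_conjL2 (conjL2 Ω f), coeFn_conjL2 f] with x h1 h2
  rw [h1, h2, Complex.conj_conj]

theorem L2pairing_apply (f g : L2 Ω) : L2pairing Ω f g = ∫ x in Ω, f x * g x := by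
  simp [L2pairing, ContinuousLinearMap.lpPairing_eq_integral]

theorem L2pairing_comm (f g : L2 Ω) : L2pairing Ω f g = L2pairing Ω g f := by
  simp only [L2pairing_apply, mul_comm]

theorem L2pairing_conjL2 (f g : L2 Ω) : L2pairing Ω f (conjL2 Ω g) = inner ℂ g f := by
  rw [L2pairing_apply, MeasureTheory.L2.inner_def]
  apply integral_congr_ae
  filter_upwards [coeFn_conjL2 g] with x h1
  simp [h1]

theorem inner_eq_integral (f g : L2 Ω) :
    inner ℂ f g = ∫ x in Ω, g x * (starRingEnd ℂ) (f x) := MeasureTheory.L2.inner_def f g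

theorem add_inner_conj_symm (f g f' g' : L2 Ω) : inner ℂ f g + inner ℂ f' g' =
    (starRingEnd ℂ) (inner ℂ g f + inner ℂ g' f') := by
  rw [map_add, inner_conj_symm, inner_conj_symm]

theorem inner_conjL2 (f g : L2 Ω) : inner ℂ (conjL2 Ω f) (conjL2 Ω g) = inner ℂ g f := by
  rw [← L2pairing_conjL2, conjL2_conjL2, L2pairing_comm, L2pairing_conjL2]

/-- Componentwise complex conjugation of a triple of `L²` functions. -/
def conjJet (K : Jet Ω) : Jet Ω := WithLp.toLp 2 fun i => conjL2 Ω (K i)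

theorem continuous_conjJet : Continuous (conjJet : Jet Ω → Jet Ω) := by
  unfold conjJet
  refine (PiLp.continuous_toLp 2 _).comp (continuous_pi fun i => (conjL2 Ω).continuous.comp ?_)
  exact (PiLp.continuous_apply 2 (fun _ : Option (Fin 2) => L2 Ω) i)

theorem IsTestFunction.conj {φ : Plane → ℂ} (h : IsTestFunction Ω φ) :
    IsTestFunction Ω (fun x => (starRingEnd ℂ) (φ x)) := by
  have hs : Function.support (fun x => (starRingEnd ℂ) (φ x)) = Function.support φ := by
    ext x; simp
  refine ⟨Complex.conjCLE.contDiff.comp h.smooth, ?_, ?_⟩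
  · have := h.compact; unfold HasCompactSupport tsupport at *; rwa [hs]
  · have := h.support; unfold tsupport at *; rwa [hs]

theorem partialDeriv_conj {φ : Plane → ℂ} {x : Plane} (h : DifferentiableAt ℝ φ x) (j : Fin 2) :
    partialDeriv j (fun x => (starRingEnd ℂ) (φ x)) x = (starRingEnd ℂ) (partialDeriv j φ x) := by
  have := (Complex.conjCLE : ℂ →L[ℝ] ℂ).hasFDerivAt.comp x h.hasFDerivAt
  unfold partialDeriv
  have h2 : HasFDerivAt (fun x => (starRingEnd ℂ) (φ x))
    ((Complex.conjCLE : ℂ →L[ℝ] ℂ).comp (fderiv ℝ φ x)) x := this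
  rw [h2.fderiv]; simp

theorem IsTestFunction.differentiable {φ : Plane → ℂ} (h : IsTestFunction Ω φ) :
    Differentiable ℝ φ := h.smooth.differentiable (by simp)

theorem conjJet_mem_testJets {K : Jet Ω} (hK : K ∈ testJets Ω) : conjJet K ∈ testJets Ω := by
  obtain ⟨φ, hφ, h0, h1⟩ := hK
  refine ⟨_, hφ.conj, ?_, fun j => ?_⟩
  · filter_upwards [coeFn_conjL2 (K none), h0] with x hx hx0
    simpa [conjJet, hx0] using hx
  · filter_upwards [coeFn_conjL2 (K (some j)), h1 j] with x hx hx0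
    rw [partialDeriv_conj (hφ.differentiable x)]
    simpa [conjJet, hx0] using hx

theorem conjJet_mem_H10 {K : Jet Ω} (hK : K ∈ H10 Ω) : conjJet K ∈ H10 Ω := by
  have : MapsTo conjJet (testJets Ω : Set (Jet Ω)) (testJets Ω) := fun K hK =>
    conjJet_mem_testJets hK
  exact this.closure continuous_conjJet hK

/-- Complex conjugation on `H¹₀(Ω)`. -/
def conjH (u : H10 Ω) : H10 Ω := ⟨conjJet u, conjJet_mem_H10 u.2⟩

theorem weakDeriv_conjH (j : Fin 2) (u : H10 Ω) :
    weakDeriv Ω j (conjH u) = conjL2 Ω (weakDeriv Ω j u) := rfl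

theorem conjH_conjH (u : H10 Ω) : conjH (conjH u) = u := by
  apply Subtype.ext
  apply PiLp.ext
  intro i
  exact conjL2_conjL2 _

theorem inner_conjH (u v : H10 Ω) : inner ℂ (conjH u) (conjH v) = inner ℂ v u := by
  rw [Submodule.coe_inner, Submodule.coe_inner, PiLp.inner_apply, PiLp.inner_apply]
  exact Finset.sum_congr rfl fun i _ => inner_conjL2 _ _

/-! ### The quadratic forms -/

theorem secondDeriv_eq_pairing (j : Fin 2) (u v : H10 Ω) :
    secondDeriv Ω j u v = -L2pairing Ω (weakDeriv Ω j u) (weakDeriv Ω j v) := rfl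

theorem secondDeriv_conjH (j : Fin 2) (u v : H10 Ω) :
    secondDeriv Ω j u (conjH v) = -inner ℂ (weakDeriv Ω j v) (weakDeriv Ω j u) := by
  rw [secondDeriv_eq_pairing, weakDeriv_conjH, L2pairing_conjL2]

theorem norm_sq_H10 (u : H10 Ω) : ‖u‖ ^ 2 =
    ‖(u : Jet Ω) none‖ ^ 2 + ‖weakDeriv Ω 0 u‖ ^ 2 + ‖weakDeriv Ω 1 u‖ ^ 2 := by
  rw [Submodule.coe_norm, PiLp.norm_sq_eq_of_L2, Fintype.sum_option, Fin.sum_univ_two]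
  rw [add_assoc]; rfl

theorem H10_eq_zero {u : H10 Ω} (h : (u : Jet Ω) none = 0) (h0 : weakDeriv Ω 0 u = 0)
    (h1 : weakDeriv Ω 1 u = 0) : u = 0 := by
  have := norm_sq_H10 u
  rw [h, h0, h1] at this
  simpa using this

/-! ### Smooth functions on `Ω` and integration by parts -/

/-- Smooth complex-valued functions on the whole plane. -/
abbrev IsSmooth (f : Plane → ℂ) : Prop := ContDiff ℝ ((⊤ : ℕ∞) : WithTop ℕ∞) f

theorem IsSmooth.partialDeriv {f : Plane → ℂ} (hf : IsSmooth f) (j : Fin 2) :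
    IsSmooth (partialDeriv j f) :=
  (hf.fderiv_right (m := ((⊤ : ℕ∞) : WithTop ℕ∞)) (by simp)).clm_apply contDiff_const

theorem IsSmooth.differentiable {f : Plane → ℂ} (hf : IsSmooth f) : Differentiable ℝ f :=
  ContDiff.differentiable hf (by simp)

theorem partialDeriv_mul {f g : Plane → ℂ} {x : Plane} (hf : DifferentiableAt ℝ f x)
    (hg : DifferentiableAt ℝ g x) (j : Fin 2) :
    partialDeriv j (fun x => f x * g x) x = partialDeriv j f x * g x + f x * partialDeriv j g x := by
  unfold partialDeriv
  rw [fderiv_fun_mul hf hg]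
  simp
  ring

theorem partialDeriv_add {f g : Plane → ℂ} {x : Plane} (hf : DifferentiableAt ℝ f x)
    (hg : DifferentiableAt ℝ g x) (j : Fin 2) :
    partialDeriv j (fun x => f x + g x) x = partialDeriv j f x + partialDeriv j g x := by
  unfold partialDeriv
  rw [fderiv_fun_add hf hg]
  simp

theorem partialDeriv_coord (j : Fin 2) (x : Plane) :
    partialDeriv j (fun x => ((x j : ℝ) : ℂ)) x = 1 := by
  have h : HasFDerivAt (fun x : Plane => ((x j : ℝ) : ℂ))
      (Complex.ofRealCLM.comp (EuclideanSpace.proj j : Plane →L[ℝ] ℝ)) x :=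
    (Complex.ofRealCLM.comp (EuclideanSpace.proj j : Plane →L[ℝ] ℝ)).hasFDerivAt
  unfold partialDeriv
  rw [h.fderiv]
  simp

theorem isSmooth_coord (j : Fin 2) : IsSmooth (fun x => ((x j : ℝ) : ℂ)) :=
  (Complex.ofRealCLM.comp (EuclideanSpace.proj j : Plane →L[ℝ] ℝ)).contDiff

theorem integral_mul_partialDeriv {f φ : Plane → ℂ} (hf : IsSmooth f) (hφ : IsTestFunction Ω φ)
    (j : Fin 2) :
    ∫ x in Ω, f x * partialDeriv j φ x = -∫ x in Ω, partialDeriv j f x * φ x := by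
  have hd : ∀ x, x ∉ tsupport φ → partialDeriv j φ x = 0 := by
    intro x hx
    have : fderiv ℝ φ x = 0 := by
      by_contra h
      exact hx (support_fderiv_subset ℝ h)
    simp [partialDeriv, this]
  have hc : HasCompactSupport (partialDeriv j φ) :=
    HasCompactSupport.intro hφ.compact hd
  have hcφ : Continuous (partialDeriv j φ) := (IsSmooth.partialDeriv hφ.smooth j).continuous
  have hcf : Continuous (partialDeriv j f) := (hf.partialDeriv j).continuous
  rw [setIntegral_eq_integral_of_forall_compl_eq_zero,
    setIntegral_eq_integral_of_forall_compl_eq_zero]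
  · refine integral_mul_fderiv_eq_neg_fderiv_mul_of_integrable ?_ ?_ ?_
      (fun x _ => hf.differentiable x) (fun x _ => hφ.differentiable x)
    · exact (hcf.mul hφ.smooth.continuous).integrable_of_hasCompactSupport hφ.compact.mul_left
    · exact (hf.continuous.mul hcφ).integrable_of_hasCompactSupport hc.mul_left
    · exact (hf.continuous.mul hφ.smooth.continuous).integrable_of_hasCompactSupport
        hφ.compact.mul_left
  · intro x hx
    rw [image_eq_zero_of_notMem_tsupport fun h => hx (hφ.support h), mul_zero]
  · intro x hx
    rw [hd x fun h => hx (hφ.support h), mul_zero]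

/-- Bounded open sets. -/
structure IsBoundedOpen (Ω : Set Plane) : Prop where
  isOpen : IsOpen Ω
  isBounded : Bornology.IsBounded Ω

namespace IsBoundedOpen

theorem isFiniteMeasure (hΩ : IsBoundedOpen Ω) :
    IsFiniteMeasure ((volume : Measure Plane).restrict Ω) :=
  ⟨by rw [Measure.restrict_apply_univ]; exact hΩ.isBounded.measure_lt_top⟩

theorem exists_bound (hΩ : IsBoundedOpen Ω) {f : Plane → ℂ} (hf : Continuous f) :
    ∃ C, ∀ x ∈ Ω, ‖f x‖ ≤ C := by
  obtain ⟨C, hC⟩ := hΩ.isBounded.isCompact_closure.exists_bound_of_continuousOn hf.continuousOn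
  exact ⟨C, fun x hx => hC x (subset_closure hx)⟩

theorem memLp (hΩ : IsBoundedOpen Ω) {f : Plane → ℂ} (hf : Continuous f) :
    MemLp f 2 ((volume : Measure Plane).restrict Ω) := by
  have := hΩ.isFiniteMeasure
  obtain ⟨C, hC⟩ := hΩ.exists_bound hf
  exact MemLp.of_bound hf.aestronglyMeasurable C
    (ae_restrict_of_forall_mem hΩ.isOpen.measurableSet hC)

/-- The restriction to `Ω` of a continuous function, as an element of `L²(Ω)`. -/
def toL2 (hΩ : IsBoundedOpen Ω) (f : Plane → ℂ) (hf : Continuous f) : L2 Ω := (hΩ.memLp hf).toLp f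

theorem coeFn_toL2 (hΩ : IsBoundedOpen Ω) {f : Plane → ℂ} (hf : Continuous f) :
    hΩ.toL2 f hf =ᵐ[volume.restrict Ω] f := (hΩ.memLp hf).coeFn_toLp

theorem pairing_toL2 (hΩ : IsBoundedOpen Ω) {f : Plane → ℂ} (hf : Continuous f) (g : L2 Ω) :
    L2pairing Ω (hΩ.toL2 f hf) g = ∫ x in Ω, f x * g x := by
  rw [L2pairing_apply]
  apply integral_congr_ae
  filter_upwards [hΩ.coeFn_toL2 hf] with x hx
  rw [hx]

/-- Integration by parts of a smooth function, without boundary conditions, against a function in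
`H¹₀(Ω)`. -/
theorem integral_mul_weakDeriv (hΩ : IsBoundedOpen Ω) {f : Plane → ℂ} (hf : IsSmooth f) (j : Fin 2)
    (u : H10 Ω) :
    ∫ x in Ω, f x * weakDeriv Ω j u x = -∫ x in Ω, partialDeriv j f x * (u : Jet Ω) none x := by
  have hf' := hf.partialDeriv j
  rw [← hΩ.pairing_toL2 hf.continuous, ← hΩ.pairing_toL2 hf'.continuous]
  let p (i : Option (Fin 2)) := PiLp.continuous_apply 2 (fun _ : Option (Fin 2) => L2 Ω) i
  have hcl : IsClosed {K : Jet Ω | L2pairing Ω (hΩ.toL2 f hf.continuous) (K (some j)) =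
      -L2pairing Ω (hΩ.toL2 _ hf'.continuous) (K none)} :=
    isClosed_eq ((L2pairing Ω _).continuous.comp (p _)) ((L2pairing Ω _).continuous.comp (p _)).neg
  refine closure_minimal ?_ hcl u.2
  rintro K ⟨φ, hφ, h0, h1⟩
  rw [mem_ofPred_eq, hΩ.pairing_toL2, hΩ.pairing_toL2]
  have e1 : ∫ x in Ω, f x * K (some j) x = ∫ x in Ω, f x * partialDeriv j φ x := by
    apply integral_congr_ae
    filter_upwards [h1 j] with x hx
    rw [hx]
  have e2 : ∫ x in Ω, partialDeriv j f x * K none x = ∫ x in Ω, partialDeriv j f x * φ x := by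
    apply integral_congr_ae
    filter_upwards [h0] with x hx
    rw [hx]
  rw [e1, e2, integral_mul_partialDeriv hf hφ]

theorem ae_eq_zero_of_integral (hΩ : IsBoundedOpen Ω) {g : Plane → ℂ} (hg : IntegrableOn g Ω)
    (h : ∀ f : Plane → ℂ, IsSmooth f → ∫ x in Ω, f x * g x = 0) :
    ∀ᵐ x ∂(volume.restrict Ω), g x = 0 := by
  rw [ae_restrict_iff' hΩ.isOpen.measurableSet]
  refine hΩ.isOpen.ae_eq_zero_of_integral_contDiff_smul_eq_zero (μ := volume) (f := g)
    hg.locallyIntegrableOn (fun φ hφ _ hφs => ?_)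
  rw [← h (fun x => (φ x : ℂ)) (Complex.ofRealCLM.contDiff.comp hφ),
    setIntegral_eq_integral_of_forall_compl_eq_zero]
  · simp
  · intro x hx
    rw [image_eq_zero_of_notMem_tsupport fun h => hx (hφs h)]
    simp

theorem integrable_L2 (hΩ : IsBoundedOpen Ω) (g : L2 Ω) : IntegrableOn g Ω := by
  have := hΩ.isFiniteMeasure
  exact (Lp.memLp g).integrable (by norm_num)

theorem eq_zero_of_ae (g : L2 Ω) (h : ∀ᵐ x ∂(volume.restrict Ω), g x = 0) : g = 0 := by
  apply Lp.ext
  filter_upwards [h, Lp.coeFn_zero ℂ 2 (volume.restrict Ω)] with x h1 h2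
  rw [h1, h2]; rfl

theorem weakDeriv_eq_zero (hΩ : IsBoundedOpen Ω) {u : H10 Ω} (hu : (u : Jet Ω) none = 0)
    (j : Fin 2) : weakDeriv Ω j u = 0 := by
  refine eq_zero_of_ae _ (hΩ.ae_eq_zero_of_integral (hΩ.integrable_L2 _) fun f hf => ?_)
  rw [hΩ.integral_mul_weakDeriv hf, hu, neg_eq_zero]
  rw [← integral_zero Plane ℂ (μ := volume.restrict Ω)]
  apply integral_congr_ae
  filter_upwards [Lp.coeFn_zero ℂ 2 (volume.restrict Ω)] with x h2
  rw [h2]; simp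

theorem H10_eq_zero (hΩ : IsBoundedOpen Ω) {u : H10 Ω} (hu : (u : Jet Ω) none = 0) : u = 0 :=
  InternalWaves.H10_eq_zero hu (hΩ.weakDeriv_eq_zero hu 0) (hΩ.weakDeriv_eq_zero hu 1)

/-! ### The Poincaré inequality -/

/-- The Poincaré inequality for test functions, from `∫ |φ|² = -∫ x_j ∂_j |φ|²`. -/
theorem norm_le_of_mem_testJets (hΩ : IsBoundedOpen Ω) {R : ℝ} (hR0 : 0 ≤ R) (hR : ∀ x ∈ Ω, ∀ j, |x j| ≤ R)
    {K : Jet Ω} (hK : K ∈ testJets Ω) (j : Fin 2) : ‖K none‖ ≤ 2 * R * ‖K (some j)‖ := by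
  obtain ⟨φ, hφ, h0, h1⟩ := hK
  have hc : Continuous (fun x : Plane => ((x j : ℝ) : ℂ) * φ x) :=
    (isSmooth_coord j).continuous.mul hφ.smooth.continuous
  set M : L2 Ω := hΩ.toL2 (fun x => ((x j : ℝ) : ℂ) * φ x) hc with hM
  have hMK : ‖M‖ ≤ R * ‖K none‖ := by
    apply Lp.norm_le_mul_norm_of_ae_le_mul
    filter_upwards [hΩ.coeFn_toL2 hc, h0, ae_restrict_mem hΩ.isOpen.measurableSet] with x hx hx0 hxΩ
    rw [hM, hx, hx0, norm_mul, Complex.norm_real]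
    exact mul_le_mul_of_nonneg_right (hR x hxΩ j) (norm_nonneg _)
  have key : inner ℂ (K none) (K none) = -inner ℂ M (K (some j)) - inner ℂ (K (some j)) M := by
    have e0 : inner ℂ (K none) (K none) = ∫ x in Ω, φ x * (starRingEnd ℂ) (φ x) := by
      rw [MeasureTheory.L2.inner_def]
      apply integral_congr_ae
      filter_upwards [h0] with x hx
      rw [hx, RCLike.inner_apply]
    have e1 : inner ℂ M (K (some j)) =
        ∫ x in Ω, ((x j : ℝ) : ℂ) * (starRingEnd ℂ) (φ x) * partialDeriv j φ x := by
      rw [MeasureTheory.L2.inner_def]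
      apply integral_congr_ae
      filter_upwards [h1 j, hΩ.coeFn_toL2 hc] with x hx hx1
      rw [hM, hx, hx1]; simp; ring
    have e2 : inner ℂ (K (some j)) M =
        ∫ x in Ω, ((x j : ℝ) : ℂ) * (starRingEnd ℂ) (partialDeriv j φ x) * φ x := by
      rw [MeasureTheory.L2.inner_def]
      apply integral_congr_ae
      filter_upwards [h1 j, hΩ.coeFn_toL2 hc] with x hx hx1
      rw [hM, hx, hx1]; simp; ring
    have hψ := hφ.conj
    have hψs : IsSmooth (fun x => (starRingEnd ℂ) (φ x)) := hψ.smooth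
    have hdc : Continuous (partialDeriv j φ) := (IsSmooth.partialDeriv hφ.smooth j).continuous
    have hint : ∀ {g : Plane → ℂ}, Continuous g → Integrable g (volume.restrict Ω) := fun hg => by
      have := hΩ.isFiniteMeasure
      exact (hΩ.memLp hg).integrable (by norm_num)
    rw [e0, e1, e2, integral_mul_partialDeriv ((isSmooth_coord j).mul hψs) hφ, neg_neg,
      ← integral_sub]
    · apply integral_congr_ae
      refine Eventually.of_forall fun x => ?_
      have hx1 := (isSmooth_coord j).differentiable x
      have hx2 := hψs.differentiable x
      have hx3 := partialDeriv_mul hx1 hx2 j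
      have hx4 := partialDeriv_conj (hφ.differentiable x) j
      rw [hx4, partialDeriv_coord] at hx3
      beta_reduce
      rw [hx3]
      ring
    · refine hint ?_
      exact (IsSmooth.partialDeriv ((isSmooth_coord j).mul hψs) j).continuous.mul
        hφ.smooth.continuous
    · refine hint ?_
      exact ((isSmooth_coord j).continuous.mul (Complex.continuous_conj.comp hdc)).mul
        hφ.smooth.continuous
  have h2 : ‖K none‖ ^ 2 ≤ 2 * (R * ‖K none‖ * ‖K (some j)‖) := by
    have e := congrArg norm key
    rw [inner_self_eq_norm_sq_to_K, norm_pow, RCLike.norm_ofReal, abs_norm] at e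
    rw [e]
    have n1 := norm_inner_le_norm (𝕜 := ℂ) M (K (some j))
    have n2 := norm_inner_le_norm (𝕜 := ℂ) (K (some j)) M
    have n3 := norm_sub_le (-inner ℂ M (K (some j))) (inner ℂ (K (some j)) M)
    rw [norm_neg] at n3
    nlinarith [norm_nonneg (K (some j)), mul_le_mul_of_nonneg_right hMK (norm_nonneg (K (some j)))]
  rcases (norm_nonneg (K none)).eq_or_lt with h3 | h3
  · rw [← h3]; positivity
  · nlinarith

theorem exists_poincare (hΩ : IsBoundedOpen Ω) :
    ∃ C : ℝ, ∀ (j : Fin 2) (u : H10 Ω), ‖(u : Jet Ω) none‖ ≤ C * ‖weakDeriv Ω j u‖ := by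
  obtain ⟨R, hR0, hR⟩ := hΩ.isBounded.exists_pos_norm_le
  refine ⟨2 * R, fun j u => ?_⟩
  let p (i : Option (Fin 2)) := PiLp.continuous_apply 2 (fun _ : Option (Fin 2) => L2 Ω) i
  have hcl : IsClosed {K : Jet Ω | ‖K none‖ ≤ 2 * R * ‖K (some j)‖} :=
    isClosed_le (p _).norm ((p _).norm.const_mul _)
  refine closure_minimal ?_ hcl u.2
  intro K hK
  refine hΩ.norm_le_of_mem_testJets hR0.le (fun x hx j => ?_) hK j
  rw [← Real.norm_eq_abs]
  exact (PiLp.norm_apply_le x j).trans (hR x hx)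

theorem eq_zero_of_weakDeriv (hΩ : IsBoundedOpen Ω) {u : H10 Ω} {j : Fin 2}
    (h : weakDeriv Ω j u = 0) : u = 0 := by
  obtain ⟨C, hC⟩ := hΩ.exists_poincare
  have := hC j u
  rw [h, norm_zero, mul_zero] at this
  exact hΩ.H10_eq_zero (norm_le_zero_iff.1 this)

/-- The forms `∂₁²` and `∂₂²` on `H¹₀(Ω)`. The sum of the two is the Dirichlet Laplacian, and their ratio is
the Poincaré operator. -/
def forms (hΩ : IsBoundedOpen Ω) : GradientForms (H10 Ω) (L2 Ω) where
  D₀ := weakDeriv Ω 0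
  D₁ := weakDeriv Ω 1
  S₀ := secondDeriv Ω 0
  S₁ := secondDeriv Ω 1
  σ := conjH
  σ_σ := conjH_conjH
  inner_σ := inner_conjH
  D₀_σ _ _ := inner_conjL2 _ _
  D₁_σ _ _ := inner_conjL2 _ _
  S₀_σ := secondDeriv_conjH 0
  S₁_σ := secondDeriv_conjH 1
  inj₀ _ := hΩ.eq_zero_of_weakDeriv
  inj₁ _ := hΩ.eq_zero_of_weakDeriv
  coercive := by
    obtain ⟨C, hC⟩ := hΩ.exists_poincare
    refine ⟨C ^ 2 + 1, by positivity, fun u => ?_⟩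
    have h1 := pow_le_pow_left₀ (norm_nonneg _) (hC 0 u) 2
    rw [norm_sq_H10]
    nlinarith [sq_nonneg (C * ‖weakDeriv Ω 1 u‖)]

theorem dirichletLaplacian_isInvertible (hΩ : IsBoundedOpen Ω) :
    (dirichletLaplacian Ω).IsInvertible := hΩ.forms.lap_isInvertible

theorem hm1Inner_eq_inner (w z : Hm1 Ω) : hm1Inner Ω w z =
    inner ℂ (weakDeriv Ω 0 (solutionOperator Ω z)) (weakDeriv Ω 0 (solutionOperator Ω w)) +
      inner ℂ (weakDeriv Ω 1 (solutionOperator Ω z)) (weakDeriv Ω 1 (solutionOperator Ω w)) :=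
  (Fin.sum_univ_two _).trans
    (congrArg₂ (· + ·) (inner_eq_integral _ _).symm (inner_eq_integral _ _).symm)

theorem hm1Inner_symm (w z : Hm1 Ω) : hm1Inner Ω w z = (starRingEnd ℂ) (hm1Inner Ω z w) := by
  rw [hm1Inner_eq_inner, hm1Inner_eq_inner]
  exact add_inner_conj_symm _ _ _ _

theorem hm1Inner_poincareOperator_eq (hΩ : IsBoundedOpen Ω) (w z : Hm1 Ω) :
    hm1Inner Ω (poincareOperator Ω w) z =
      (inner ℂ (weakDeriv Ω 1 (solutionOperator Ω z) : L2 Ω)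
        (weakDeriv Ω 1 (solutionOperator Ω w) : L2 Ω) : ℂ) := by
  have h := hΩ.forms.inner_ratio_of_eq (d₀ := fun u => weakDeriv Ω 0 u)
    (d₁ := fun u => weakDeriv Ω 1 u) (R := fun w => solutionOperator Ω w)
    (P := fun w => poincareOperator Ω w) (fun _ => rfl) (fun _ => rfl) (fun _ => rfl) (fun _ => rfl)
    w z
  exact (hm1Inner_eq_inner (poincareOperator Ω w) z).trans h

theorem hm1Inner_poincareOperator (hΩ : IsBoundedOpen Ω) (w z : Hm1 Ω) :
    hm1Inner Ω (poincareOperator Ω w) z = hm1Inner Ω w (poincareOperator Ω z) := by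
  have h1 := hΩ.hm1Inner_poincareOperator_eq w z
  have h2 := hΩ.hm1Inner_poincareOperator_eq z w
  have h3 := hm1Inner_symm w (poincareOperator Ω z)
  exact h1.trans ((inner_conj_symm (𝕜 := ℂ) (E := L2 Ω) _ _).symm.trans
    (h3.trans (congrArg (starRingEnd ℂ) h2)).symm)

theorem spectrum_eq (hΩ : IsBoundedOpen Ω) {E : Set (ℂ × H10 Ω)} (hE : hΩ.forms.IsComplete E)
    (h : closure (Prod.fst '' E) = Complex.ofReal '' Icc (0 : ℝ) 1) :
    spectrum ℂ (poincareOperator Ω) = Complex.ofReal '' Icc (0 : ℝ) 1 :=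
  hE.spectrum_eq h

theorem eigenvalues_eq (hΩ : IsBoundedOpen Ω) {E : Set (ℂ × H10 Ω)} (hE : hΩ.forms.IsComplete E) :
    eigenvalues (poincareOperator Ω) = Prod.fst '' E := by
  have h : eigenvalues (poincareOperator Ω) = eigenvalues hΩ.forms.ratio := rfl
  rw [h]
  exact hE.eigenvalues_eq

theorem hasPurePointSpectrum (hΩ : IsBoundedOpen Ω) {E : Set (ℂ × H10 Ω)}
    (hE : hΩ.forms.IsComplete E) : HasPurePointSpectrum (poincareOperator Ω) :=
  hE.hasPurePointSpectrum

end IsBoundedOpen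

end

section

variable {Ω : Set Plane}

/-! ### Smooth functions vanishing on the boundary -/

/-- A smooth cutoff on the real line: `0` on `(-∞, 1]` and `1` on `[2, ∞)`. -/
def cutoff (s : ℝ) : ℝ := Real.smoothTransition (s - 1)

theorem contDiff_cutoff : ContDiff ℝ ((⊤ : ℕ∞) : WithTop ℕ∞) cutoff :=
  Real.smoothTransition.contDiff.comp (contDiff_id.sub contDiff_const)

theorem cutoff_of_le {s : ℝ} (h : s ≤ 1) : cutoff s = 0 :=
  Real.smoothTransition.zero_of_nonpos (by linarith)

theorem cutoff_of_ge {s : ℝ} (h : 2 ≤ s) : cutoff s = 1 :=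
  Real.smoothTransition.one_of_one_le (by linarith)

theorem cutoff_nonneg (s : ℝ) : 0 ≤ cutoff s := Real.smoothTransition.nonneg _

theorem cutoff_le_one (s : ℝ) : cutoff s ≤ 1 := Real.smoothTransition.le_one _

theorem deriv_cutoff_of_lt {s : ℝ} (h : s < 1) : deriv cutoff s = 0 := by
  have : cutoff =ᶠ[𝓝 s] fun _ => 0 := by
    filter_upwards [gt_mem_nhds h] with x hx using cutoff_of_le hx.le
  rw [this.deriv_eq, deriv_const]

theorem deriv_cutoff_of_gt {s : ℝ} (h : 2 < s) : deriv cutoff s = 0 := by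
  have : cutoff =ᶠ[𝓝 s] fun _ => 1 := by
    filter_upwards [lt_mem_nhds h] with x hx using cutoff_of_ge hx.le
  rw [this.deriv_eq, deriv_const]

/-- The scale invariant quantity `s χ'(s)` is bounded. -/
theorem exists_bound_mul_deriv_cutoff : ∃ K, 0 ≤ K ∧ ∀ s, |s * deriv cutoff s| ≤ K := by
  have hc : Continuous (deriv cutoff) := contDiff_cutoff.continuous_deriv (by simp)
  obtain ⟨K, hK⟩ := (isCompact_Icc (a := (1 : ℝ)) (b := 2)).exists_bound_of_continuousOn
    (f := fun s => s * deriv cutoff s) (continuous_id.mul hc).continuousOn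
  have hK0 : 0 ≤ K := (norm_nonneg _).trans (hK 1 (by norm_num))
  refine ⟨K, hK0, fun s => ?_⟩
  by_cases hs : s ∈ Icc (1 : ℝ) 2
  · exact hK s hs
  · have : deriv cutoff s = 0 := by
      rw [mem_Icc, not_and_or, not_le, not_le] at hs
      exact hs.elim deriv_cutoff_of_lt deriv_cutoff_of_gt
    rw [this, mul_zero, abs_zero]
    exact hK0

/-- The cutoff in the plane at scale `1 / c` near the zero set of `ρ`. -/
def planeCutoff (c : ℝ) (ρ : Plane → ℝ) (x : Plane) : ℂ := (cutoff (c * ρ x) : ℂ)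

variable {ρ : Plane → ℝ}

theorem isSmooth_planeCutoff (hρ : ContDiff ℝ ((⊤ : ℕ∞) : WithTop ℕ∞) ρ) (c : ℝ) :
    IsSmooth (planeCutoff c ρ) :=
  Complex.ofRealCLM.contDiff.comp (contDiff_cutoff.comp (contDiff_const.mul hρ))

theorem norm_planeCutoff_le (c : ℝ) (ρ : Plane → ℝ) (x : Plane) : ‖planeCutoff c ρ x‖ ≤ 1 := by
  rw [planeCutoff, Complex.norm_real, Real.norm_of_nonneg (cutoff_nonneg _)]
  exact cutoff_le_one _

theorem partialDeriv_planeCutoff (hρ : ContDiff ℝ ((⊤ : ℕ∞) : WithTop ℕ∞) ρ) (c : ℝ) (j : Fin 2)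
    (x : Plane) : partialDeriv j (planeCutoff c ρ) x =
      ((c * deriv cutoff (c * ρ x) * fderiv ℝ ρ x (EuclideanSpace.single j 1) : ℝ) : ℂ) := by
  have h1 : HasFDerivAt (fun x => c * ρ x) (c • fderiv ℝ ρ x) x :=
    ((hρ.differentiable (by simp)) x).hasFDerivAt.const_mul c
  have h2 : HasDerivAt cutoff (deriv cutoff (c * ρ x)) (c * ρ x) :=
    ((contDiff_cutoff.differentiable (by simp)) _).hasDerivAt
  have h3 := h2.comp_hasFDerivAt x h1
  have h4 : HasFDerivAt (planeCutoff c ρ)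
      (Complex.ofRealCLM.comp (deriv cutoff (c * ρ x) • c • fderiv ℝ ρ x)) x :=
    Complex.ofRealCLM.hasFDerivAt.comp x h3
  unfold partialDeriv
  rw [h4.fderiv]
  simp
  ring

theorem tendsto_mul_pos {r : ℝ} (hr : 0 < r) : ∀ᶠ n : ℕ in atTop, 2 < (n : ℝ) * r := by
  have : Tendsto (fun n : ℕ => (n : ℝ) * r) atTop atTop :=
    tendsto_natCast_atTop_atTop.atTop_mul_const hr
  exact this.eventually_gt_atTop 2

/-- Near the zero set of `ρ` the derivative of the cutoff is compensated by a factor which vanishes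
there. -/
theorem norm_mul_partialDeriv_planeCutoff_le (hρ : ContDiff ℝ ((⊤ : ℕ∞) : WithTop ℕ∞) ρ)
    {K C M : ℝ} (hK : ∀ s, |s * deriv cutoff s| ≤ K) {f : Plane → ℂ} {x : Plane}
    (hx : 0 < ρ x) (hf : ‖f x‖ ≤ C * ρ x) {j : Fin 2}
    (hM : |fderiv ℝ ρ x (EuclideanSpace.single j 1)| ≤ M) (n : ℕ) :
    ‖f x * partialDeriv j (planeCutoff n ρ) x‖ ≤ C * K * M := by
  have hC : 0 ≤ C := nonneg_of_mul_nonneg_left ((norm_nonneg _).trans hf) hx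
  rw [partialDeriv_planeCutoff hρ, norm_mul, Complex.norm_real, Real.norm_eq_abs, abs_mul,
    ← mul_assoc]
  have hK0 : 0 ≤ K := (abs_nonneg _).trans (hK 0)
  refine mul_le_mul ?_ hM (abs_nonneg _) (by positivity)
  have h2 := hK (n * ρ x)
  calc ‖f x‖ * |n * deriv cutoff (n * ρ x)| ≤ C * ρ x * |n * deriv cutoff (n * ρ x)| := by gcongr
    _ = C * |n * ρ x * deriv cutoff (n * ρ x)| := by
      rw [abs_mul, abs_mul, abs_mul, abs_of_pos hx]; ring
    _ ≤ C * K := by gcongr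

namespace IsBoundedOpen

theorem toL2_sub (hΩ : IsBoundedOpen Ω) {f g : Plane → ℂ} (hf : Continuous f) (hg : Continuous g) :
    hΩ.toL2 f hf - hΩ.toL2 g hg = hΩ.toL2 (fun x => f x - g x) (hf.sub hg) :=
  (MemLp.toLp_sub (hΩ.memLp hf) (hΩ.memLp hg)).symm

/-- Bounded pointwise convergence implies convergence in `L²(Ω)`. -/
theorem tendsto_toL2 (hΩ : IsBoundedOpen Ω) {F : ℕ → Plane → ℂ} {f : Plane → ℂ}
    (hF : ∀ n, Continuous (F n)) (hf : Continuous f) {C : ℝ} (hC : ∀ n, ∀ x ∈ Ω, ‖F n x‖ ≤ C)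
    (hlim : ∀ x ∈ Ω, Tendsto (fun n => F n x) atTop (𝓝 (f x))) :
    Tendsto (fun n => hΩ.toL2 (F n) (hF n)) atTop (𝓝 (hΩ.toL2 f hf)) := by
  have := hΩ.isFiniteMeasure
  have hm := hΩ.isOpen.measurableSet
  rw [tendsto_iff_norm_sub_tendsto_zero]
  have h1 : ∀ n, ‖hΩ.toL2 (F n) (hF n) - hΩ.toL2 f hf‖ ^ 2 =
      ‖∫ x in Ω, (F n x - f x) * (starRingEnd ℂ) (F n x - f x)‖ := by
    intro n
    rw [toL2_sub, ← abs_norm, ← RCLike.norm_ofReal (K := ℂ), ← norm_pow,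
      ← inner_self_eq_norm_sq_to_K, inner_eq_integral]
    congr 1
    apply integral_congr_ae
    filter_upwards [hΩ.coeFn_toL2 ((hF n).sub hf)] with x hx
    erw [hx]
    rfl
  have hb : ∀ x ∈ Ω, ‖f x‖ ≤ C := fun x hx =>
    le_of_tendsto (hlim x hx).norm (Eventually.of_forall fun n => hC n x hx)
  have h2 : Tendsto (fun n => ∫ x in Ω, (F n x - f x) * (starRingEnd ℂ) (F n x - f x)) atTop
      (𝓝 (∫ x in Ω, (0 : ℂ))) := by
    refine tendsto_integral_of_dominated_convergence (fun _ => (2 * C) * (2 * C)) (fun n => ?_)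
      (integrable_const _) (fun n => ?_) ?_
    · have hc := (hF n).sub hf
      exact (hc.mul (Complex.continuous_conj.comp hc)).aestronglyMeasurable
    · refine ae_restrict_of_forall_mem hm fun x hx => ?_
      have h3 : ‖F n x - f x‖ ≤ 2 * C :=
        (norm_sub_le _ _).trans (by linarith [hC n x hx, hb x hx])
      rw [norm_mul, RCLike.norm_conj]
      exact mul_le_mul h3 h3 (norm_nonneg _) ((norm_nonneg _).trans h3)
    · refine ae_restrict_of_forall_mem hm fun x hx => ?_
      have h3 : Tendsto (fun n => F n x - f x) atTop (𝓝 0) := by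
        simpa using (hlim x hx).sub_const (f x)
      simpa using h3.mul ((Complex.continuous_conj.tendsto _).comp h3)
  rw [integral_zero] at h2
  have h3 := h2.norm
  simp_rw [← h1, norm_zero] at h3
  have h4 := h3.sqrt
  simpa [Real.sqrt_sq] using h4

/-- The triple `(f, ∂₁ f, ∂₂ f)` of a smooth function `f`. -/
def jet (hΩ : IsBoundedOpen Ω) (f : Plane → ℂ) (hf : IsSmooth f) : Jet Ω :=
  WithLp.toLp 2 fun i => match i with
    | none => hΩ.toL2 f hf.continuous
    | some j => hΩ.toL2 (partialDeriv j f) (hf.partialDeriv j).continuous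

theorem jet_mem_testJets (hΩ : IsBoundedOpen Ω) {f : Plane → ℂ} (hf : IsTestFunction Ω f) :
    hΩ.jet f hf.smooth ∈ testJets Ω :=
  ⟨f, hf, hΩ.coeFn_toL2 hf.smooth.continuous,
    fun j => hΩ.coeFn_toL2 (IsSmooth.partialDeriv hf.smooth j).continuous⟩

/-- A smooth function `f` on the plane whose restriction to `Ω = {ρ₁ > 0, ρ₂ > 0}` is bounded by
multiples of `ρ₁` and of `ρ₂` belongs to `H¹₀(Ω)`: multiply it by cutoffs in `n ρ₁` and `n ρ₂`. -/
theorem jet_mem_H10 (hΩ : IsBoundedOpen Ω) {ρ₁ ρ₂ : Plane → ℝ}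
    (h₁ : ContDiff ℝ ((⊤ : ℕ∞) : WithTop ℕ∞) ρ₁) (h₂ : ContDiff ℝ ((⊤ : ℕ∞) : WithTop ℕ∞) ρ₂)
    (hρ : Ω = {x | 0 < ρ₁ x ∧ 0 < ρ₂ x}) {f : Plane → ℂ} (hf : IsSmooth f) {C : ℝ}
    (hC₁ : ∀ x ∈ Ω, ‖f x‖ ≤ C * ρ₁ x) (hC₂ : ∀ x ∈ Ω, ‖f x‖ ≤ C * ρ₂ x) :
    hΩ.jet f hf ∈ H10 Ω := by
  have hpos : ∀ x ∈ Ω, 0 < ρ₁ x ∧ 0 < ρ₂ x := fun x hx => by rw [hρ] at hx; exact hx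
  set ψ : ℕ → Plane → ℂ := fun n x => planeCutoff n ρ₁ x * planeCutoff n ρ₂ x with hψ
  have hψs : ∀ n, IsSmooth (ψ n) := fun n =>
    (isSmooth_planeCutoff h₁ n).mul (isSmooth_planeCutoff h₂ n)
  have hψ1 : ∀ n x, ‖ψ n x‖ ≤ 1 := fun n x => by
    rw [hψ, norm_mul]
    exact mul_le_one₀ (norm_planeCutoff_le _ _ _) (norm_nonneg _) (norm_planeCutoff_le _ _ _)
  set F : ℕ → Plane → ℂ := fun n x => f x * ψ n x with hFdef
  have hFs : ∀ n, IsSmooth (F n) := fun n => hf.mul (hψs n)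
  have hlim1 : ∀ x ∈ Ω, ∀ᶠ n : ℕ in atTop, 2 < n * ρ₁ x ∧ 2 < n * ρ₂ x := fun x hx =>
    (tendsto_mul_pos (hpos x hx).1).and (tendsto_mul_pos (hpos x hx).2)
  -- The truncations are test functions.
  have htest : ∀ n, IsTestFunction Ω (F n) := by
    intro n
    have hsub : tsupport (F n) ⊆ {x | 1 ≤ n * ρ₁ x ∧ 1 ≤ n * ρ₂ x} := by
      refine closure_minimal ?_ ((isClosed_le continuous_const
        (continuous_const.mul h₁.continuous)).inter (isClosed_le continuous_const
        (continuous_const.mul h₂.continuous)))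
      intro x hx
      rw [Function.mem_support] at hx
      by_contra hcon
      refine hx ?_
      rw [mem_ofPred_eq, not_and_or, not_le, not_le] at hcon
      have : ψ n x = 0 := by
        rcases hcon with h | h
        · simp [hψ, planeCutoff, cutoff_of_le h.le]
        · simp [hψ, planeCutoff, cutoff_of_le h.le]
      simp [hFdef, this]
    have hsub2 : tsupport (F n) ⊆ Ω := by
      refine hsub.trans ?_
      rintro x ⟨hx1, hx2⟩
      rw [hρ]
      have hn : (0 : ℝ) ≤ n := n.cast_nonneg
      exact ⟨pos_of_mul_pos_right (one_pos.trans_le hx1) hn,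
        pos_of_mul_pos_right (one_pos.trans_le hx2) hn⟩
    exact ⟨hFs n, Metric.isCompact_of_isClosed_isBounded (isClosed_tsupport _)
      (hΩ.isBounded.subset hsub2), hsub2⟩
  obtain ⟨K, hK0, hK⟩ := exists_bound_mul_deriv_cutoff
  have hgrad : ∀ ρ : Plane → ℝ, ContDiff ℝ ((⊤ : ℕ∞) : WithTop ℕ∞) ρ → ∀ j : Fin 2, ∃ M, ∀ x ∈ Ω,
      |fderiv ℝ ρ x (EuclideanSpace.single j 1)| ≤ M := by
    intro ρ hρ j
    have hc : Continuous fun x => fderiv ℝ ρ x (EuclideanSpace.single j 1) :=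
      (hρ.continuous_fderiv (by simp)).clm_apply continuous_const
    obtain ⟨M, hM⟩ := hΩ.exists_bound (Complex.continuous_ofReal.comp hc)
    exact ⟨M, fun x hx => by simpa using hM x hx⟩
  have hFd : ∀ n j x, partialDeriv j (F n) x = partialDeriv j f x * ψ n x +
      (f x * partialDeriv j (planeCutoff n ρ₁) x * planeCutoff n ρ₂ x +
        f x * partialDeriv j (planeCutoff n ρ₂) x * planeCutoff n ρ₁ x) := by
    intro n j x
    rw [hFdef, partialDeriv_mul (hf.differentiable x) ((hψs n).differentiable x), hψ,
      partialDeriv_mul ((isSmooth_planeCutoff h₁ n).differentiable x)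
        ((isSmooth_planeCutoff h₂ n).differentiable x)]
    ring
  refine mem_closure_of_tendsto (f := fun n => hΩ.jet (F n) (hFs n)) (b := atTop) ?_
    (Eventually.of_forall fun n => hΩ.jet_mem_testJets (htest n))
  refine ((PiLp.continuous_toLp 2 _).tendsto _).comp (tendsto_pi_nhds.2 fun i => ?_)
  cases i with
  | none =>
    obtain ⟨B, hB⟩ := hΩ.exists_bound hf.continuous
    refine hΩ.tendsto_toL2 (fun n => (hFs n).continuous) hf.continuous (C := B) (fun n x hx => ?_)
      fun x hx => ?_
    · rw [hFdef, norm_mul]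
      exact (mul_le_of_le_one_right (norm_nonneg _) (hψ1 n x)).trans (hB x hx)
    · refine tendsto_const_nhds.congr' ?_
      filter_upwards [hlim1 x hx] with n hn
      simp [hFdef, hψ, planeCutoff, cutoff_of_ge hn.1.le, cutoff_of_ge hn.2.le]
  | some j =>
    obtain ⟨B, hB⟩ := hΩ.exists_bound (hf.partialDeriv j).continuous
    obtain ⟨M₁, hM₁⟩ := hgrad ρ₁ h₁ j
    obtain ⟨M₂, hM₂⟩ := hgrad ρ₂ h₂ j
    refine hΩ.tendsto_toL2 (fun n => ((hFs n).partialDeriv j).continuous)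
      (hf.partialDeriv j).continuous (C := B + (C * K * M₁ + C * K * M₂)) (fun n x hx => ?_)
      fun x hx => ?_
    · rw [hFd]
      have b1 := norm_mul_partialDeriv_planeCutoff_le h₁ hK (hpos x hx).1 (hC₁ x hx) (hM₁ x hx) n
      have b2 := norm_mul_partialDeriv_planeCutoff_le h₂ hK (hpos x hx).2 (hC₂ x hx) (hM₂ x hx) n
      refine (norm_add_le _ _).trans (add_le_add ?_ ((norm_add_le _ _).trans (add_le_add ?_ ?_)))
      · rw [norm_mul]
        exact (mul_le_of_le_one_right (norm_nonneg _) (hψ1 n x)).trans (hB x hx)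
      · rw [norm_mul _ (planeCutoff _ _ _)]
        exact (mul_le_of_le_one_right (norm_nonneg _) (norm_planeCutoff_le _ _ _)).trans b1
      · rw [norm_mul _ (planeCutoff _ _ _)]
        exact (mul_le_of_le_one_right (norm_nonneg _) (norm_planeCutoff_le _ _ _)).trans b2
    · refine tendsto_const_nhds.congr' ?_
      filter_upwards [hlim1 x hx] with n hn
      rw [hFd, partialDeriv_planeCutoff h₁, partialDeriv_planeCutoff h₂, deriv_cutoff_of_gt hn.1,
        deriv_cutoff_of_gt hn.2]
      simp [hψ, planeCutoff, cutoff_of_ge hn.1.le, cutoff_of_ge hn.2.le]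

/-- On smooth elements of `H¹₀(Ω)`, the distributional second derivatives are the classical ones. -/
theorem secondDeriv_jet (hΩ : IsBoundedOpen Ω) {f : Plane → ℂ} {hf : IsSmooth f}
    (h : hΩ.jet f hf ∈ H10 Ω) (j : Fin 2) (v : H10 Ω) :
    secondDeriv Ω j ⟨hΩ.jet f hf, h⟩ v =
      ∫ x in Ω, partialDeriv j (partialDeriv j f) x * (v : Jet Ω) none x := by
  have h1 : secondDeriv Ω j ⟨hΩ.jet f hf, h⟩ v =
      -L2pairing Ω (hΩ.toL2 (partialDeriv j f) (hf.partialDeriv j).continuous) (weakDeriv Ω j v) := rfl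
  rw [h1, pairing_toL2, hΩ.integral_mul_weakDeriv (hf.partialDeriv j), neg_neg]

theorem eqOn_zero_of_jet_eq_zero (hΩ : IsBoundedOpen Ω) {f : Plane → ℂ} {hf : IsSmooth f}
    (h : hΩ.jet f hf ∈ H10 Ω) (h0 : (⟨hΩ.jet f hf, h⟩ : H10 Ω) = 0) : EqOn f 0 Ω := by
  have h1 : hΩ.toL2 f hf.continuous = 0 :=
    congrArg (fun u : H10 Ω => (u : Jet Ω) none) h0
  refine Measure.eqOn_open_of_ae_eq (μ := volume) ?_ hΩ.isOpen hf.continuous.continuousOn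
    continuousOn_const
  filter_upwards [hΩ.coeFn_toL2 hf.continuous, Lp.coeFn_zero ℂ 2 (volume.restrict Ω)] with x hx h2
  rw [← hx, h1, h2]

/-! ### Completeness of moments -/

/-- By the Stone–Weierstrass theorem, an integrable function on `Ω` is determined by its moments
`∫ ζᵐ ζ̄ⁿ g`, for a continuous function `ζ` which is injective on the closure of `Ω`. -/
theorem ae_eq_zero_of_moments (hΩ : IsBoundedOpen Ω) {ζ : Plane → ℂ} (hζ : Continuous ζ)
    (hinj : InjOn ζ (closure Ω)) {g : Plane → ℂ} (hg : IntegrableOn g Ω)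
    (h : ∀ m n : ℕ, ∫ x in Ω, ζ x ^ m * (starRingEnd ℂ) (ζ x) ^ n * g x = 0) :
    ∀ᵐ x ∂(volume.restrict Ω), g x = 0 := by
  have := hΩ.isFiniteMeasure
  have hint : ∀ {P : Plane → ℂ}, Continuous P →
      Integrable (fun x => P x * g x) (volume.restrict Ω) := by
    intro P hP
    obtain ⟨C, hC⟩ := hΩ.exists_bound hP
    exact hg.bdd_mul hP.aestronglyMeasurable
      (ae_restrict_of_forall_mem hΩ.isOpen.measurableSet hC)
  have hcpt : CompactSpace (closure Ω) := isCompact_iff_compactSpace.1 hΩ.isBounded.isCompact_closure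
  let z : C(closure Ω, ℂ) := ⟨fun x => ζ x, hζ.comp continuous_subtype_val⟩
  let A : StarSubalgebra ℂ C(closure Ω, ℂ) := StarAlgebra.adjoin ℂ {z}
  have hsep : A.SeparatesPoints := by
    intro x y hxy
    refine ⟨z, ⟨z, StarAlgebra.subset_adjoin ℂ _ rfl, rfl⟩, fun hz => hxy ?_⟩
    exact Subtype.ext (hinj x.2 y.2 hz)
  have htop := ContinuousMap.starSubalgebra_topologicalClosure_eq_top_of_separatesPoints A hsep
  -- Every element of the algebra extends to a polynomial in `ζ` and its conjugate.
  have hA : ∀ p ∈ A, ∃ P : Plane → ℂ, Continuous P ∧ (∀ x : closure Ω, P x = p x) ∧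
      ∫ x in Ω, P x * g x = 0 := by
    intro p hp
    have hp2 : p ∈ Algebra.adjoin ℂ ({z} ∪ star {z} : Set C(closure Ω, ℂ)) := hp
    rw [← Subalgebra.mem_toSubmodule, Algebra.adjoin_eq_span] at hp2
    clear hp
    induction hp2 using Submodule.span_induction with
    | mem q hq =>
      rw [star_singleton, singleton_union] at hq
      obtain ⟨m, n, rfl⟩ := (Submonoid.mem_closure_pair z (star z) q).1 hq
      exact ⟨fun x => ζ x ^ m * (starRingEnd ℂ) (ζ x) ^ n,
        (hζ.pow m).mul ((Complex.continuous_conj.comp hζ).pow n), fun x => rfl, h m n⟩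
    | zero => exact ⟨0, continuous_const, fun x => rfl, by simp⟩
    | add p q _ _ hp hq =>
      obtain ⟨P, hP, hP1, hP2⟩ := hp
      obtain ⟨Q, hQ, hQ1, hQ2⟩ := hq
      refine ⟨fun x => P x + Q x, hP.add hQ, fun x => by simp [hP1, hQ1], ?_⟩
      simp_rw [add_mul]
      rw [integral_add (hint hP) (hint hQ), hP2, hQ2, add_zero]
    | smul c p _ hp =>
      obtain ⟨P, hP, hP1, hP2⟩ := hp
      refine ⟨fun x => c * P x, continuous_const.mul hP, fun x => by simp [hP1], ?_⟩
      simp_rw [mul_assoc]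
      rw [integral_const_mul, hP2, mul_zero]
  refine hΩ.ae_eq_zero_of_integral hg fun f hf => ?_
  let F : C(closure Ω, ℂ) := ⟨fun x => f x, hf.continuous.comp continuous_subtype_val⟩
  have hF : F ∈ closure (A : Set C(closure Ω, ℂ)) := by
    have : F ∈ A.topologicalClosure := htop ▸ StarSubalgebra.mem_top
    exact this
  have hle : ∀ ε > 0, ‖∫ x in Ω, f x * g x‖ ≤ ε * ∫ x in Ω, ‖g x‖ := by
    intro ε hε
    obtain ⟨p, hp, hpF⟩ := Metric.mem_closure_iff.1 hF ε hε
    obtain ⟨P, hP, hP1, hP2⟩ := hA p hp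
    have e : ∫ x in Ω, f x * g x = ∫ x in Ω, (f x - P x) * g x := by
      simp_rw [sub_mul]
      rw [integral_sub (hint hf.continuous) (hint hP), hP2, sub_zero]
    rw [e, ← integral_const_mul]
    refine norm_integral_le_of_norm_le (hg.norm.const_mul ε)
      (ae_restrict_of_forall_mem hΩ.isOpen.measurableSet fun x hx => ?_)
    rw [norm_mul]
    refine mul_le_mul_of_nonneg_right ?_ (norm_nonneg _)
    have := (ContinuousMap.dist_apply_le_dist (f := F) (g := p) ⟨x, subset_closure hx⟩).trans hpF.le
    rw [dist_eq_norm, ← hP1] at this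
    exact this
  have hlim : Tendsto (fun ε : ℝ => ε * ∫ x in Ω, ‖g x‖) (𝓝[>] 0) (𝓝 0) := by
    have : Tendsto (fun ε : ℝ => ε * ∫ x in Ω, ‖g x‖) (𝓝 0) (𝓝 (0 * ∫ x in Ω, ‖g x‖)) :=
      tendsto_id.mul_const _
    rw [zero_mul] at this
    exact this.mono_left nhdsWithin_le_nhds
  exact norm_le_zero_iff.1 (ge_of_tendsto hlim (eventually_nhdsWithin_of_forall hle))

end IsBoundedOpen

end

section

variable {Ω : Set Plane}

/-! ### Winding of boundary parametrizations -/

/-- The identification of the plane with `ℂ`. -/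
def toComplex (x : Plane) : ℂ := ⟨x 0, x 1⟩

theorem continuous_toComplex : Continuous toComplex := by
  have : toComplex = fun x : Plane => (x 0 : ℂ) + (x 1 : ℂ) * Complex.I := by
    funext x
    apply Complex.ext <;> simp [toComplex]
  rw [this]
  fun_prop

theorem norm_toComplex_sub (x c : Plane) : ‖toComplex x - toComplex c‖ = dist x c := by
  rw [EuclideanSpace.dist_eq, Fin.sum_univ_two, Complex.norm_eq_sqrt_sq_add_sq, Real.dist_eq,
    Real.dist_eq, sq_abs, sq_abs]
  rfl

/-- A continuous angle `θ` of the curve `p` around `c`, which increases by `2π` in one period. -/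
structure IsAngle (p : UnitAddCircle → Plane) (c : Plane) (θ : ℝ → ℝ) : Prop where
  continuous : Continuous θ
  add_one : ∀ t, θ (t + 1) = θ t + 2 * Real.pi
  eq : ∀ t : ℝ, toComplex (p t) - toComplex c = dist (p t) c * Complex.exp (θ t * Complex.I)

theorem isAngle_iff {p : UnitAddCircle → Plane} {c : Plane} {θ : ℝ → ℝ} :
    IsAngle p c θ ↔ Continuous θ ∧ (∀ t, θ (t + 1) = θ t + 2 * Real.pi) ∧
      ∀ t : ℝ, p (t : UnitAddCircle) 0 = c 0 + dist (p (t : UnitAddCircle)) c * Real.cos (θ t) ∧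
        p (t : UnitAddCircle) 1 = c 1 + dist (p (t : UnitAddCircle)) c * Real.sin (θ t) := by
  have key : ∀ t : ℝ, toComplex (p t) - toComplex c = dist (p t) c * Complex.exp (θ t * Complex.I) ↔
      p (t : UnitAddCircle) 0 = c 0 + dist (p (t : UnitAddCircle)) c * Real.cos (θ t) ∧
        p (t : UnitAddCircle) 1 = c 1 + dist (p (t : UnitAddCircle)) c * Real.sin (θ t) := by
    intro t
    rw [Complex.ext_iff, Complex.re_ofReal_mul, Complex.im_ofReal_mul, Complex.exp_ofReal_mul_I_re,
      Complex.exp_ofReal_mul_I_im]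
    simp only [toComplex, Complex.sub_re, Complex.sub_im]
    constructor
    · rintro ⟨h1, h2⟩; constructor <;> linarith
    · rintro ⟨h1, h2⟩; constructor <;> linarith
  constructor
  · rintro ⟨h1, h2, h3⟩
    exact ⟨h1, h2, fun t => (key t).1 (h3 t)⟩
  · rintro ⟨h1, h2, h3⟩
    exact ⟨h1, h2, fun t => (key t).2 (h3 t)⟩

/-- A curve whose direction from `c` is never opposite to `exp (i α)` has an angle of the same degree
as `α`. -/
theorem exists_isAngle_of_slitPlane {p : UnitAddCircle → Plane} (hp : Continuous p) {c : Plane}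
    {α : ℝ → ℝ} (hα : Continuous α) (hα1 : ∀ t, α (t + 1) = α t + 2 * Real.pi)
    (h : ∀ t : ℝ, (toComplex (p t) - toComplex c) * Complex.exp (-(α t * Complex.I)) ∈
      Complex.slitPlane) : ∃ θ, IsAngle p c θ := by
  set w : ℝ → ℂ := fun t => (toComplex (p t) - toComplex c) * Complex.exp (-(α t * Complex.I))
    with hw
  have hwc : Continuous w := by
    have h1 : Continuous fun t : ℝ => toComplex (p (t : UnitAddCircle)) :=
      continuous_toComplex.comp (hp.comp (AddCircle.continuous_mk' 1))
    exact (h1.sub continuous_const).mul (by fun_prop)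
  have hnorm : ∀ t, ‖w t‖ = dist (p t) c := by
    intro t
    rw [hw, norm_mul, norm_toComplex_sub, ← neg_mul, ← Complex.ofReal_neg,
      Complex.norm_exp_ofReal_mul_I, mul_one]
  refine ⟨fun t => α t + (w t).arg, ?_, fun t => ?_, fun t => ?_⟩
  · exact hα.add (continuous_iff_continuousAt.2 fun t =>
      ContinuousAt.comp (f := w) (Complex.continuousAt_arg (h t)) hwc.continuousAt)
  · have : w (t + 1) = w t := by
      simp only [hw, hα1]
      have e1 : ((t + 1 : ℝ) : UnitAddCircle) = t := by simp
      have e2 : Complex.exp (-(((α t + 2 * Real.pi : ℝ) : ℂ) * Complex.I)) =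
          Complex.exp (-(α t * Complex.I)) := by
        rw [Complex.exp_eq_exp_iff_exists_int]
        exact ⟨-1, by push_cast; ring⟩
      rw [e1, e2]
    rw [this, hα1]; ring
  · have h1 := Complex.norm_mul_exp_arg_mul_I (w t)
    rw [hnorm] at h1
    rw [Complex.ofReal_add, add_mul, Complex.exp_add, mul_left_comm, h1, hw, mul_comm, mul_assoc,
      ← Complex.exp_add, neg_add_cancel, Complex.exp_zero, mul_one]

/-- It suffices that the direction from `c` and `exp (i α)` always lie in a common open half-plane. -/
theorem exists_isAngle_of_halfPlane {p : UnitAddCircle → Plane} (hp : Continuous p) {c : Plane}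
    {α : ℝ → ℝ} (hα : Continuous α) (hα1 : ∀ t, α (t + 1) = α t + 2 * Real.pi)
    (h : ∀ t : ℝ, ∃ a b : ℝ, 0 < a * (p t 0 - c 0) + b * (p t 1 - c 1) ∧
      0 < a * Real.cos (α t) + b * Real.sin (α t)) : ∃ θ, IsAngle p c θ := by
  refine exists_isAngle_of_slitPlane hp hα hα1 fun t => ?_
  obtain ⟨a, b, h1, h2⟩ := h t
  by_contra hs
  rw [Complex.mem_slitPlane_iff_not_le_zero, not_not, Complex.le_def] at hs
  have e : toComplex (p t) - toComplex c =
      (toComplex (p t) - toComplex c) * Complex.exp (-(α t * Complex.I)) *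
        Complex.exp (α t * Complex.I) := by
    rw [mul_assoc, ← Complex.exp_add, neg_add_cancel, Complex.exp_zero, mul_one]
  set w := (toComplex (p t) - toComplex c) * Complex.exp (-(α t * Complex.I))
  obtain ⟨hr, hi⟩ := hs
  simp only [Complex.zero_re, Complex.zero_im] at hr hi
  have e1 := congrArg Complex.re e
  have e2 := congrArg Complex.im e
  rw [Complex.mul_re, Complex.exp_ofReal_mul_I_re, Complex.exp_ofReal_mul_I_im, hi, zero_mul,
    sub_zero] at e1
  rw [Complex.mul_im, Complex.exp_ofReal_mul_I_re, Complex.exp_ofReal_mul_I_im, hi, zero_mul,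
    add_zero] at e2
  simp only [toComplex, Complex.sub_re, Complex.sub_im] at e1 e2
  rw [e1, e2] at h1
  nlinarith

/-- In a convex domain, the boundary winds once around every interior point as soon as it does around
one of them. -/
theorem exists_isAngle_of_convex (ho : IsOpen Ω) (hc : Convex ℝ Ω) {p : UnitAddCircle → Plane}
    (hp : Continuous p) (hpΩ : ∀ s, p s ∈ frontier Ω) {c₀ : Plane} (hc₀ : c₀ ∈ Ω)
    (h : ∃ θ, IsAngle p c₀ θ) {c : Plane} (hcΩ : c ∈ Ω) : ∃ θ, IsAngle p c θ := by
  obtain ⟨θ, hθ⟩ := h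
  have hnot : ∀ s, p s ∉ Ω := fun s hs => by
    have := hpΩ s
    rw [ho.frontier_eq] at this
    exact this.2 hs
  refine exists_isAngle_of_slitPlane hp hθ.continuous hθ.add_one fun t => ?_
  by_contra hs
  rw [Complex.mem_slitPlane_iff_not_le_zero, not_not, Complex.le_def] at hs
  have e : toComplex (p t) - toComplex c =
      (toComplex (p t) - toComplex c) * Complex.exp (-(θ t * Complex.I)) *
        Complex.exp (θ t * Complex.I) := by
    rw [mul_assoc, ← Complex.exp_add, neg_add_cancel, Complex.exp_zero, mul_one]
  set w := (toComplex (p t) - toComplex c) * Complex.exp (-(θ t * Complex.I))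
  obtain ⟨hr, hi⟩ := hs
  simp only [Complex.zero_re, Complex.zero_im] at hr hi
  have hd : 0 < dist (p t) c₀ := dist_pos.2 fun h => hnot t (h ▸ hc₀)
  -- The boundary point would lie on the segment from `c` to `c₀`.
  set k := -w.re with hk
  set r := dist (p t) c₀ with hrr
  have hk0 : 0 ≤ k := by linarith
  have hwk : w = -(k : ℂ) := by
    apply Complex.ext <;> simp [hk, hi]
  have e3 := hθ.eq t
  have e4 : (r : ℂ) * (toComplex (p t) - toComplex c) +
      k * (toComplex (p t) - toComplex c₀) = 0 := by
    rw [e, e3, hwk]; ring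
  have hx : p t = (r / (r + k)) • c + (k / (r + k)) • c₀ := by
    have hrk : r + k ≠ 0 := by positivity
    have h1 := congrArg Complex.re e4
    have h2 := congrArg Complex.im e4
    rw [Complex.add_re, Complex.re_ofReal_mul, Complex.re_ofReal_mul] at h1
    rw [Complex.add_im, Complex.im_ofReal_mul, Complex.im_ofReal_mul] at h2
    simp only [toComplex, Complex.sub_re, Complex.sub_im, Complex.zero_re, Complex.zero_im] at h1 h2
    ext i
    fin_cases i
    · simp
      field_simp
      linarith
    · simp
      field_simp
      linarith
  refine hnot t ?_
  rw [hx]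
  exact hc hcΩ hc₀ (by positivity) (by positivity) (by field_simp)

theorem isPositiveParametrization_of_convex (ho : IsOpen Ω) (hc : Convex ℝ Ω)
    {p : UnitAddCircle → Plane} (hp : Continuous p) (hi : Function.Injective p)
    (hr : range p = frontier Ω) {c₀ : Plane} (hc₀ : c₀ ∈ Ω) (h : ∃ θ, IsAngle p c₀ θ) :
    IsPositiveParametrization Ω p where
  continuous := hp
  injective := hi
  range_eq := hr
  winding c hcΩ := by
    obtain ⟨θ, hθ⟩ := exists_isAngle_of_convex ho hc hp (fun s => hr ▸ mem_range_self s) hc₀ h hcΩ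
    exact ⟨θ, isAngle_iff.1 hθ⟩

/-! ### Rotation numbers of products of two reflections -/

/-- A continuous integer-valued function is constant. -/
theorem exists_int_of_continuous {φ : ℝ → ℝ} (hφ : Continuous φ) (h : ∀ t, ∃ n : ℤ, φ t = n) :
    ∃ n : ℤ, ∀ t, φ t = n := by
  choose f hf using h
  have hfc : Continuous f := by
    rw [Int.isClosedEmbedding_coe_real.isEmbedding.continuous_iff]
    exact hφ.congr hf
  exact ⟨f 0, fun t => by rw [hf t, PreconnectedSpace.constant inferInstance hfc (x := t) (y := 0)]⟩

theorem coe_eq_coe_iff_exists_int {a b : ℝ} :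
    (a : UnitAddCircle) = b ↔ ∃ n : ℤ, a - b = n := by
  rw [← sub_eq_zero, ← AddCircle.coe_sub, AddCircle.coe_eq_zero_iff]
  simp [eq_comm]

theorem boundaryInvolution_eq {p : UnitAddCircle → Plane} (hr : range p = frontier Ω)
    (hi : Function.Injective p) {ℓ : Plane → ℝ} {c : UnitAddCircle}
    (h : ∀ s t, ℓ (p s) = ℓ (p t) ↔ s = t ∨ s = c - t) (t : UnitAddCircle) :
    boundaryInvolution Ω ℓ (p t) = p (c - t) := by
  unfold boundaryInvolution
  split_ifs with hex
  · obtain ⟨h1, h2, h3⟩ := hex.choose_spec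
    obtain ⟨s, hs⟩ := hr.superset h1
    rw [← hs] at h2 h3 ⊢
    rcases (h s t).1 h3 with h4 | h4
    · exact absurd (congrArg p h4) h2
    · rw [h4]
  · congr 1
    by_contra hne
    exact hex ⟨p (c - t), hr ▸ mem_range_self _, fun h => hne (hi h).symm,
      (h _ _).2 (Or.inr rfl)⟩

/-- Any positive parametrization factors through any other one, by a change of parameter of degree
one. -/
theorem IsPositiveParametrization.exists_lift (ho : IsOpen Ω) (hne : Ω.Nonempty)
    {p p₀ : UnitAddCircle → Plane} (hp : IsPositiveParametrization Ω p)
    (hp₀ : IsPositiveParametrization Ω p₀) :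
    ∃ h : ℝ → ℝ, Continuous h ∧ (∀ t, h (t + 1) = h t + 1) ∧
      ∀ t : ℝ, p (t : UnitAddCircle) = p₀ (h t : UnitAddCircle) := by
  have hex : ∀ s, ∃ s', p₀ s' = p s := fun s => by
    have : p s ∈ range p₀ := by rw [hp₀.range_eq, ← hp.range_eq]; exact mem_range_self s
    exact this
  choose g hg using hex
  have hgc : Continuous g := by
    rw [(hp₀.continuous.isClosedEmbedding hp₀.injective).isEmbedding.continuous_iff]
    exact hp.continuous.congr fun s => (hg s).symm
  let f : C(ℝ, UnitAddCircle) := ⟨fun t => g (t : UnitAddCircle), hgc.comp (AddCircle.continuous_mk' 1)⟩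
  obtain ⟨e₀, he₀⟩ := QuotientAddGroup.mk_surjective (f 0)
  obtain ⟨h, ⟨-, hh⟩, -⟩ :=
    (AddCircle.isCoveringMap_coe (1 : ℝ)).existsUnique_continuousMap_lifts f 0 e₀ he₀
  have hh' : ∀ t : ℝ, (h t : UnitAddCircle) = g (t : UnitAddCircle) := fun t => congrFun hh t
  have hph : ∀ t : ℝ, p (t : UnitAddCircle) = p₀ (h t : UnitAddCircle) := fun t => by rw [hh', hg]
  refine ⟨h, h.continuous, ?_, hph⟩
  obtain ⟨d, hd⟩ := exists_int_of_continuous (φ := fun t => h (t + 1) - h t)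
    ((h.continuous.comp (continuous_id.add continuous_const)).sub h.continuous) fun t => by
      rw [← coe_eq_coe_iff_exists_int, hh', hh']
      simp
  -- Compare the angles around an interior point to see that the degree is one.
  obtain ⟨c, hc⟩ := hne
  obtain ⟨θ, hθ⟩ := hp.winding c hc
  obtain ⟨θ₀, hθ₀⟩ := hp₀.winding c hc
  obtain ⟨m, hm⟩ := exists_int_of_continuous (φ := fun t => (θ t - θ₀ (h t)) / (2 * Real.pi))
    ((hθ.1.sub (hθ₀.1.comp h.continuous)).div_const _) fun t => by
      have h1 := hθ.2.2 t
      have h2 := hθ₀.2.2 (h t)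
      rw [← hph] at h2
      have hd : dist (p t) c ≠ 0 := by
        rw [dist_ne_zero]
        intro he
        have : p t ∈ frontier Ω := hp.range_eq ▸ mem_range_self _
        rw [ho.frontier_eq] at this
        exact this.2 (he ▸ hc)
      have h3 : Real.cos (θ t) = Real.cos (θ₀ (h t)) :=
        mul_left_cancel₀ hd (by linarith [h1.1, h2.1])
      have h4 : Real.sin (θ t) = Real.sin (θ₀ (h t)) :=
        mul_left_cancel₀ hd (by linarith [h1.2, h2.2])
      obtain ⟨k, hk⟩ := Real.Angle.angle_eq_iff_two_pi_dvd_sub.1 (Real.Angle.cos_sin_inj h3 h4)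
      exact ⟨k, by rw [hk]; field_simp⟩
  have hper : Function.Periodic (fun s => θ₀ s - 2 * Real.pi * s) 1 := fun s => by
    beta_reduce
    rw [hθ₀.2.1]; ring
  have h5 : θ₀ (h 0 + d) = θ₀ (h 0) + 2 * Real.pi * d := by
    have := (hper.int_mul d) (h 0)
    beta_reduce at this
    rw [mul_one] at this
    linarith
  have h6 := (hm (0 + 1)).trans (hm 0).symm
  have h7 : h (0 + 1) = h 0 + d := by linarith [hd 0]
  rw [div_left_inj' (by positivity), h7, h5, hθ.2.1] at h6
  have h8 : (d : ℝ) = 1 := by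
    have hpi : (2 * Real.pi) ≠ 0 := by positivity
    have : 2 * Real.pi * (d : ℝ) = 2 * Real.pi * 1 := by linarith
    exact mul_left_cancel₀ hpi this
  intro t
  have := hd t
  rw [h8] at this
  linarith

theorem exists_bound_sub_id {h : ℝ → ℝ} (hc : Continuous h) (h1 : ∀ t, h (t + 1) = h t + 1) :
    ∃ B, ∀ t, |h t - t| ≤ B := by
  have hper : Function.Periodic (fun t => h t - t) 1 := fun t => by
    beta_reduce
    rw [h1]; ring
  obtain ⟨B, hB⟩ := (isCompact_Icc (a := (0 : ℝ)) (b := 1)).exists_bound_of_continuousOn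
    (hc.sub continuous_id).continuousOn
  refine ⟨B, fun t => ?_⟩
  have e := hper.sub_int_mul_eq ⌊t⌋ (x := t)
  beta_reduce at e
  rw [mul_one] at e
  rw [← e]
  exact hB _ ⟨by linarith [Int.floor_le t], by linarith [Int.lt_floor_add_one t]⟩

/-- If `F` is semiconjugate to the translation by `ρ` through a map at bounded distance from the
identity, its rotation number is `ρ`. -/
theorem tendsto_iterate_of_semiconj {F h : ℝ → ℝ} {ρ B : ℝ} (hF : ∀ t, h (F t) = h t + ρ)
    (hB : ∀ t, |h t - t| ≤ B) (x : ℝ) :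
    Tendsto (fun k : ℕ => (F^[k] x - x) / k) atTop (𝓝 ρ) := by
  have hk : ∀ k : ℕ, h (F^[k] x) = h x + k * ρ := by
    intro k
    induction k with
    | zero => simp
    | succ k ih => rw [Function.iterate_succ_apply', hF, ih]; push_cast; ring
  rw [tendsto_iff_norm_sub_tendsto_zero]
  have hlim : Tendsto (fun k : ℕ => 2 * B / (k : ℝ)) atTop (𝓝 0) :=
    tendsto_const_div_atTop_nhds_zero_nat _
  refine squeeze_zero' (Eventually.of_forall fun _ => norm_nonneg _) ?_ hlim
  filter_upwards [eventually_gt_atTop 0] with k hk0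
  have hk1 : (0 : ℝ) < k := by exact_mod_cast hk0
  have e : (F^[k] x - x) / k - ρ = ((h x - x) - (h (F^[k] x) - F^[k] x)) / k := by
    rw [hk]; field_simp; ring
  rw [e, norm_div, Real.norm_of_nonneg hk1.le]
  gcongr
  rw [Real.norm_eq_abs]
  exact (abs_sub _ _).trans (by linarith [hB x, hB (F^[k] x)])

/-- If both involutions are reflections `t ↦ c - t` in one parameter, then the chess billiard map is the
translation by the difference of the two constants. -/
theorem isRotationNumber_of_reflections (ho : IsOpen Ω) (hne : Ω.Nonempty) {lam : ℝ}
    {p₀ : UnitAddCircle → Plane} (hp₀ : IsPositiveParametrization Ω p₀) {c₁ c₂ : UnitAddCircle}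
    (h₁ : ∀ s t, ellPlus lam (p₀ s) = ellPlus lam (p₀ t) ↔ s = t ∨ s = c₁ - t)
    (h₂ : ∀ s t, ellMinus lam (p₀ s) = ellMinus lam (p₀ t) ↔ s = t ∨ s = c₂ - t) :
    IsRotationNumber Ω lam (c₁ - c₂) := by
  obtain ⟨ρ, hρ⟩ := QuotientAddGroup.mk_surjective (c₁ - c₂)
  have hρ' : (ρ : UnitAddCircle) = c₁ - c₂ := hρ
  have hb : ∀ s, chessBilliard Ω lam (p₀ s) = p₀ (s + (c₁ - c₂)) := by
    intro s
    unfold chessBilliard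
    rw [Function.comp_apply, boundaryInvolution_eq hp₀.range_eq hp₀.injective h₂,
      boundaryInvolution_eq hp₀.range_eq hp₀.injective h₁]
    congr 1
    abel
  refine ⟨⟨p₀, fun t => t + ρ, hp₀, continuous_id.add continuous_const, fun t => ?_⟩, ?_⟩
  · rw [hb, ← hρ', AddCircle.coe_add]
  · intro p F hp hF x₀
    obtain ⟨h, hc, h1, hph⟩ := hp.exists_lift ho hne hp₀
    obtain ⟨B, hB⟩ := exists_bound_sub_id hc h1
    obtain ⟨n, hn⟩ := exists_int_of_continuous (φ := fun t => h (F t) - (h t + ρ))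
      ((hc.comp hF.continuous).sub (hc.add continuous_const)) fun t => by
        rw [← coe_eq_coe_iff_exists_int]
        apply hp₀.injective
        rw [← hph, hF.semiconj, hph, hb, AddCircle.coe_add, hρ']
    refine ⟨ρ + n, tendsto_iterate_of_semiconj (h := h) (B := B) (fun t => ?_) hB x₀, ?_⟩
    · linarith [hn t]
    · rw [← hρ', coe_eq_coe_iff_exists_int]
      exact ⟨n, by ring⟩

theorem IsRotationNumber.unique {lam : ℝ} {r r' : UnitAddCircle} (h : IsRotationNumber Ω lam r)
    (h' : IsRotationNumber Ω lam r') : r = r' := by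
  obtain ⟨⟨p, F, hp, hF⟩, h2⟩ := h
  obtain ⟨ρ, h3, h4⟩ := h2 p F hp hF 0
  obtain ⟨ρ', h5, h6⟩ := h'.2 p F hp hF 0
  rw [← h4, ← h6, tendsto_nhds_unique h3 h5]

theorem IsRotationNumber.rotationNumber_eq {lam : ℝ} {r : UnitAddCircle}
    (h : IsRotationNumber Ω lam r) : rotationNumber Ω lam = r := by
  have hex : ∃ r, IsRotationNumber Ω lam r := ⟨r, h⟩
  unfold rotationNumber
  rw [dif_pos hex]
  exact hex.choose_spec.unique h

end

/-! ### Chess billiards in rectangles -/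

theorem isRationalMod_coe_iff {x : ℝ} : IsRationalMod (x : UnitAddCircle) ↔ ∃ q : ℚ, (q : ℝ) = x := by
  constructor
  · rintro ⟨q, hq⟩
    obtain ⟨n, hn⟩ := coe_eq_coe_iff_exists_int.1 hq
    exact ⟨q - n, by push_cast; linarith⟩
  · rintro ⟨q, rfl⟩
    exact ⟨q, rfl⟩

theorem UnitAddCircle.norm_eq_norm_iff {s t : UnitAddCircle} : ‖s‖ = ‖t‖ ↔ s = t ∨ s = -t := by
  constructor
  · intro h
    obtain ⟨x, rfl⟩ := QuotientAddGroup.mk_surjective s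
    obtain ⟨y, rfl⟩ := QuotientAddGroup.mk_surjective t
    change ‖(x : UnitAddCircle)‖ = ‖(y : UnitAddCircle)‖ at h
    change (x : UnitAddCircle) = y ∨ (x : UnitAddCircle) = -(y : UnitAddCircle)
    rw [UnitAddCircle.norm_eq, UnitAddCircle.norm_eq] at h
    rw [← AddCircle.coe_neg, coe_eq_coe_iff_exists_int, coe_eq_coe_iff_exists_int]
    rcases abs_eq_abs.1 h with h | h
    · exact Or.inl ⟨round x - round y, by push_cast; linarith⟩
    · exact Or.inr ⟨round x + round y, by push_cast; linarith⟩
  · rintro (rfl | rfl)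
    · rfl
    · rw [norm_neg]

theorem UnitAddCircle.norm_coe_of_abs_le {x : ℝ} (h : |x| ≤ 1 / 2) : ‖(x : UnitAddCircle)‖ = |x| :=
  (AddCircle.norm_coe_eq_abs_iff 1 one_ne_zero).2 (by simpa using h)

theorem UnitAddCircle.norm_coe_of_half_le {x : ℝ} (h : 1 / 2 ≤ x) (h' : x ≤ 3 / 2) :
    ‖(x : UnitAddCircle)‖ = |1 - x| := by
  have e : (x : UnitAddCircle) = ((x - 1 : ℝ) : UnitAddCircle) := by
    rw [coe_eq_coe_iff_exists_int]; exact ⟨1, by simp⟩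
  rw [e, UnitAddCircle.norm_coe_of_abs_le (abs_le.2 ⟨by linarith, by linarith⟩), abs_sub_comm]

/-- The parametrization of the boundary of the rectangle with lower left corner `(a₁, a₂)` and sides
`l A`, `m B` by the length `|dx₁| / l + |dx₂| / m`, normalized to `1`. In the coordinates
`X = (x₁ - a₁) / l`, `Y = (x₂ - a₂) / m`, both `X + Y` and `Y - X` are affine functions of the distance
to a point of the circle: to `0` for the former, to `A / (2 (A + B))` for the latter. -/
def rectParam (a₁ a₂ l m A B : ℝ) (t : UnitAddCircle) : Plane :=
  !₂[a₁ + l * ((A + B) * (‖t‖ - ‖t - ((A / (2 * (A + B)) : ℝ) : UnitAddCircle)‖) + A / 2),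
    a₂ + m * ((A + B) * (‖t‖ + ‖t - ((A / (2 * (A + B)) : ℝ) : UnitAddCircle)‖) - A / 2)]

/-- The open rectangle with lower left corner `(a₁, a₂)` and upper right corner `(b₁, b₂)`. -/
def rect (a₁ b₁ a₂ b₂ : ℝ) : Set Plane := {x : Plane | x 0 ∈ Ioo a₁ b₁ ∧ x 1 ∈ Ioo a₂ b₂}

theorem continuous_coord (j : Fin 2) : Continuous fun x : Plane => x j :=
  (EuclideanSpace.proj j : Plane →L[ℝ] ℝ).continuous

theorem isOpen_rect (a₁ b₁ a₂ b₂ : ℝ) : IsOpen (rect a₁ b₁ a₂ b₂) :=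
  (isOpen_Ioo.preimage (continuous_coord 0)).inter (isOpen_Ioo.preimage (continuous_coord 1))

theorem convex_rect (a₁ b₁ a₂ b₂ : ℝ) : Convex ℝ (rect a₁ b₁ a₂ b₂) :=
  ((convex_Ioo a₁ b₁).linear_preimage (EuclideanSpace.proj 0 : Plane →L[ℝ] ℝ).toLinearMap).inter
    ((convex_Ioo a₂ b₂).linear_preimage (EuclideanSpace.proj 1 : Plane →L[ℝ] ℝ).toLinearMap)

theorem isBoundedOpen_rect (a₁ b₁ a₂ b₂ : ℝ) : IsBoundedOpen (rect a₁ b₁ a₂ b₂) := by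
  refine ⟨isOpen_rect _ _ _ _, ?_⟩
  rw [isBounded_iff_forall_norm_le]
  refine ⟨(|a₁| + |b₁|) + (|a₂| + |b₂|), fun x hx => ?_⟩
  have h : ∀ {a b y : ℝ}, y ∈ Ioo a b → |y| ≤ |a| + |b| := by
    intro a b y hy
    rw [abs_le]
    exact ⟨by linarith [neg_abs_le a, abs_nonneg b, hy.1], by linarith [le_abs_self b, abs_nonneg a, hy.2]⟩
  rw [EuclideanSpace.norm_eq, Fin.sum_univ_two]
  refine Real.sqrt_le_iff.2 ⟨by positivity, ?_⟩
  simp only [Real.norm_eq_abs]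
  nlinarith [h hx.1, h hx.2, abs_nonneg (x 0), abs_nonneg (x 1)]

theorem closure_rect {a₁ b₁ a₂ b₂ : ℝ} (h₁ : a₁ < b₁) (h₂ : a₂ < b₂) :
    closure (rect a₁ b₁ a₂ b₂) = {x | x 0 ∈ Icc a₁ b₁ ∧ x 1 ∈ Icc a₂ b₂} := by
  have e : rect a₁ b₁ a₂ b₂ = (EuclideanSpace.equiv (Fin 2) ℝ).toHomeomorph ⁻¹'
      (univ.pi ![Ioo a₁ b₁, Ioo a₂ b₂]) := by
    ext x
    simp [rect, Set.pi, Fin.forall_fin_two]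
  rw [e, ← Homeomorph.preimage_closure, closure_pi_set]
  ext x
  simp [Set.pi, Fin.forall_fin_two, closure_Ioo h₁.ne, closure_Ioo h₂.ne]

theorem mem_frontier_rect_iff {a₁ b₁ a₂ b₂ : ℝ} (h₁ : a₁ < b₁) (h₂ : a₂ < b₂) {x : Plane} :
    x ∈ frontier (rect a₁ b₁ a₂ b₂) ↔ (x 0 ∈ Icc a₁ b₁ ∧ x 1 ∈ Icc a₂ b₂) ∧
      (x 0 = a₁ ∨ x 0 = b₁ ∨ x 1 = a₂ ∨ x 1 = b₂) := by
  rw [(isOpen_rect _ _ _ _).frontier_eq, closure_rect h₁ h₂]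
  simp only [Set.mem_sdiff, mem_ofPred_eq, rect, mem_Icc, mem_Ioo]
  constructor
  · rintro ⟨⟨⟨h3, h4⟩, h5, h6⟩, h7⟩
    refine ⟨⟨⟨h3, h4⟩, h5, h6⟩, ?_⟩
    by_contra! h8
    exact h7 ⟨⟨lt_of_le_of_ne h3 (Ne.symm h8.1), lt_of_le_of_ne h4 h8.2.1⟩,
      lt_of_le_of_ne h5 (Ne.symm h8.2.2.1), lt_of_le_of_ne h6 h8.2.2.2⟩
  · rintro ⟨h, h7⟩
    refine ⟨h, fun h8 => ?_⟩
    rcases h7 with h | h | h | h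
    · exact absurd h h8.1.1.ne'
    · exact absurd h h8.1.2.ne
    · exact absurd h h8.2.1.ne'
    · exact absurd h h8.2.2.ne

section Param

variable {a₁ a₂ l m A B : ℝ}

theorem rectParam_zero (t : UnitAddCircle) : rectParam a₁ a₂ l m A B t 0 =
    a₁ + l * ((A + B) * (‖t‖ - ‖t - ((A / (2 * (A + B)) : ℝ) : UnitAddCircle)‖) + A / 2) := rfl

theorem rectParam_one (t : UnitAddCircle) : rectParam a₁ a₂ l m A B t 1 =
    a₂ + m * ((A + B) * (‖t‖ + ‖t - ((A / (2 * (A + B)) : ℝ) : UnitAddCircle)‖) - A / 2) := rfl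

/-- The four sides of the rectangle. -/
theorem rectParam_coe (hA : 0 < A) (hB : 0 < B) {x : ℝ} (hx0 : 0 ≤ x) (hx1 : x ≤ 1) :
    (x ≤ A / (2 * (A + B)) ∧ rectParam a₁ a₂ l m A B x 0 = a₁ + l * (2 * (A + B) * x) ∧
      rectParam a₁ a₂ l m A B x 1 = a₂) ∨
    (A / (2 * (A + B)) ≤ x ∧ x ≤ 1 / 2 ∧ rectParam a₁ a₂ l m A B x 0 = a₁ + l * A ∧
      rectParam a₁ a₂ l m A B x 1 = a₂ + m * (2 * (A + B) * x - A)) ∨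
    (1 / 2 ≤ x ∧ x ≤ 1 / 2 + A / (2 * (A + B)) ∧
      rectParam a₁ a₂ l m A B x 0 = a₁ + l * (2 * A + B - 2 * (A + B) * x) ∧
      rectParam a₁ a₂ l m A B x 1 = a₂ + m * B) ∨
    (1 / 2 + A / (2 * (A + B)) ≤ x ∧ rectParam a₁ a₂ l m A B x 0 = a₁ ∧
      rectParam a₁ a₂ l m A B x 1 = a₂ + m * (2 * (A + B) - 2 * (A + B) * x)) := by
  have hS : 0 < A + B := by positivity
  set τ := A / (2 * (A + B)) with hτ
  have hτS : (A + B) * τ = A / 2 := by rw [hτ]; field_simp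
  have hτ0 : 0 < τ := by positivity
  have hτ1 : τ < 1 / 2 := by rw [hτ, div_lt_iff₀ (by positivity)]; linarith
  simp only [rectParam_zero, rectParam_one, ← hτ, ← AddCircle.coe_sub]
  rcases le_total x (1 / 2) with h | h
  · have e1 : ‖(x : UnitAddCircle)‖ = x := by
      rw [UnitAddCircle.norm_coe_of_abs_le (by rwa [abs_of_nonneg hx0]), abs_of_nonneg hx0]
    have e2 : ‖((x - τ : ℝ) : UnitAddCircle)‖ = |x - τ| :=
      UnitAddCircle.norm_coe_of_abs_le (abs_le.2 ⟨by linarith, by linarith⟩)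
    rw [e1, e2]
    rcases le_total x τ with h' | h'
    · refine Or.inl ⟨h', ?_, ?_⟩
      · rw [abs_of_nonpos (by linarith)]; linear_combination (-l) * hτS
      · rw [abs_of_nonpos (by linarith)]; linear_combination m * hτS
    · refine Or.inr (Or.inl ⟨h', h, ?_, ?_⟩)
      · rw [abs_of_nonneg (by linarith)]; linear_combination l * hτS
      · rw [abs_of_nonneg (by linarith)]; linear_combination (-m) * hτS
  · have e1 : ‖(x : UnitAddCircle)‖ = 1 - x := by
      rw [UnitAddCircle.norm_coe_of_half_le h (by linarith), abs_of_nonneg (by linarith)]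
    rcases le_total x (1 / 2 + τ) with h' | h'
    · have e2 : ‖((x - τ : ℝ) : UnitAddCircle)‖ = x - τ := by
        rw [UnitAddCircle.norm_coe_of_abs_le (abs_le.2 ⟨by linarith, by linarith⟩),
          abs_of_nonneg (by linarith)]
      rw [e1, e2]
      refine Or.inr (Or.inr (Or.inl ⟨h, h', ?_, ?_⟩))
      · linear_combination l * hτS
      · linear_combination (-m) * hτS
    · have e2 : ‖((x - τ : ℝ) : UnitAddCircle)‖ = 1 - (x - τ) := by
        rw [UnitAddCircle.norm_coe_of_half_le (by linarith) (by linarith),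
          abs_of_nonneg (by linarith)]
      rw [e1, e2]
      refine Or.inr (Or.inr (Or.inr ⟨h', ?_, ?_⟩))
      · linear_combination (-l) * hτS
      · linear_combination m * hτS

theorem continuous_rectParam : Continuous (rectParam a₁ a₂ l m A B) := by
  refine (PiLp.continuous_toLp 2 _).comp (continuous_pi fun i => ?_)
  fin_cases i
  · simp only [Fin.zero_eta, Matrix.cons_val_zero]; fun_prop
  · simp only [Fin.mk_one, Matrix.cons_val_one]; fun_prop

/-- In the parameter, the involution of `ℓ⁺` is the reflection `t ↦ -t`. -/
theorem rectParam_plus_iff (hl : l ≠ 0) (hm : m ≠ 0) (hA : 0 < A) (hB : 0 < B)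
    (s t : UnitAddCircle) :
    rectParam a₁ a₂ l m A B s 0 / l + rectParam a₁ a₂ l m A B s 1 / m =
      rectParam a₁ a₂ l m A B t 0 / l + rectParam a₁ a₂ l m A B t 1 / m ↔ s = t ∨ s = 0 - t := by
  have e : ∀ t, rectParam a₁ a₂ l m A B t 0 / l + rectParam a₁ a₂ l m A B t 1 / m =
      a₁ / l + a₂ / m + 2 * (A + B) * ‖t‖ := by
    intro t
    rw [rectParam_zero, rectParam_one]
    field_simp
    ring
  rw [e, e, zero_sub, ← UnitAddCircle.norm_eq_norm_iff, add_right_inj]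
  have : 2 * (A + B) ≠ 0 := by positivity
  exact mul_right_inj' this

/-- In the parameter, the involution of `ℓ⁻` is a reflection too. -/
theorem rectParam_minus_iff (hl : l ≠ 0) (hm : m ≠ 0) (hA : 0 < A) (hB : 0 < B)
    (s t : UnitAddCircle) :
    -(rectParam a₁ a₂ l m A B s 0 / l) + rectParam a₁ a₂ l m A B s 1 / m =
      -(rectParam a₁ a₂ l m A B t 0 / l) + rectParam a₁ a₂ l m A B t 1 / m ↔
        s = t ∨ s = ((A / (A + B) : ℝ) : UnitAddCircle) - t := by
  set τ : UnitAddCircle := ((A / (2 * (A + B)) : ℝ) : UnitAddCircle) with hτ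
  have e : ∀ t, -(rectParam a₁ a₂ l m A B t 0 / l) + rectParam a₁ a₂ l m A B t 1 / m =
      -(a₁ / l) + a₂ / m - A + 2 * (A + B) * ‖t - τ‖ := by
    intro t
    rw [rectParam_zero, rectParam_one, ← hτ]
    field_simp
    ring
  have e2 : ((A / (A + B) : ℝ) : UnitAddCircle) = τ + τ := by
    rw [hτ, ← AddCircle.coe_add, coe_eq_coe_iff_exists_int]
    exact ⟨0, by field_simp; norm_num⟩
  have : 2 * (A + B) ≠ 0 := by positivity
  rw [e, e, add_right_inj, mul_right_inj' this, UnitAddCircle.norm_eq_norm_iff, sub_left_inj, e2]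
  refine or_congr_right ⟨fun h => ?_, fun h => ?_⟩
  · rw [sub_eq_iff_eq_add] at h
    rw [h, neg_sub, sub_add_eq_add_sub]
  · rw [h, neg_sub, add_sub_assoc, add_sub_cancel_left]

theorem injective_rectParam (hl : l ≠ 0) (hm : m ≠ 0) (hA : 0 < A) (hB : 0 < B) :
    Function.Injective (rectParam a₁ a₂ l m A B) := by
  intro s t h
  rcases (rectParam_plus_iff hl hm hA hB s t).1 (by rw [h]) with h1 | h1
  · exact h1
  rcases (rectParam_minus_iff hl hm hA hB s t).1 (by rw [h]) with h2 | h2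
  · exact h2
  exfalso
  rw [h1, sub_left_inj, ← AddCircle.coe_zero, coe_eq_coe_iff_exists_int] at h2
  obtain ⟨n, hn⟩ := h2
  have h3 : 0 < A / (A + B) := by positivity
  have h4 : A / (A + B) < 1 := by rw [div_lt_one (by positivity)]; linarith
  have h5 : (-1 : ℝ) < n := by linarith
  have h6 : (n : ℝ) < 0 := by linarith
  norm_cast at h5 h6
  omega

theorem exists_coe_eq (t : UnitAddCircle) : ∃ x : ℝ, 0 ≤ x ∧ x ≤ 1 ∧ (x : UnitAddCircle) = t := by
  obtain ⟨y, rfl⟩ := QuotientAddGroup.mk_surjective t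
  refine ⟨Int.fract y, Int.fract_nonneg y, (Int.fract_lt_one y).le, ?_⟩
  rw [coe_eq_coe_iff_exists_int]
  exact ⟨-⌊y⌋, by rw [Int.fract]; push_cast; ring⟩

theorem rectParam_mem_frontier (hl : 0 < l) (hm : 0 < m) (hA : 0 < A) (hB : 0 < B)
    (t : UnitAddCircle) :
    rectParam a₁ a₂ l m A B t ∈ frontier (rect a₁ (a₁ + l * A) a₂ (a₂ + m * B)) := by
  have hS : 0 < 2 * (A + B) := by positivity
  have hτ : 2 * (A + B) * (A / (2 * (A + B))) = A := by field_simp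
  have hlA : 0 < l * A := by positivity
  have hmB : 0 < m * B := by positivity
  rw [mem_frontier_rect_iff (by linarith) (by linarith)]
  have hIcc : ∀ {a k X C : ℝ}, 0 < k → 0 ≤ X → X ≤ C → a + k * X ∈ Icc a (a + k * C) := by
    intro a k X C hk h0 h1
    exact ⟨le_add_of_nonneg_right (mul_nonneg hk.le h0),
      add_le_add_right (mul_le_mul_of_nonneg_left h1 hk.le) a⟩
  obtain ⟨x, hx0, hx1, rfl⟩ := exists_coe_eq t
  rcases rectParam_coe (a₁ := a₁) (a₂ := a₂) (l := l) (m := m) hA hB hx0 hx1 with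
    ⟨h, e1, e2⟩ | ⟨h, h', e1, e2⟩ | ⟨h, h', e1, e2⟩ | ⟨h, e1, e2⟩
  · have k := mul_le_mul_of_nonneg_left h hS.le
    rw [e1, e2]
    exact ⟨⟨hIcc hl (by positivity) (by linarith), by simp, by linarith⟩, by simp⟩
  · have k := mul_le_mul_of_nonneg_left h hS.le
    have k' := mul_le_mul_of_nonneg_left h' hS.le
    rw [e1, e2]
    exact ⟨⟨⟨by linarith, le_rfl⟩, hIcc hm (by linarith) (by linarith)⟩, by simp⟩
  · have k := mul_le_mul_of_nonneg_left h hS.le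
    have k' := mul_le_mul_of_nonneg_left h' hS.le
    rw [e1, e2]
    exact ⟨⟨hIcc hl (by linarith) (by linarith), by linarith, le_rfl⟩, by simp⟩
  · have k := mul_le_mul_of_nonneg_left h hS.le
    have k' := mul_le_mul_of_nonneg_left hx1 hS.le
    rw [e1, e2]
    exact ⟨⟨⟨le_rfl, by linarith⟩, hIcc hm (by linarith) (by linarith)⟩, by simp⟩

theorem range_rectParam (hl : 0 < l) (hm : 0 < m) (hA : 0 < A) (hB : 0 < B) :
    range (rectParam a₁ a₂ l m A B) = frontier (rect a₁ (a₁ + l * A) a₂ (a₂ + m * B)) := by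
  refine Subset.antisymm (range_subset_iff.2 fun t => rectParam_mem_frontier hl hm hA hB t) ?_
  have hS : 0 < 2 * (A + B) := by positivity
  have hlA : 0 < l * A := by positivity
  have hmB : 0 < m * B := by positivity
  intro z hz
  rw [mem_frontier_rect_iff (by linarith) (by linarith)] at hz
  obtain ⟨⟨⟨h1, h2⟩, h3, h4⟩, h⟩ := hz
  -- The rescaled coordinates of the point.
  obtain ⟨X, hX⟩ : ∃ X, z 0 = a₁ + l * X := ⟨(z 0 - a₁) / l, by field_simp; ring⟩
  obtain ⟨Y, hY⟩ : ∃ Y, z 1 = a₂ + m * Y := ⟨(z 1 - a₂) / m, by field_simp; ring⟩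
  rw [hX] at h1 h2 h
  rw [hY] at h3 h4 h
  have hX0 : 0 ≤ X := nonneg_of_mul_nonneg_right (by linarith) hl
  have hXA : X ≤ A := le_of_mul_le_mul_left (by linarith) hl
  have hY0 : 0 ≤ Y := nonneg_of_mul_nonneg_right (by linarith) hm
  have hYB : Y ≤ B := le_of_mul_le_mul_left (by linarith) hm
  have h' : X = 0 ∨ X = A ∨ Y = 0 ∨ Y = B := by
    rcases h with h | h | h | h
    · exact Or.inl (mul_left_cancel₀ hl.ne' (by linarith))
    · exact Or.inr (Or.inl (mul_left_cancel₀ hl.ne' (by linarith)))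
    · exact Or.inr (Or.inr (Or.inl (mul_left_cancel₀ hm.ne' (by linarith))))
    · exact Or.inr (Or.inr (Or.inr (mul_left_cancel₀ hm.ne' (by linarith))))
  -- It is enough to find the parameter for which `X + Y` and `Y - X` have the right values.
  suffices hs : ∃ t : UnitAddCircle, 2 * (A + B) * ‖t‖ = X + Y ∧
      2 * (A + B) * ‖t - ((A / (2 * (A + B)) : ℝ) : UnitAddCircle)‖ = A + Y - X by
    obtain ⟨t, e1, e2⟩ := hs
    refine ⟨t, ?_⟩
    ext i
    fin_cases i
    · change rectParam a₁ a₂ l m A B t 0 = z 0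
      rw [rectParam_zero, hX]; linear_combination (l / 2) * e1 - (l / 2) * e2
    · change rectParam a₁ a₂ l m A B t 1 = z 1
      rw [rectParam_one, hY]; linear_combination (m / 2) * e1 + (m / 2) * e2
  have key : ∀ w : ℝ, |w| ≤ A + B →
      2 * (A + B) * ‖((w / (2 * (A + B)) : ℝ) : UnitAddCircle)‖ = |w| := by
    intro w hw
    have e : |w / (2 * (A + B))| = |w| / (2 * (A + B)) := by rw [abs_div, abs_of_pos hS]
    rw [UnitAddCircle.norm_coe_of_abs_le, e, mul_div_cancel₀ _ hS.ne']
    rw [e, div_le_div_iff₀ hS two_pos]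
    linarith
  have sub : ∀ w : ℝ, ((w / (2 * (A + B)) : ℝ) : UnitAddCircle) -
      ((A / (2 * (A + B)) : ℝ) : UnitAddCircle) = (((w - A) / (2 * (A + B)) : ℝ) : UnitAddCircle) := by
    intro w
    rw [← AddCircle.coe_sub, sub_div]
  have abs_nn : ∀ w : ℝ, 0 ≤ w → w ≤ A + B → 2 * (A + B) *
      ‖((w / (2 * (A + B)) : ℝ) : UnitAddCircle)‖ = w := fun w h0 h1 => by
    rw [key w (by rwa [abs_of_nonneg h0]), abs_of_nonneg h0]
  have abs_np : ∀ w : ℝ, w ≤ 0 → -w ≤ A + B → 2 * (A + B) *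
      ‖((w / (2 * (A + B)) : ℝ) : UnitAddCircle)‖ = -w := fun w h0 h1 => by
    rw [key w (by rwa [abs_of_nonpos h0]), abs_of_nonpos h0]
  rcases h' with h5 | h5 | h5 | h5
  · refine ⟨((-Y / (2 * (A + B)) : ℝ) : UnitAddCircle), ?_, ?_⟩
    · rw [abs_np _ (by linarith) (by linarith), h5]; ring
    · rw [sub, abs_np _ (by linarith) (by linarith), h5]; ring
  · refine ⟨(((A + Y) / (2 * (A + B)) : ℝ) : UnitAddCircle), ?_, ?_⟩
    · rw [abs_nn _ (by linarith) (by linarith), h5]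
    · rw [sub, abs_nn _ (by linarith) (by linarith), h5]
  · refine ⟨((X / (2 * (A + B)) : ℝ) : UnitAddCircle), ?_, ?_⟩
    · rw [abs_nn _ (by linarith) (by linarith), h5, add_zero]
    · rw [sub, abs_np _ (by linarith) (by linarith), h5]; ring
  · refine ⟨(((2 * A + B - X) / (2 * (A + B)) : ℝ) : UnitAddCircle), ?_, ?_⟩
    · have e : (((2 * A + B - X) / (2 * (A + B)) : ℝ) : UnitAddCircle) =
          ((-(X + B) / (2 * (A + B)) : ℝ) : UnitAddCircle) := by
        rw [coe_eq_coe_iff_exists_int]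
        exact ⟨1, by field_simp; push_cast; ring⟩
      rw [e, abs_np _ (by linarith) (by linarith), h5]; ring
    · rw [sub, abs_nn _ (by linarith) (by linarith), h5]; ring

/-- The rectangle winds once around its centre: it is compared with the uniform rotation by means
of the outer normals of the four sides. -/
theorem exists_isAngle_rectParam (hl : 0 < l) (hm : 0 < m) (hA : 0 < A) (hB : 0 < B) :
    ∃ θ, IsAngle (rectParam a₁ a₂ l m A B) !₂[a₁ + l * A / 2, a₂ + m * B / 2] θ := by
  have hS : 0 < A + B := by positivity
  have hπ := Real.pi_pos
  set τ := A / (2 * (A + B)) with hτ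
  have hτ0 : 0 < τ := by positivity
  have hτ1 : τ < 1 / 2 := by rw [hτ, div_lt_iff₀ (by positivity)]; linarith
  have hlA : 0 < l * A := by positivity
  have hmB : 0 < m * B := by positivity
  have hπτ : 0 < Real.pi * τ := by positivity
  have hπτ1 : Real.pi * τ < Real.pi / 2 := by
    have := mul_lt_mul_of_pos_left hτ1 hπ
    linarith
  refine exists_isAngle_of_halfPlane continuous_rectParam
    (α := fun t => 2 * Real.pi * t - Real.pi * τ - Real.pi / 2) (by fun_prop)
    (fun t => by ring) fun t => ?_
  have et : t = Int.fract t + ⌊t⌋ := (Int.fract_add_floor t).symm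
  have ep : (t : UnitAddCircle) = ((Int.fract t : ℝ) : UnitAddCircle) := by
    rw [coe_eq_coe_iff_exists_int]
    exact ⟨⌊t⌋, by rw [Int.fract]; ring⟩
  set x := Int.fract t
  have ec : Real.cos (2 * Real.pi * t - Real.pi * τ - Real.pi / 2) =
      Real.sin (2 * Real.pi * x - Real.pi * τ) := by
    rw [Real.cos_sub_pi_div_two, ← Real.sin_add_int_mul_two_pi (2 * Real.pi * x - Real.pi * τ) ⌊t⌋]
    congr 1
    linear_combination (2 * Real.pi) * et
  have es : Real.sin (2 * Real.pi * t - Real.pi * τ - Real.pi / 2) =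
      -Real.cos (2 * Real.pi * x - Real.pi * τ) := by
    rw [Real.sin_sub_pi_div_two, ← Real.cos_add_int_mul_two_pi (2 * Real.pi * x - Real.pi * τ) ⌊t⌋]
    congr 2
    linear_combination (2 * Real.pi) * et
  rw [ec, es, ep]
  have c0 : (!₂[a₁ + l * A / 2, a₂ + m * B / 2] : Plane) 0 = a₁ + l * A / 2 := rfl
  have c1 : (!₂[a₁ + l * A / 2, a₂ + m * B / 2] : Plane) 1 = a₂ + m * B / 2 := rfl
  rw [c0, c1]
  have hle : ∀ {y z : ℝ}, y ≤ z → Real.pi * y ≤ Real.pi * z := fun h =>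
    mul_le_mul_of_nonneg_left h hπ.le
  have hx0 : 0 ≤ x := Int.fract_nonneg t
  have hx1 : x ≤ 1 := (Int.fract_lt_one t).le
  have h0 := hle hx0
  have h1 := hle hx1
  rcases rectParam_coe (a₁ := a₁) (a₂ := a₂) (l := l) (m := m) hA hB hx0 hx1 with
    ⟨h, e1, e2⟩ | ⟨h, h', e1, e2⟩ | ⟨h, h', e1, e2⟩ | ⟨h, e1, e2⟩ <;> rw [e1, e2]
  · have k := hle h
    have := Real.cos_pos_of_mem_Ioo (x := 2 * Real.pi * x - Real.pi * τ)
      ⟨by linarith, by linarith⟩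
    exact ⟨0, -1, by linarith, by linarith⟩
  · have k := hle h
    have k' := hle h'
    have := Real.sin_pos_of_pos_of_lt_pi (x := 2 * Real.pi * x - Real.pi * τ)
      (by linarith) (by linarith)
    exact ⟨1, 0, by linarith, by linarith⟩
  · have k := hle h
    have k' := hle h'
    have := Real.cos_neg_of_pi_div_two_lt_of_lt (x := 2 * Real.pi * x - Real.pi * τ)
      (by linarith) (by linarith)
    exact ⟨0, 1, by linarith, by linarith⟩
  · have k := hle h
    have := Real.sin_pos_of_pos_of_lt_pi (x := 2 * Real.pi * x - Real.pi * τ - Real.pi)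
      (by linarith) (by linarith)
    rw [Real.sin_sub_pi] at this
    exact ⟨-1, 0, by linarith, by linarith⟩

theorem isPositiveParametrization_rectParam (hl : 0 < l) (hm : 0 < m) (hA : 0 < A) (hB : 0 < B) :
    IsPositiveParametrization (rect a₁ (a₁ + l * A) a₂ (a₂ + m * B))
      (rectParam a₁ a₂ l m A B) := by
  have hlA : 0 < l * A := by positivity
  have hmB : 0 < m * B := by positivity
  refine isPositiveParametrization_of_convex (isOpen_rect _ _ _ _) (convex_rect _ _ _ _)
    continuous_rectParam (injective_rectParam hl.ne' hm.ne' hA hB) (range_rectParam hl hm hA hB)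
    ?_ (exists_isAngle_rectParam hl hm hA hB)
  exact ⟨⟨show a₁ < a₁ + l * A / 2 by linarith, show a₁ + l * A / 2 < a₁ + l * A by linarith⟩,
    show a₂ < a₂ + m * B / 2 by linarith, show a₂ + m * B / 2 < a₂ + m * B by linarith⟩

end Param

theorem sqrt_one_sub_sq_pos {lam : ℝ} (h : lam ∈ Ioo (0 : ℝ) 1) : 0 < √(1 - lam ^ 2) :=
  Real.sqrt_pos.2 (by nlinarith [h.1, h.2])

theorem isRotationNumber_rect {a₁ b₁ a₂ b₂ : ℝ} (h₁ : a₁ < b₁) (h₂ : a₂ < b₂) {lam : ℝ}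
    (hlam : lam ∈ Ioo (0 : ℝ) 1) :
    IsRotationNumber (rect a₁ b₁ a₂ b₂) lam ((-(((b₁ - a₁) / lam) /
      ((b₁ - a₁) / lam + (b₂ - a₂) / √(1 - lam ^ 2))) : ℝ) : UnitAddCircle) := by
  have hm := sqrt_one_sub_sq_pos hlam
  have hl := hlam.1
  set m := √(1 - lam ^ 2)
  have hA : 0 < (b₁ - a₁) / lam := div_pos (sub_pos.2 h₁) hl
  have hB : 0 < (b₂ - a₂) / m := div_pos (sub_pos.2 h₂) hm
  have e₁ : b₁ = a₁ + lam * ((b₁ - a₁) / lam) := by field_simp; ring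
  have e₂ : b₂ = a₂ + m * ((b₂ - a₂) / m) := by field_simp; ring
  have hp := isPositiveParametrization_rectParam (a₁ := a₁) (a₂ := a₂) hl hm hA hB
  rw [← e₁, ← e₂] at hp
  have := isRotationNumber_of_reflections (isOpen_rect a₁ b₁ a₂ b₂)
    ⟨!₂[(a₁ + b₁) / 2, (a₂ + b₂) / 2], ⟨show a₁ < (a₁ + b₁) / 2 by linarith,
      show (a₁ + b₁) / 2 < b₁ by linarith⟩, show a₂ < (a₂ + b₂) / 2 by linarith,
      show (a₂ + b₂) / 2 < b₂ by linarith⟩ hp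
    (rectParam_plus_iff hl.ne' hm.ne' hA hB) (rectParam_minus_iff hl.ne' hm.ne' hA hB)
  rwa [zero_sub, ← AddCircle.coe_neg] at this

theorem isRationalMod_rotationNumber_rect_iff {a₁ b₁ a₂ b₂ : ℝ} (h₁ : a₁ < b₁) (h₂ : a₂ < b₂)
    {lam : ℝ} (hlam : lam ∈ Ioo (0 : ℝ) 1) :
    IsRationalMod (rotationNumber (rect a₁ b₁ a₂ b₂) lam) ↔
      ∃ q : ℚ, (q : ℝ) = lam * (b₂ - a₂) / (√(1 - lam ^ 2) * (b₁ - a₁)) := by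
  rw [(isRotationNumber_rect h₁ h₂ hlam).rotationNumber_eq, isRationalMod_coe_iff]
  have hm := sqrt_one_sub_sq_pos hlam
  have hl := hlam.1
  set m := √(1 - lam ^ 2)
  have hL₁ := sub_pos.2 h₁
  have hL₂ := sub_pos.2 h₂
  set L₁ := b₁ - a₁
  set L₂ := b₂ - a₂
  -- the two numbers are `-1 / (1 + ρ)` and `ρ`
  have hρ : 0 < lam * L₂ / (m * L₁) := by positivity
  have e : -((L₁ / lam) / (L₁ / lam + L₂ / m)) = -(1 + lam * L₂ / (m * L₁))⁻¹ := by
    field_simp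
  rw [e]
  set ρ := lam * L₂ / (m * L₁)
  constructor
  · rintro ⟨q, hq⟩
    refine ⟨-q⁻¹ - 1, ?_⟩
    push_cast
    rw [hq]
    field_simp
    ring
  · rintro ⟨q, hq⟩
    exact ⟨-(1 + q)⁻¹, by push_cast; rw [hq]⟩

section

/-! ### Eigenvectors given by smooth functions -/

namespace GradientForms

variable {H L : Type*} [NormedAddCommGroup H] [InnerProductSpace ℂ H]
  [NormedAddCommGroup L] [InnerProductSpace ℂ L] {G : GradientForms H L}

theorem isEigenpair_of_apply {u : H} {μ : ℂ} (h : ∀ v, G.S₁ u v = μ * G.lap u v) :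
    G.IsEigenpair μ u := ContinuousLinearMap.ext h

theorem IsEigenpair.eq_zero_of_jordan_apply {u v : H} {μ : ℂ} (hu : G.IsEigenpair μ u)
    (h : ∀ w, G.S₁ v w = μ * G.lap v w + G.lap u w) : u = 0 :=
  hu.eq_zero_of_jordan (v := v) (ContinuousLinearMap.ext h)

variable [CompleteSpace H] [CompleteSpace L]

theorem eq_zero_of_lap_apply {u : H} (h : ∀ v, G.lap u v = 0) : u = 0 := by
  refine G.lap_bijective.1 ?_
  rw [map_zero]
  exact ContinuousLinearMap.ext h

end GradientForms

namespace IsBoundedOpen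

variable {Ω : Set Plane}

theorem integrableOn_continuous_mul (hΩ : IsBoundedOpen Ω) {P g : Plane → ℂ} (hP : Continuous P)
    (hg : IntegrableOn g Ω) : IntegrableOn (fun x => P x * g x) Ω := by
  obtain ⟨C, hC⟩ := hΩ.exists_bound hP
  exact hg.bdd_mul hP.aestronglyMeasurable
    ((ae_restrict_mem hΩ.isOpen.measurableSet).mono fun x hx => hC x hx)

theorem lap_jet (hΩ : IsBoundedOpen Ω) {f : Plane → ℂ} {hf : IsSmooth f}
    (h : hΩ.jet f hf ∈ H10 Ω) (v : H10 Ω) :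
    hΩ.forms.lap ⟨hΩ.jet f hf, h⟩ v = ∫ x in Ω, (partialDeriv 0 (partialDeriv 0 f) x +
      partialDeriv 1 (partialDeriv 1 f) x) * (v : Jet Ω) none x := by
  have h0 := hΩ.secondDeriv_jet h 0 v
  have h1 := hΩ.secondDeriv_jet h 1 v
  have hi : ∀ j, IntegrableOn (fun x => partialDeriv j (partialDeriv j f) x * (v : Jet Ω) none x) Ω :=
    fun j => hΩ.integrableOn_continuous_mul ((hf.partialDeriv j).partialDeriv j).continuous
      (hΩ.integrable_L2 _)
  have h2 : hΩ.forms.lap ⟨hΩ.jet f hf, h⟩ v = secondDeriv Ω 0 ⟨hΩ.jet f hf, h⟩ v +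
    secondDeriv Ω 1 ⟨hΩ.jet f hf, h⟩ v := rfl
  rw [h2, h0, h1, ← integral_add (hi 0) (hi 1)]
  simp only [add_mul]

/-- A smooth function with `∂₂² f = μ Δ f`, vanishing on the boundary, is an eigenvector. -/
theorem isEigenpair_jet (hΩ : IsBoundedOpen Ω) {f : Plane → ℂ} {hf : IsSmooth f}
    (h : hΩ.jet f hf ∈ H10 Ω) {μ : ℂ} (hμ : ∀ x, partialDeriv 1 (partialDeriv 1 f) x =
      μ * (partialDeriv 0 (partialDeriv 0 f) x + partialDeriv 1 (partialDeriv 1 f) x)) :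
    hΩ.forms.IsEigenpair μ ⟨hΩ.jet f hf, h⟩ := by
  refine GradientForms.isEigenpair_of_apply fun v => ?_
  have h1 : hΩ.forms.S₁ ⟨hΩ.jet f hf, h⟩ v = _ := hΩ.secondDeriv_jet h 1 v
  rw [h1, lap_jet, ← integral_const_mul]
  congr 1
  funext x
  exact (congrArg (· * (v : Jet Ω) none x) (hμ x)).trans (mul_assoc _ _ _)

theorem jet_eq_zero_of_laplacian_eq_zero (hΩ : IsBoundedOpen Ω) {f : Plane → ℂ} {hf : IsSmooth f}
    (h : hΩ.jet f hf ∈ H10 Ω) (h0 : ∀ x, partialDeriv 0 (partialDeriv 0 f) x +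
      partialDeriv 1 (partialDeriv 1 f) x = 0) : (⟨hΩ.jet f hf, h⟩ : H10 Ω) = 0 := by
  refine GradientForms.eq_zero_of_lap_apply (G := hΩ.forms) fun v => ?_
  rw [lap_jet]
  simp only [h0, zero_mul, integral_zero]

/-- A smooth eigenfunction `g` at the bottom of a Jordan block of smooth functions is zero. -/
theorem jet_eq_zero_of_jordan (hΩ : IsBoundedOpen Ω) {f g : Plane → ℂ} {hf : IsSmooth f}
    {hg : IsSmooth g} (hf' : hΩ.jet f hf ∈ H10 Ω) (hg' : hΩ.jet g hg ∈ H10 Ω) {μ : ℂ}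
    (h₁ : ∀ x, partialDeriv 1 (partialDeriv 1 g) x =
      μ * (partialDeriv 0 (partialDeriv 0 g) x + partialDeriv 1 (partialDeriv 1 g) x))
    (h₂ : ∀ x, partialDeriv 1 (partialDeriv 1 f) x =
      μ * (partialDeriv 0 (partialDeriv 0 f) x + partialDeriv 1 (partialDeriv 1 f) x) +
        (partialDeriv 0 (partialDeriv 0 g) x + partialDeriv 1 (partialDeriv 1 g) x)) :
    (⟨hΩ.jet g hg, hg'⟩ : H10 Ω) = 0 := by
  refine (hΩ.isEigenpair_jet hg' h₁).eq_zero_of_jordan_apply (v := ⟨hΩ.jet f hf, hf'⟩) fun v => ?_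
  have hi : ∀ {f : Plane → ℂ}, IsSmooth f → IntegrableOn (fun x => (partialDeriv 0 (partialDeriv 0 f) x +
      partialDeriv 1 (partialDeriv 1 f) x) * (v : Jet Ω) none x) Ω := fun hf =>
    hΩ.integrableOn_continuous_mul (((hf.partialDeriv 0).partialDeriv 0).continuous.add
      ((hf.partialDeriv 1).partialDeriv 1).continuous) (hΩ.integrable_L2 _)
  refine (hΩ.secondDeriv_jet hf' 1 v).trans (Eq.trans ?_
    (congrArg₂ (fun a b => μ * a + b) (hΩ.lap_jet hf' v) (hΩ.lap_jet hg' v)).symm)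
  beta_reduce
  rw [← integral_const_mul, ← integral_add ((hi hf).const_mul μ) (hi hg)]
  congr 1
  funext x
  refine (congrArg (· * (v : Jet Ω) none x) (h₂ x)).trans ?_
  ring

end IsBoundedOpen

/-! ### Density of the eigenvalues -/

/-- By the intermediate value theorem, a continuous strictly monotone function takes rational values on a
dense set. -/
theorem closure_sq_eq_Icc {φ : ℝ → ℝ} (hc : ContinuousOn φ (Ioo 0 1))
    (hm : StrictMonoOn φ (Ioo 0 1)) :
    closure {μ : ℂ | ∃ lam ∈ Ioo (0 : ℝ) 1, μ = ((lam ^ 2 : ℝ) : ℂ) ∧ ∃ q : ℚ, (q : ℝ) = φ lam} =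
      Complex.ofReal '' Icc (0 : ℝ) 1 := by
  set D : Set ℝ := {lam | lam ∈ Ioo (0 : ℝ) 1 ∧ ∃ q : ℚ, (q : ℝ) = φ lam} with hD
  have hdense : Ioo (0 : ℝ) 1 ⊆ closure D := by
    intro x hx
    rw [mem_closure_iff_nhds_basis (nhds_basis_Ioo' ⟨_, sub_one_lt x⟩ ⟨_, lt_add_one x⟩)]
    rintro ⟨a, b⟩ ⟨ha, hb⟩
    obtain ⟨c, hc1, hc2⟩ := exists_between (max_lt hx.1 ha)
    obtain ⟨d, hd1, hd2⟩ := exists_between (lt_min hx.2 hb)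
    have hc' : c ∈ Ioo (0 : ℝ) 1 := ⟨(le_max_left _ _).trans_lt hc1, hc2.trans hx.2⟩
    have hd' : d ∈ Ioo (0 : ℝ) 1 := ⟨hx.1.trans hd1, hd2.trans_le (min_le_left _ _)⟩
    obtain ⟨q, hq1, hq2⟩ := exists_rat_btwn (hm hc' hd' (hc2.trans hd1))
    have hsub : Icc c d ⊆ Ioo (0 : ℝ) 1 := fun y hy => ⟨hc'.1.trans_le hy.1, hy.2.trans_lt hd'.2⟩
    obtain ⟨y, hy, hyq⟩ := intermediate_value_Icc (hc2.trans hd1).le (hc.mono hsub)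
      ⟨hq1.le, hq2.le⟩
    exact ⟨y, ⟨hsub hy, q, hyq.symm⟩, ((le_max_right _ _).trans_lt hc1).trans_le hy.1,
      hy.2.trans_lt (hd2.trans_le (min_le_right _ _))⟩
  have hset : {μ : ℂ | ∃ lam ∈ Ioo (0 : ℝ) 1, μ = ((lam ^ 2 : ℝ) : ℂ) ∧ ∃ q : ℚ, (q : ℝ) = φ lam} =
      (fun lam : ℝ => ((lam ^ 2 : ℝ) : ℂ)) '' D := by
    ext μ
    constructor
    · rintro ⟨lam, h1, h2, h3⟩
      exact ⟨lam, ⟨h1, h3⟩, h2.symm⟩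
    · rintro ⟨lam, ⟨h1, h3⟩, h2⟩
      exact ⟨lam, h1, h2.symm, h3⟩
  have hcl : closure D = Icc 0 1 := by
    refine Subset.antisymm (closure_minimal (fun y hy => ⟨hy.1.1.le, hy.1.2.le⟩) isClosed_Icc) ?_
    rw [← closure_Ioo (zero_ne_one (α := ℝ))]
    exact closure_minimal hdense isClosed_closure
  have hsq : Continuous fun lam : ℝ => ((lam ^ 2 : ℝ) : ℂ) := by fun_prop
  have hcomp : IsCompact (closure D) := hcl ▸ isCompact_Icc
  rw [hset, ← image_closure_of_isCompact hcomp hsq.continuousOn, hcl]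
  ext μ
  constructor
  · rintro ⟨lam, h, rfl⟩
    exact ⟨lam ^ 2, ⟨by positivity, pow_le_one₀ h.1 h.2⟩, rfl⟩
  · rintro ⟨s, h, rfl⟩
    exact ⟨√s, ⟨Real.sqrt_nonneg s, Real.sqrt_le_one.2 h.2⟩, by simp only [Real.sq_sqrt h.1]⟩

theorem strictMonoOn_mul_div_sqrt {k : ℝ} (hk : 0 < k) :
    StrictMonoOn (fun lam : ℝ => k * (lam / √(1 - lam ^ 2))) (Ioo 0 1) := by
  intro x hx y hy hxy
  refine mul_lt_mul_of_pos_left ?_ hk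
  refine div_lt_div₀ hxy (Real.sqrt_le_sqrt ?_) hy.1.le (sqrt_one_sub_sq_pos hy)
  have := pow_le_pow_left₀ hx.1.le hxy.le 2
  linarith

theorem continuousOn_div_sqrt : ContinuousOn (fun lam : ℝ => lam / √(1 - lam ^ 2)) (Ioo 0 1) := by
  refine continuousOn_id.div (by fun_prop) fun x hx => (sqrt_one_sub_sq_pos hx).ne'

/-! ### Eigenfunctions of rectangles -/

/-- The product of a function of the first coordinate and a function of the second. -/
def sepProd (g h : ℝ → ℂ) (x : Plane) : ℂ := g (x 0) * h (x 1)

theorem isSmooth_sepProd {g h : ℝ → ℂ} (hg : ContDiff ℝ ((⊤ : ℕ∞) : WithTop ℕ∞) g)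
    (hh : ContDiff ℝ ((⊤ : ℕ∞) : WithTop ℕ∞) h) : IsSmooth (sepProd g h) :=
  (hg.comp (EuclideanSpace.proj 0 : Plane →L[ℝ] ℝ).contDiff).mul
    (hh.comp (EuclideanSpace.proj 1 : Plane →L[ℝ] ℝ).contDiff)

theorem partialDeriv_comp_coord {g : ℝ → ℂ} {x : Plane} (i j : Fin 2)
    (hg : DifferentiableAt ℝ g (x i)) :
    partialDeriv j (fun x => g (x i)) x = if i = j then deriv g (x i) else 0 := by
  have h1 := hg.hasDerivAt.hasFDerivAt.comp x (EuclideanSpace.proj i : Plane →L[ℝ] ℝ).hasFDerivAt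
  have h2 : HasFDerivAt (fun x : Plane => g (x i)) _ x := h1
  unfold partialDeriv
  rw [h2.fderiv]
  split_ifs with h
  · simp [h]
  · simp [h]

theorem partialDeriv_zero_sepProd {g h : ℝ → ℂ} (hg : Differentiable ℝ g)
    (hh : Differentiable ℝ h) : partialDeriv 0 (sepProd g h) = sepProd (deriv g) h := by
  funext x
  have hg' : DifferentiableAt ℝ (fun x : Plane => g (x 0)) x :=
    (hg _).comp x (EuclideanSpace.proj 0 : Plane →L[ℝ] ℝ).differentiableAt
  have hh' : DifferentiableAt ℝ (fun x : Plane => h (x 1)) x :=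
    (hh _).comp x (EuclideanSpace.proj 1 : Plane →L[ℝ] ℝ).differentiableAt
  have := partialDeriv_mul hg' hh' 0
  rw [partialDeriv_comp_coord 0 0 (hg _), partialDeriv_comp_coord 1 0 (hh _)] at this
  exact this.trans (by simp [sepProd])

theorem partialDeriv_one_sepProd {g h : ℝ → ℂ} (hg : Differentiable ℝ g)
    (hh : Differentiable ℝ h) : partialDeriv 1 (sepProd g h) = sepProd g (deriv h) := by
  funext x
  have hg' : DifferentiableAt ℝ (fun x : Plane => g (x 0)) x :=
    (hg _).comp x (EuclideanSpace.proj 0 : Plane →L[ℝ] ℝ).differentiableAt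
  have hh' : DifferentiableAt ℝ (fun x : Plane => h (x 1)) x :=
    (hh _).comp x (EuclideanSpace.proj 1 : Plane →L[ℝ] ℝ).differentiableAt
  have := partialDeriv_mul hg' hh' 1
  rw [partialDeriv_comp_coord 0 1 (hg _), partialDeriv_comp_coord 1 1 (hh _)] at this
  exact this.trans (by simp [sepProd])

/-- The function `sin (c (s - a))`, with complex values. -/
def sine (c a s : ℝ) : ℂ := (Real.sin (c * (s - a)) : ℂ)

theorem contDiff_sine (c a : ℝ) : ContDiff ℝ ((⊤ : ℕ∞) : WithTop ℕ∞) (sine c a) :=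
  Complex.ofRealCLM.contDiff.comp
    (Real.contDiff_sin.comp (contDiff_const.mul (contDiff_id.sub contDiff_const)))

theorem contDiff_deriv_sine (c a : ℝ) : ContDiff ℝ ((⊤ : ℕ∞) : WithTop ℕ∞) (deriv (sine c a)) :=
  (contDiff_infty_iff_deriv.1 (contDiff_sine c a)).2

theorem deriv_deriv_sine (c a : ℝ) : deriv (deriv (sine c a)) = fun s => -(c : ℂ) ^ 2 * sine c a s := by
  have hl : ∀ s, HasDerivAt (fun s : ℝ => c * (s - a)) c s := fun s => by
    simpa using ((hasDerivAt_id s).sub_const a).const_mul c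
  have h1 : deriv (sine c a) = fun s => ((Real.cos (c * (s - a)) * c : ℝ) : ℂ) :=
    funext fun s => ((hl s).sin.ofReal_comp).deriv
  rw [h1]
  funext s
  rw [(((hl s).cos.mul_const c).ofReal_comp).deriv, sine]
  push_cast
  ring

theorem norm_sine_le_one (c a s : ℝ) : ‖sine c a s‖ ≤ 1 := by
  rw [sine, Complex.norm_real]
  exact Real.abs_sin_le_one _

/-- A sine that vanishes at `a` and at `b` is bounded by a multiple of `(s - a) (b - s)`. -/
theorem norm_sine_le {c a b s : ℝ} (hc : 0 ≤ c) {j : ℕ} (hj : c * (b - a) = j * Real.pi)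
    (hs : s ∈ Ioo a b) : ‖sine c a s‖ ≤ 2 * c / (b - a) * ((s - a) * (b - s)) := by
  rw [sine, Complex.norm_real, Real.norm_eq_abs]
  have hL : 0 < b - a := sub_pos.2 (hs.1.trans hs.2)
  have h0 : 0 < s - a := sub_pos.2 hs.1
  have h1 : 0 < b - s := sub_pos.2 hs.2
  have k0 : |Real.sin (c * (s - a))| ≤ c * (s - a) := by
    refine Real.abs_sin_le_abs.trans_eq (abs_of_nonneg (by positivity))
  have k1 : |Real.sin (c * (s - a))| ≤ c * (b - s) := by
    have e : c * (s - a) = j * Real.pi - c * (b - s) := by rw [← hj]; ring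
    have e2 : |Real.sin (c * (s - a))| = |Real.sin (c * (b - s))| := by
      rw [e, Real.sin_nat_mul_pi_sub, abs_neg, abs_mul, abs_pow, abs_neg, abs_one, one_pow, one_mul]
    rw [e2]
    exact Real.abs_sin_le_abs.trans_eq (abs_of_nonneg (by positivity))
  rw [div_mul_eq_mul_div, le_div_iff₀ hL]
  nlinarith [mul_le_mul_of_nonneg_right k0 h1.le, mul_le_mul_of_nonneg_right k1 h0.le]

theorem sine_add (c d a s : ℝ) : sine c a s * (Real.cos (d * (s - a)) : ℂ) =
    (1 / 2) * sine (c + d) a s + (1 / 2) * sine (c - d) a s := by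
  simp only [sine]
  rw [add_mul, sub_mul, Real.sin_add, Real.sin_sub]
  push_cast
  ring

/-- The product of sines with `j` half waves in the first and `k` half waves in the second
coordinate of the rectangle. -/
def rectMode (a₁ b₁ a₂ b₂ : ℝ) (j k : ℕ) : Plane → ℂ :=
  sepProd (sine (j * (Real.pi / (b₁ - a₁))) a₁) (sine (k * (Real.pi / (b₂ - a₂))) a₂)

section Modes

variable {a₁ b₁ a₂ b₂ : ℝ}

theorem isSmooth_rectMode (j k : ℕ) : IsSmooth (rectMode a₁ b₁ a₂ b₂ j k) :=
  isSmooth_sepProd (contDiff_sine _ _) (contDiff_sine _ _)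

theorem partialDeriv_zero_rectMode (j k : ℕ) (x : Plane) :
    partialDeriv 0 (partialDeriv 0 (rectMode a₁ b₁ a₂ b₂ j k)) x =
      -((j * (Real.pi / (b₁ - a₁)) : ℝ) : ℂ) ^ 2 * rectMode a₁ b₁ a₂ b₂ j k x := by
  rw [rectMode, partialDeriv_zero_sepProd ((contDiff_sine _ _).differentiable (by simp))
      ((contDiff_sine _ _).differentiable (by simp)),
    partialDeriv_zero_sepProd ((contDiff_deriv_sine _ _).differentiable (by simp))
      ((contDiff_sine _ _).differentiable (by simp)), deriv_deriv_sine]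
  simp only [sepProd, mul_assoc]

theorem partialDeriv_one_rectMode (j k : ℕ) (x : Plane) :
    partialDeriv 1 (partialDeriv 1 (rectMode a₁ b₁ a₂ b₂ j k)) x =
      -((k * (Real.pi / (b₂ - a₂)) : ℝ) : ℂ) ^ 2 * rectMode a₁ b₁ a₂ b₂ j k x := by
  rw [rectMode, partialDeriv_one_sepProd ((contDiff_sine _ _).differentiable (by simp))
      ((contDiff_sine _ _).differentiable (by simp)),
    partialDeriv_one_sepProd ((contDiff_sine _ _).differentiable (by simp))
      ((contDiff_deriv_sine _ _).differentiable (by simp)), deriv_deriv_sine]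
  simp only [sepProd]
  ring

theorem rectMode_jet_mem_H10 (h₁ : a₁ < b₁) (h₂ : a₂ < b₂) (j k : ℕ) :
    (isBoundedOpen_rect a₁ b₁ a₂ b₂).jet (rectMode a₁ b₁ a₂ b₂ j k) (isSmooth_rectMode j k) ∈
      H10 (rect a₁ b₁ a₂ b₂) := by
  have hL₁ := sub_pos.2 h₁
  have hL₂ := sub_pos.2 h₂
  have hπ := Real.pi_pos
  set c₁ := j * (Real.pi / (b₁ - a₁)) with hc₁
  set c₂ := k * (Real.pi / (b₂ - a₂)) with hc₂
  have hc₁0 : 0 ≤ c₁ := by positivity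
  have hc₂0 : 0 ≤ c₂ := by positivity
  have hs : ∀ (i : Fin 2) (a b : ℝ),
      ContDiff ℝ ((⊤ : ℕ∞) : WithTop ℕ∞) fun x : Plane => (x i - a) * (b - x i) := fun i a b =>
    ((EuclideanSpace.proj i : Plane →L[ℝ] ℝ).contDiff.sub contDiff_const).mul
      (contDiff_const.sub (EuclideanSpace.proj i : Plane →L[ℝ] ℝ).contDiff)
  have hIoo : ∀ {a b s : ℝ}, a < b → (0 < (s - a) * (b - s) ↔ s ∈ Ioo a b) := by
    intro a b s h
    constructor
    · intro h0
      rcases mul_pos_iff.1 h0 with h1 | h1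
      · exact ⟨by linarith [h1.1], by linarith [h1.2]⟩
      · linarith [h1.1, h1.2]
    · exact fun h0 => mul_pos (sub_pos.2 h0.1) (sub_pos.2 h0.2)
  set C := 2 * c₁ / (b₁ - a₁) + 2 * c₂ / (b₂ - a₂) with hC
  have hC₁ : 2 * c₁ / (b₁ - a₁) ≤ C := le_add_of_nonneg_right (by positivity)
  have hC₂ : 2 * c₂ / (b₂ - a₂) ≤ C := le_add_of_nonneg_left (by positivity)
  refine (isBoundedOpen_rect a₁ b₁ a₂ b₂).jet_mem_H10 (hs 0 a₁ b₁) (hs 1 a₂ b₂) ?_ _ (C := C) ?_ ?_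
  · ext x
    exact and_congr (hIoo h₁).symm (hIoo h₂).symm
  · intro x hx
    have h := norm_sine_le hc₁0 (j := j) (by rw [hc₁]; field_simp) hx.1
    calc ‖rectMode a₁ b₁ a₂ b₂ j k x‖ = ‖sine c₁ a₁ (x 0)‖ * ‖sine c₂ a₂ (x 1)‖ := norm_mul _ _
      _ ≤ ‖sine c₁ a₁ (x 0)‖ * 1 := by gcongr; exact norm_sine_le_one _ _ _
      _ ≤ C * ((x 0 - a₁) * (b₁ - x 0)) := by
        rw [mul_one]
        exact h.trans (mul_le_mul_of_nonneg_right hC₁ ((hIoo h₁).2 hx.1).le)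
  · intro x hx
    have h := norm_sine_le hc₂0 (j := k) (by rw [hc₂]; field_simp) hx.2
    calc ‖rectMode a₁ b₁ a₂ b₂ j k x‖ = ‖sine c₁ a₁ (x 0)‖ * ‖sine c₂ a₂ (x 1)‖ := norm_mul _ _
      _ ≤ 1 * ‖sine c₂ a₂ (x 1)‖ := by gcongr; exact norm_sine_le_one _ _ _
      _ ≤ C * ((x 1 - a₂) * (b₂ - x 1)) := by
        rw [one_mul]
        exact h.trans (mul_le_mul_of_nonneg_right hC₂ ((hIoo h₂).2 hx.2).le)

/-- The element of `H¹₀` given by `rectMode`. -/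
def rectModeH10 (h₁ : a₁ < b₁) (h₂ : a₂ < b₂) (j k : ℕ) : H10 (rect a₁ b₁ a₂ b₂) :=
  ⟨_, rectMode_jet_mem_H10 h₁ h₂ j k⟩

/-- The eigenvalue of `rectMode`. -/
def rectEigenvalue (a₁ b₁ a₂ b₂ : ℝ) (j k : ℕ) : ℝ :=
  (k * (Real.pi / (b₂ - a₂))) ^ 2 /
    ((j * (Real.pi / (b₁ - a₁))) ^ 2 + (k * (Real.pi / (b₂ - a₂))) ^ 2)

theorem isEigenpair_rectModeH10 (h₁ : a₁ < b₁) (h₂ : a₂ < b₂) {j k : ℕ} (hj : j ≠ 0) :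
    (isBoundedOpen_rect a₁ b₁ a₂ b₂).forms.IsEigenpair (rectEigenvalue a₁ b₁ a₂ b₂ j k : ℂ)
      (rectModeH10 h₁ h₂ j k) := by
  refine (isBoundedOpen_rect a₁ b₁ a₂ b₂).isEigenpair_jet _ fun x => ?_
  rw [partialDeriv_zero_rectMode, partialDeriv_one_rectMode, rectEigenvalue]
  have hL₁ := sub_pos.2 h₁
  have hπ := Real.pi_pos
  have hj' : (0 : ℝ) < j := by exact_mod_cast Nat.pos_of_ne_zero hj
  set c₁ := j * (Real.pi / (b₁ - a₁)) with hc₁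
  have hc : 0 < c₁ := by positivity
  set c₂ := k * (Real.pi / (b₂ - a₂))
  have h0 : ((c₁ ^ 2 + c₂ ^ 2 : ℝ) : ℂ) ≠ 0 := by
    have : c₁ ^ 2 + c₂ ^ 2 ≠ 0 := by positivity
    exact_mod_cast this
  rw [Complex.ofReal_div]
  push_cast at h0 ⊢
  field_simp
  ring

/-- The first mode has no zero in the rectangle. -/
theorem rectMode_one_one_ne_zero {x : Plane} (hx : x ∈ rect a₁ b₁ a₂ b₂) :
    rectMode a₁ b₁ a₂ b₂ 1 1 x ≠ 0 := by
  have key : ∀ {a b s : ℝ}, s ∈ Ioo a b → sine ((1 : ℕ) * (Real.pi / (b - a))) a s ≠ 0 := by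
    intro a b s hs
    have hL : 0 < b - a := sub_pos.2 (hs.1.trans hs.2)
    have h0 : 0 < s - a := sub_pos.2 hs.1
    have h1 : s - a < b - a := by linarith [hs.2]
    have := Real.sin_pos_of_pos_of_lt_pi (x := (1 : ℕ) * (Real.pi / (b - a)) * (s - a))
      (by have := Real.pi_pos; push_cast; positivity)
      (by
        rw [Nat.cast_one, one_mul, div_mul_eq_mul_div, div_lt_iff₀ hL]
        exact mul_lt_mul_of_pos_left h1 Real.pi_pos)
    rw [sine]
    exact_mod_cast this.ne'
  exact mul_ne_zero (key hx.1) (key hx.2)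

theorem rectModeH10_ne_zero (h₁ : a₁ < b₁) (h₂ : a₂ < b₂) {j k : ℕ} (hj : j ≠ 0) (hk : k ≠ 0) :
    rectModeH10 h₁ h₂ j k ≠ 0 := by
  intro h0
  have key : ∀ {a b : ℝ} {j : ℕ}, a < b → j ≠ 0 →
      a + (b - a) / (2 * j) ∈ Ioo a b ∧ sine (j * (Real.pi / (b - a))) a (a + (b - a) / (2 * j)) = 1 := by
    intro a b j h hj
    have hL := sub_pos.2 h
    have hj' : (1 : ℝ) ≤ j := by exact_mod_cast Nat.one_le_iff_ne_zero.2 hj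
    refine ⟨⟨lt_add_of_pos_right _ (by positivity), ?_⟩, ?_⟩
    · have : (b - a) / (2 * j) < b - a := by
        rw [div_lt_iff₀ (by positivity)]
        nlinarith
      linarith
    · have e : j * (Real.pi / (b - a)) * (a + (b - a) / (2 * j) - a) = Real.pi / 2 := by
        field_simp
        ring
      rw [sine, e, Real.sin_pi_div_two, Complex.ofReal_one]
  obtain ⟨m₁, e₁⟩ := key h₁ hj
  obtain ⟨m₂, e₂⟩ := key h₂ hk
  have h3 := (isBoundedOpen_rect a₁ b₁ a₂ b₂).eqOn_zero_of_jet_eq_zero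
    (rectMode_jet_mem_H10 h₁ h₂ j k) h0
    (show !₂[a₁ + (b₁ - a₁) / (2 * j), a₂ + (b₂ - a₂) / (2 * k)] ∈ rect a₁ b₁ a₂ b₂ from ⟨m₁, m₂⟩)
  have h4 : rectMode a₁ b₁ a₂ b₂ j k !₂[a₁ + (b₁ - a₁) / (2 * j), a₂ + (b₂ - a₂) / (2 * k)] =
    sine (j * (Real.pi / (b₁ - a₁))) a₁ (a₁ + (b₁ - a₁) / (2 * j)) *
      sine (k * (Real.pi / (b₂ - a₂))) a₂ (a₂ + (b₂ - a₂) / (2 * k)) := rfl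
  rw [h4, e₁, e₂] at h3
  simp at h3

/-- The linear span of the modes. -/
def rectModeSpan (a₁ b₁ a₂ b₂ : ℝ) : Submodule ℂ (Plane → ℂ) :=
  Submodule.span ℂ (range fun p : ℕ × ℕ => rectMode a₁ b₁ a₂ b₂ p.1 p.2)

theorem rectMode_mem_span (j k : ℕ) : rectMode a₁ b₁ a₂ b₂ j k ∈ rectModeSpan a₁ b₁ a₂ b₂ :=
  Submodule.subset_span ⟨(j, k), rfl⟩

theorem mul_mem_rectModeSpan {ψ : Plane → ℂ}
    (h : ∀ j k, (fun x => ψ x * rectMode a₁ b₁ a₂ b₂ j k x) ∈ rectModeSpan a₁ b₁ a₂ b₂)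
    {f : Plane → ℂ} (hf : f ∈ rectModeSpan a₁ b₁ a₂ b₂) :
    (fun x => ψ x * f x) ∈ rectModeSpan a₁ b₁ a₂ b₂ := by
  induction hf using Submodule.span_induction with
  | mem f hf => obtain ⟨p, rfl⟩ := hf; exact h p.1 p.2
  | zero =>
    convert (rectModeSpan a₁ b₁ a₂ b₂).zero_mem using 1
    funext x
    exact mul_zero _
  | add f g _ _ hf hg =>
    convert add_mem hf hg using 1
    funext x
    exact mul_add _ _ _
  | smul c f _ hf =>
    have := (rectModeSpan a₁ b₁ a₂ b₂).smul_mem c hf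
    convert this using 1
    funext x
    simp only [Pi.smul_apply, smul_eq_mul]
    ring

/-- The function whose values separate the points of the closed rectangle. -/
def rectCos (a₁ b₁ a₂ b₂ : ℝ) (x : Plane) : ℂ :=
  (Real.cos (Real.pi / (b₁ - a₁) * (x 0 - a₁)) : ℂ) +
    (Real.cos (Real.pi / (b₂ - a₂) * (x 1 - a₂)) : ℂ) * Complex.I

/-- For `j = 0` both sides vanish, and the index `j - 1` in the natural numbers is harmless. -/
theorem sine_mul_cos (κ a s : ℝ) (j : ℕ) : sine (j * κ) a s * (Real.cos (κ * (s - a)) : ℂ) =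
    (if j = 0 then 0 else 1 / 2) * sine ((j + 1 : ℕ) * κ) a s +
      (if j = 0 then 0 else 1 / 2) * sine ((j - 1 : ℕ) * κ) a s := by
  rcases j with _ | j
  · simp [sine]
  · rw [sine_add]
    simp only [Nat.add_sub_cancel, Nat.succ_ne_zero, if_false]
    push_cast
    ring_nf

theorem cos_zero_mul_mem {f : Plane → ℂ} (hf : f ∈ rectModeSpan a₁ b₁ a₂ b₂) :
    (fun x => (Real.cos (Real.pi / (b₁ - a₁) * (x 0 - a₁)) : ℂ) * f x) ∈
      rectModeSpan a₁ b₁ a₂ b₂ := by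
  refine mul_mem_rectModeSpan (fun j k => ?_) hf
  have := add_mem ((rectModeSpan a₁ b₁ a₂ b₂).smul_mem
    (if j = 0 then 0 else 1 / 2) (rectMode_mem_span (j + 1) k)) ((rectModeSpan a₁ b₁ a₂ b₂).smul_mem
    (if j = 0 then 0 else 1 / 2) (rectMode_mem_span (j - 1) k))
  convert this using 1
  funext x
  have e := sine_mul_cos (Real.pi / (b₁ - a₁)) a₁ (x 0) j
  simp only [Pi.add_apply, Pi.smul_apply, smul_eq_mul, rectMode, sepProd]
  linear_combination (sine (k * (Real.pi / (b₂ - a₂))) a₂ (x 1)) * e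

theorem cos_one_mul_mem {f : Plane → ℂ} (hf : f ∈ rectModeSpan a₁ b₁ a₂ b₂) :
    (fun x => (Real.cos (Real.pi / (b₂ - a₂) * (x 1 - a₂)) : ℂ) * f x) ∈
      rectModeSpan a₁ b₁ a₂ b₂ := by
  refine mul_mem_rectModeSpan (fun j k => ?_) hf
  have := add_mem ((rectModeSpan a₁ b₁ a₂ b₂).smul_mem
    (if k = 0 then 0 else 1 / 2) (rectMode_mem_span j (k + 1))) ((rectModeSpan a₁ b₁ a₂ b₂).smul_mem
    (if k = 0 then 0 else 1 / 2) (rectMode_mem_span j (k - 1)))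
  convert this using 1
  funext x
  have e := sine_mul_cos (Real.pi / (b₂ - a₂)) a₂ (x 1) k
  simp only [Pi.add_apply, Pi.smul_apply, smul_eq_mul, rectMode, sepProd]
  linear_combination (sine (j * (Real.pi / (b₁ - a₁))) a₁ (x 0)) * e

theorem rectCos_mul_mem {f : Plane → ℂ} (hf : f ∈ rectModeSpan a₁ b₁ a₂ b₂) :
    (fun x => rectCos a₁ b₁ a₂ b₂ x * f x) ∈ rectModeSpan a₁ b₁ a₂ b₂ := by
  convert add_mem (cos_zero_mul_mem hf)
    ((rectModeSpan a₁ b₁ a₂ b₂).smul_mem Complex.I (cos_one_mul_mem hf)) using 1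
  funext x
  simp only [Pi.add_apply, Pi.smul_apply, smul_eq_mul, rectCos]
  ring

theorem conj_rectCos_mul_mem {f : Plane → ℂ} (hf : f ∈ rectModeSpan a₁ b₁ a₂ b₂) :
    (fun x => (starRingEnd ℂ) (rectCos a₁ b₁ a₂ b₂ x) * f x) ∈ rectModeSpan a₁ b₁ a₂ b₂ := by
  convert add_mem (cos_zero_mul_mem hf)
    ((rectModeSpan a₁ b₁ a₂ b₂).smul_mem (-Complex.I) (cos_one_mul_mem hf)) using 1
  funext x
  simp only [Pi.add_apply, Pi.smul_apply, smul_eq_mul, rectCos, map_add, map_mul,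
    Complex.conj_ofReal, Complex.conj_I]
  ring

theorem rectCos_pow_mul_mem (m n : ℕ) :
    (fun x => rectCos a₁ b₁ a₂ b₂ x ^ m * (starRingEnd ℂ) (rectCos a₁ b₁ a₂ b₂ x) ^ n *
      rectMode a₁ b₁ a₂ b₂ 1 1 x) ∈ rectModeSpan a₁ b₁ a₂ b₂ := by
  induction m with
  | zero =>
    induction n with
    | zero => simpa using rectMode_mem_span 1 1
    | succ n ih =>
      convert conj_rectCos_mul_mem ih using 1
      funext x
      ring
  | succ m ih =>
    convert rectCos_mul_mem ih using 1
    funext x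
    ring

theorem continuous_rectCos : Continuous (rectCos a₁ b₁ a₂ b₂) := by
  have h0 := continuous_coord 0
  have h1 := continuous_coord 1
  unfold rectCos
  fun_prop

theorem injOn_rectCos (h₁ : a₁ < b₁) (h₂ : a₂ < b₂) :
    InjOn (rectCos a₁ b₁ a₂ b₂) (closure (rect a₁ b₁ a₂ b₂)) := by
  rw [closure_rect h₁ h₂]
  have key : ∀ {a b s t : ℝ}, a < b → s ∈ Icc a b → t ∈ Icc a b →
      Real.cos (Real.pi / (b - a) * (s - a)) = Real.cos (Real.pi / (b - a) * (t - a)) → s = t := by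
    intro a b s t h hs ht he
    have hL := sub_pos.2 h
    have hπ := Real.pi_pos
    have hm : ∀ {s}, s ∈ Icc a b → Real.pi / (b - a) * (s - a) ∈ Icc 0 Real.pi := by
      intro s hs
      refine ⟨mul_nonneg (by positivity) (sub_nonneg.2 hs.1), ?_⟩
      rw [div_mul_eq_mul_div, div_le_iff₀ hL]
      exact mul_le_mul_of_nonneg_left (by linarith [hs.2]) hπ.le
    have := Real.injOn_cos (hm hs) (hm ht) he
    have := mul_left_cancel₀ (by positivity) this
    linarith
  intro x hx y hy he
  have hre := congrArg Complex.re he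
  have him := congrArg Complex.im he
  simp only [rectCos, Complex.add_re, Complex.add_im, Complex.ofReal_re, Complex.ofReal_im,
    Complex.mul_re, Complex.mul_im, Complex.I_re, Complex.I_im, mul_zero, mul_one, sub_zero,
    add_zero, zero_add] at hre him
  ext i
  fin_cases i
  · exact key h₁ hx.1 hy.1 hre
  · exact key h₂ hx.2 hy.2 him

/-- The eigenpairs given by the modes. -/
def rectEigenpairs (h₁ : a₁ < b₁) (h₂ : a₂ < b₂) : Set (ℂ × H10 (rect a₁ b₁ a₂ b₂)) :=
  {e | ∃ j k : ℕ, j ≠ 0 ∧ k ≠ 0 ∧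
    e = ((rectEigenvalue a₁ b₁ a₂ b₂ j k : ℂ), rectModeH10 h₁ h₂ j k)}

theorem integral_rectMode_mul_eq_zero (h₁ : a₁ < b₁) (h₂ : a₂ < b₂) {j k : ℕ} (hj : j ≠ 0)
    {v : H10 (rect a₁ b₁ a₂ b₂)}
    (h : (isBoundedOpen_rect a₁ b₁ a₂ b₂).forms.lap (rectModeH10 h₁ h₂ j k) v = 0) :
    ∫ x in rect a₁ b₁ a₂ b₂, rectMode a₁ b₁ a₂ b₂ j k x *
      (v : Jet (rect a₁ b₁ a₂ b₂)) none x = 0 := by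
  have h0 : -(((j * (Real.pi / (b₁ - a₁)) : ℝ) : ℂ) ^ 2 +
      ((k * (Real.pi / (b₂ - a₂)) : ℝ) : ℂ) ^ 2) ≠ 0 := by
    have hL₁ := sub_pos.2 h₁
    have hL₂ := sub_pos.2 h₂
    have hπ := Real.pi_pos
    have hj' : (0 : ℝ) < j := by exact_mod_cast Nat.pos_of_ne_zero hj
    have : (j * (Real.pi / (b₁ - a₁))) ^ 2 + (k * (Real.pi / (b₂ - a₂))) ^ 2 ≠ 0 := by positivity
    rw [neg_ne_zero]
    exact_mod_cast this
  have h' := ((isBoundedOpen_rect a₁ b₁ a₂ b₂).lap_jet (rectMode_jet_mem_H10 h₁ h₂ j k) v).symm.trans h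
  simp only [partialDeriv_zero_rectMode, partialDeriv_one_rectMode] at h'
  refine (mul_eq_zero.1 ?_).resolve_left h0
  rw [← integral_const_mul, ← h']
  congr 1
  funext x
  ring

/-- The span of the modes is invariant under multiplication by `rectCos` and its conjugate, so a function
orthogonal to all modes has, after multiplication by the first mode, vanishing moments. -/
theorem isComplete_rectEigenpairs (h₁ : a₁ < b₁) (h₂ : a₂ < b₂) :
    (isBoundedOpen_rect a₁ b₁ a₂ b₂).forms.IsComplete (rectEigenpairs h₁ h₂) := by
  have hΩ := isBoundedOpen_rect a₁ b₁ a₂ b₂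
  constructor
  · rintro e ⟨j, k, hj, hk, rfl⟩
    exact ⟨isEigenpair_rectModeH10 h₁ h₂ hj, rectModeH10_ne_zero h₁ h₂ hj hk⟩
  intro v hv
  set g : Plane → ℂ := ⇑((v : Jet (rect a₁ b₁ a₂ b₂)) none) with hg
  have hgi : IntegrableOn g (rect a₁ b₁ a₂ b₂) := hΩ.integrable_L2 _
  have hmode : ∀ j k, ∫ x in rect a₁ b₁ a₂ b₂, rectMode a₁ b₁ a₂ b₂ j k x * g x = 0 := by
    intro j k
    by_cases hj : j = 0
    · simp [hj, rectMode, sepProd, sine]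
    by_cases hk : k = 0
    · simp [hk, rectMode, sepProd, sine]
    exact integral_rectMode_mul_eq_zero h₁ h₂ hj
      (hv (_, rectModeH10 h₁ h₂ j k) ⟨j, k, hj, hk, rfl⟩)
  have hspan : ∀ f ∈ rectModeSpan a₁ b₁ a₂ b₂, IntegrableOn (fun x => f x * g x) (rect a₁ b₁ a₂ b₂) ∧
      ∫ x in rect a₁ b₁ a₂ b₂, f x * g x = 0 := by
    intro f hf
    induction hf using Submodule.span_induction with
    | mem f hf =>
      obtain ⟨p, rfl⟩ := hf
      exact ⟨hΩ.integrableOn_continuous_mul (isSmooth_rectMode _ _).continuous hgi, hmode _ _⟩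
    | zero => simp
    | add f f' _ _ hf hf' =>
      simp only [Pi.add_apply, add_mul]
      exact ⟨hf.1.add hf'.1, by rw [integral_add hf.1 hf'.1, hf.2, hf'.2, add_zero]⟩
    | smul c f _ hf =>
      simp only [Pi.smul_apply, smul_eq_mul, mul_assoc]
      exact ⟨hf.1.const_mul c, by rw [integral_const_mul, hf.2, mul_zero]⟩
  have hae := hΩ.ae_eq_zero_of_moments continuous_rectCos (injOn_rectCos h₁ h₂)
    (hΩ.integrableOn_continuous_mul (isSmooth_rectMode 1 1).continuous hgi) fun m n => by
      simpa only [mul_assoc] using (hspan _ (rectCos_pow_mul_mem m n)).2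
  refine hΩ.H10_eq_zero (IsBoundedOpen.eq_zero_of_ae _ ?_)
  filter_upwards [hae, ae_restrict_mem hΩ.isOpen.measurableSet] with x hx hxΩ
  exact (mul_eq_zero.1 hx).resolve_left (rectMode_one_one_ne_zero hxΩ)

theorem fst_image_rectEigenpairs (h₁ : a₁ < b₁) (h₂ : a₂ < b₂) :
    Prod.fst '' rectEigenpairs h₁ h₂ =
      {μ : ℂ | ∃ lam ∈ Ioo (0 : ℝ) 1, μ = ((lam ^ 2 : ℝ) : ℂ) ∧
        ∃ q : ℚ, (q : ℝ) = (b₂ - a₂) / (b₁ - a₁) * (lam / √(1 - lam ^ 2))} := by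
  have hL₁ := sub_pos.2 h₁
  have hL₂ := sub_pos.2 h₂
  have hπ := Real.pi_pos
  ext μ
  constructor
  · rintro ⟨_, ⟨j, k, hj, hk, rfl⟩, rfl⟩
    have hj' : (0 : ℝ) < j := by exact_mod_cast Nat.pos_of_ne_zero hj
    have hk' : (0 : ℝ) < k := by exact_mod_cast Nat.pos_of_ne_zero hk
    set c₁ := j * (Real.pi / (b₁ - a₁)) with hc₁
    set c₂ := k * (Real.pi / (b₂ - a₂)) with hc₂
    have hc₁0 : 0 < c₁ := by positivity
    have hc₂0 : 0 < c₂ := by positivity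
    have hS : 0 < c₁ ^ 2 + c₂ ^ 2 := by positivity
    have hr := Real.sqrt_pos.2 hS
    have hr2 := Real.sq_sqrt hS.le
    set r := √(c₁ ^ 2 + c₂ ^ 2)
    have e1 : 1 - (c₂ / r) ^ 2 = (c₁ / r) ^ 2 := by
      field_simp
      rw [hr2]
      ring
    refine ⟨c₂ / r, ⟨by positivity, (div_lt_one hr).2 ?_⟩, ?_, k / j, ?_⟩
    · exact Real.lt_sqrt_of_sq_lt (lt_add_of_pos_left _ (by positivity))
    · change ((rectEigenvalue a₁ b₁ a₂ b₂ j k : ℝ) : ℂ) = _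
      rw [rectEigenvalue, div_pow, hr2]
    · rw [e1, Real.sqrt_sq (by positivity), hc₁, hc₂]
      push_cast
      field_simp
  · rintro ⟨lam, hlam, rfl, q, hq⟩
    have hm := sqrt_one_sub_sq_pos hlam
    have hm2 : √(1 - lam ^ 2) ^ 2 = 1 - lam ^ 2 := Real.sq_sqrt (Real.sqrt_pos.1 hm).le
    have hl := hlam.1
    set m := √(1 - lam ^ 2)
    have hq0 : (0 : ℝ) < q := by rw [hq]; positivity
    have hq0' : 0 < q := by exact_mod_cast hq0
    have hnum : 0 < q.num := Rat.num_pos.2 hq0'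
    refine ⟨_, ⟨q.den, q.num.toNat, q.den_nz, by omega, rfl⟩, ?_⟩
    change ((rectEigenvalue a₁ b₁ a₂ b₂ _ _ : ℝ) : ℂ) = _
    have hcast : ((q.num.toNat : ℕ) : ℝ) = (q.num : ℝ) := by
      exact_mod_cast congrArg (Int.cast (R := ℝ)) (Int.toNat_of_nonneg hnum.le)
    have hden : (0 : ℝ) < q.den := by exact_mod_cast q.den_pos
    have hqq : (q.num : ℝ) = q.den * ((b₂ - a₂) / (b₁ - a₁) * (lam / m)) := by
      rw [← hq, mul_comm]
      exact_mod_cast (Rat.mul_den_eq_num q).symm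
    congr 1
    rw [rectEigenvalue, hcast, hqq]
    field_simp
    rw [hm2]
    ring

end Modes

end

/-! ### Chess billiards in ellipses -/

section EllipseGeometry

/-- The affine map `w ↦ v + (Re (p̄ w), Re (q̄ w))` from the complex line to the plane. -/
def ellMap (p q : ℂ) (v : Plane) (w : ℂ) : Plane :=
  !₂[v 0 + ((starRingEnd ℂ) p * w).re, v 1 + ((starRingEnd ℂ) q * w).re]

/-- The inverse of `ellMap`: the complex coordinate in which the ellipse is the unit disk. -/
def ellCoord (p q : ℂ) (v : Plane) (x : Plane) : ℂ :=
  (-Complex.I * q * ((x 0 - v 0 : ℝ) : ℂ) + Complex.I * p * ((x 1 - v 1 : ℝ) : ℂ)) /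
    ((((starRingEnd ℂ) p * q).im : ℝ) : ℂ)

/-- The image of the unit disk under `ellMap`. -/
def ellipse (p q : ℂ) (v : Plane) : Set Plane := {x | ‖ellCoord p q v x‖ < 1}

variable {p q : ℂ} {v : Plane}

theorem ellCoord_ellMap (hD : 0 < ((starRingEnd ℂ) p * q).im) (w : ℂ) :
    ellCoord p q v (ellMap p q v w) = w := by
  have h0 : ellMap p q v w 0 = v 0 + ((starRingEnd ℂ) p * w).re := rfl
  have h1 : ellMap p q v w 1 = v 1 + ((starRingEnd ℂ) q * w).re := rfl
  have hD' : ((((starRingEnd ℂ) p * q).im : ℝ) : ℂ) ≠ 0 := by exact_mod_cast hD.ne'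
  rw [ellCoord, div_eq_iff hD', h0, h1]
  apply Complex.ext <;> simp <;> ring

theorem ellMap_ellCoord (hD : 0 < ((starRingEnd ℂ) p * q).im) (x : Plane) :
    ellMap p q v (ellCoord p q v x) = x := by
  have hD' : p.re * q.im - p.im * q.re ≠ 0 := by
    have := hD.ne'
    simp only [Complex.mul_im, Complex.conj_re, Complex.conj_im] at this
    intro h; apply this; linarith
  obtain ⟨d, hd⟩ : ∃ d, (p.re * q.im - p.im * q.re) * d = 1 := ⟨_, mul_inv_cancel₀ hD'⟩
  have e : ellCoord p q v x = (-Complex.I * q * ((x 0 - v 0 : ℝ) : ℂ) +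
      Complex.I * p * ((x 1 - v 1 : ℝ) : ℂ)) * (d : ℂ) := by
    rw [eq_inv_of_mul_eq_one_right hd, ellCoord, div_eq_mul_inv, ← Complex.ofReal_inv]
    simp only [Complex.mul_im, Complex.conj_re, Complex.conj_im]
    ring_nf
  ext i
  fin_cases i
  · change v 0 + ((starRingEnd ℂ) p * ellCoord p q v x).re = x 0
    rw [e]
    simp
    linear_combination (x 0 - v 0) * hd
  · change v 1 + ((starRingEnd ℂ) q * ellCoord p q v x).re = x 1
    rw [e]
    simp
    linear_combination (x 1 - v 1) * hd

theorem continuous_ellMap : Continuous (ellMap p q v) := by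
  refine (PiLp.continuous_toLp 2 _).comp (continuous_pi fun i => ?_)
  fin_cases i
  · simp only [Fin.zero_eta, Matrix.cons_val_zero]; fun_prop
  · simp only [Fin.mk_one, Matrix.cons_val_one]; fun_prop

theorem continuous_ellCoord : Continuous (ellCoord p q v) := by
  have h0 := continuous_coord 0
  have h1 := continuous_coord 1
  unfold ellCoord
  fun_prop

/-- The complex coordinate as a homeomorphism. -/
def ellHomeo (v : Plane) (hD : 0 < ((starRingEnd ℂ) p * q).im) : Plane ≃ₜ ℂ where
  toFun := ellCoord p q v
  invFun := ellMap p q v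
  left_inv := ellMap_ellCoord hD
  right_inv := ellCoord_ellMap hD
  continuous_toFun := continuous_ellCoord
  continuous_invFun := continuous_ellMap

theorem ellipse_eq_preimage (hD : 0 < ((starRingEnd ℂ) p * q).im) :
    ellipse p q v = ellHomeo v hD ⁻¹' Metric.ball 0 1 := by
  ext x
  simp only [ellipse, mem_preimage, Metric.mem_ball, dist_zero_right]
  rfl

theorem isOpen_ellipse : IsOpen (ellipse p q v) :=
  isOpen_lt continuous_ellCoord.norm continuous_const

theorem frontier_ellipse (hD : 0 < ((starRingEnd ℂ) p * q).im) :
    frontier (ellipse p q v) = {x | ‖ellCoord p q v x‖ = 1} := by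
  rw [ellipse_eq_preimage hD, ← Homeomorph.preimage_frontier, frontier_ball _ one_ne_zero]
  ext x
  simp only [mem_preimage, Metric.mem_sphere, dist_zero_right]
  rfl

theorem isBoundedOpen_ellipse (hD : 0 < ((starRingEnd ℂ) p * q).im) :
    IsBoundedOpen (ellipse p q v) := by
  refine ⟨isOpen_ellipse, ((isCompact_closedBall (0 : ℂ) 1).image
    (continuous_ellMap (p := p) (q := q) (v := v))).isBounded.subset fun x hx => ?_⟩
  exact ⟨ellCoord p q v x, by simpa using (show ‖ellCoord p q v x‖ < 1 from hx).le,
    ellMap_ellCoord hD x⟩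

theorem convex_ellipse : Convex ℝ (ellipse p q v) := by
  intro x hx y hy a b ha hb hab
  have e : ellCoord p q v (a • x + b • y) = a • ellCoord p q v x + b • ellCoord p q v y := by
    have h0 : (a • x + b • y) 0 - v 0 = a * (x 0 - v 0) + b * (y 0 - v 0) := by
      change a * x 0 + b * y 0 - v 0 = _
      linear_combination (v 0) * hab
    have h1 : (a • x + b • y) 1 - v 1 = a * (x 1 - v 1) + b * (y 1 - v 1) := by
      change a * x 1 + b * y 1 - v 1 = _
      linear_combination (v 1) * hab
    simp only [ellCoord, h0, h1, Complex.real_smul]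
    push_cast
    ring
  have := convex_ball (0 : ℂ) 1 (show ellCoord p q v x ∈ Metric.ball 0 1 from mem_ball_zero_iff.2 hx)
    (show ellCoord p q v y ∈ Metric.ball 0 1 from mem_ball_zero_iff.2 hy) ha hb hab
  rw [← e] at this
  exact mem_ball_zero_iff.1 this

theorem ellMap_zero_mem (hD : 0 < ((starRingEnd ℂ) p * q).im) : ellMap p q v 0 ∈ ellipse p q v := by
  change ‖ellCoord p q v (ellMap p q v 0)‖ < 1
  rw [ellCoord_ellMap hD, norm_zero]
  exact one_pos

/-- Every ellipse is the image of the unit disk under an orientation preserving map `ellMap`. -/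
theorem IsEllipse.exists_eq_ellipse {Ω : Set Plane} (h : IsEllipse Ω) :
    ∃ p q v, 0 < ((starRingEnd ℂ) p * q).im ∧ Ω = ellipse p q v := by
  obtain ⟨A, v, rfl⟩ := h
  set e₀ : Plane := EuclideanSpace.single 0 1
  set e₁ : Plane := EuclideanSpace.single 1 1
  set p : ℂ := ⟨A e₀ 0, A e₁ 0⟩ with hp
  set q : ℂ := ⟨A e₀ 1, A e₁ 1⟩ with hq
  have hy : ∀ y : Plane, y = y 0 • e₀ + y 1 • e₁ := by
    intro y
    ext i
    fin_cases i <;> simp [e₀, e₁]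
  have hA : ∀ y i, A y i = y 0 * A e₀ i + y 1 * A e₁ i := by
    intro y i
    conv_lhs => rw [hy y, map_add, map_smul, map_smul]
    simp
  have hmap : ∀ y, A y + v = ellMap p q v (toComplex y) := by
    intro y
    ext i
    fin_cases i
    · change A y 0 + v 0 = v 0 + ((starRingEnd ℂ) p * toComplex y).re
      rw [hA]
      simp [hp, toComplex]
      ring
    · change A y 1 + v 1 = v 1 + ((starRingEnd ℂ) q * toComplex y).re
      rw [hA]
      simp [hq, toComplex]
      ring
  have hmap' : ∀ y, A y + v = ellMap ((starRingEnd ℂ) p) ((starRingEnd ℂ) q) v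
      ((starRingEnd ℂ) (toComplex y)) := by
    intro y
    rw [hmap]
    simp only [ellMap, ← map_mul, Complex.conj_re]
  have hD : ((starRingEnd ℂ) p * q).im ≠ 0 := by
    intro h0
    simp only [Complex.mul_im, Complex.conj_re, Complex.conj_im] at h0
    -- the rows of the matrix of `A` are dependent, so a nonzero vector is mapped to zero
    have k : ∀ a b : ℝ, a * A e₀ 0 + b * A e₁ 0 = 0 → a * A e₀ 1 + b * A e₁ 1 = 0 →
        a = 0 ∧ b = 0 := by
      intro a b h1 h2
      have h3 : A (a • e₀ + b • e₁) = 0 := by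
        ext i
        fin_cases i
        · simpa using h1
        · simpa using h2
      have h4 := (map_eq_zero_iff A A.injective).1 h3
      have h5 := congrArg (fun y : Plane => y 0) h4
      have h6 := congrArg (fun y : Plane => y 1) h4
      simp [e₀, e₁] at h5 h6
      exact ⟨h5, h6⟩
    obtain ⟨h1, h2⟩ := k (A e₁ 0) (-A e₀ 0) (by ring) (by linarith)
    obtain ⟨h3, h4⟩ := k (A e₁ 1) (-A e₀ 1) (by linarith) (by ring)
    have := k 1 0 (by linarith) (by linarith)
    exact one_ne_zero this.1
  have hn : ∀ y : Plane, ‖toComplex y‖ = ‖y‖ := by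
    intro y
    have h0 : toComplex 0 = 0 := by apply Complex.ext <;> simp [toComplex]
    have := norm_toComplex_sub y 0
    rwa [h0, sub_zero, dist_zero_right] at this
  have hsurj : ∀ w : ℂ, toComplex !₂[w.re, w.im] = w := fun w => rfl
  have key : ∀ {p q : ℂ}, 0 < ((starRingEnd ℂ) p * q).im → (∀ σ : ℂ → ℂ, (∀ w, ‖σ w‖ = ‖w‖) →
      (∀ w, σ (σ w) = w) → (∀ y, A y + v = ellMap p q v (σ (toComplex y))) →
      (fun x => A x + v) '' Metric.ball (0 : Plane) 1 = ellipse p q v) := by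
    intro p q hD σ hσ hσσ h
    ext x
    constructor
    · rintro ⟨y, hy, rfl⟩
      change ‖ellCoord p q v (A y + v)‖ < 1
      rw [h, ellCoord_ellMap hD, hσ, hn]
      simpa using hy
    · intro hx
      set w := σ (ellCoord p q v x) with hw
      refine ⟨!₂[w.re, w.im], ?_, ?_⟩
      · rw [mem_ball_zero_iff, ← hn, hsurj, hw, hσ]
        exact hx
      · change A !₂[w.re, w.im] + v = x
        rw [h, hsurj, hw, hσσ, ellMap_ellCoord hD]
  rcases lt_or_gt_of_ne hD with h | h
  · have h' : 0 < ((starRingEnd ℂ) ((starRingEnd ℂ) p) * (starRingEnd ℂ) q).im := by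
      rw [← map_mul, Complex.conj_im]
      linarith
    exact ⟨_, _, v, h', key h' (starRingEnd ℂ) (fun w => RCLike.norm_conj w)
      (fun w => Complex.conj_conj w) hmap'⟩
  · exact ⟨p, q, v, h, key h id (fun _ => rfl) (fun _ => rfl) hmap⟩

/-- The parametrization of an ellipse by the uniform rotation of the circle. -/
def ellParam (p q : ℂ) (v : Plane) (t : UnitAddCircle) : Plane :=
  ellMap p q v (AddCircle.toCircle t : ℂ)

theorem toCircle_coe_eq (t : ℝ) : ((AddCircle.toCircle (t : UnitAddCircle) : Circle) : ℂ) =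
    Complex.exp ((2 * Real.pi * t : ℝ) * Complex.I) := by
  rw [AddCircle.toCircle_apply_mk, Circle.coe_exp, div_one]

theorem continuous_ellParam : Continuous (ellParam p q v) :=
  continuous_ellMap.comp (continuous_subtype_val.comp AddCircle.continuous_toCircle)

theorem injective_ellParam (hD : 0 < ((starRingEnd ℂ) p * q).im) :
    Function.Injective (ellParam p q v) := by
  intro s t h
  have := (ellHomeo v hD).symm.injective h
  exact AddCircle.injective_toCircle one_ne_zero (Circle.ext this)

theorem range_ellParam (hD : 0 < ((starRingEnd ℂ) p * q).im) :
    range (ellParam p q v) = frontier (ellipse p q v) := by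
  rw [frontier_ellipse hD]
  ext x
  constructor
  · rintro ⟨t, rfl⟩
    change ‖ellCoord p q v (ellMap p q v _)‖ = 1
    rw [ellCoord_ellMap hD, Circle.norm_coe]
  · intro hx
    obtain ⟨t, ht⟩ := (AddCircle.homeomorphCircle (T := 1) one_ne_zero).surjective
      ⟨ellCoord p q v x, mem_sphere_zero_iff_norm.2 hx⟩
    rw [AddCircle.homeomorphCircle_apply] at ht
    refine ⟨t, ?_⟩
    rw [ellParam, ht]
    exact ellMap_ellCoord hD x

/-- The linear part of `ellMap` is `w ↦ P w + Q w̄` with `|Q| < |P|`, so the ellipse stays within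
a right angle of the rotation `w ↦ P w`. -/
theorem exists_isAngle_ellParam (hD : 0 < ((starRingEnd ℂ) p * q).im) :
    ∃ θ, IsAngle (ellParam p q v) (ellMap p q v 0) θ := by
  set P : ℂ := ((starRingEnd ℂ) p + Complex.I * (starRingEnd ℂ) q) / 2 with hP
  set Q : ℂ := (p + Complex.I * q) / 2 with hQ
  have hPQ : Complex.normSq Q < Complex.normSq P := by
    have : Complex.normSq P - Complex.normSq Q = ((starRingEnd ℂ) p * q).im := by
      simp [hP, hQ, Complex.normSq_apply]
      ring
    linarith
  have hPQ' : ‖Q‖ < ‖P‖ := by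
    rw [Complex.normSq_eq_norm_sq, Complex.normSq_eq_norm_sq] at hPQ
    exact lt_of_pow_lt_pow_left₀ 2 (norm_nonneg _) hPQ
  have hP0 : 0 < ‖P‖ := (norm_nonneg _).trans_lt hPQ'
  refine exists_isAngle_of_halfPlane continuous_ellParam
    (α := fun t => 2 * Real.pi * t + P.arg) (by fun_prop) (fun t => by ring) fun t => ?_
  set α := 2 * Real.pi * t + P.arg with hα
  refine ⟨Real.cos α, Real.sin α, ?_, ?_⟩
  swap
  · have := Real.cos_sq_add_sin_sq α
    nlinarith
  set w : ℂ := Complex.exp ((2 * Real.pi * t : ℝ) * Complex.I) with hw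
  have hw1 : ‖w‖ = 1 := by rw [hw, Complex.norm_exp_ofReal_mul_I]
  have e0 : ellParam p q v t 0 - ellMap p q v 0 0 = (P * w + Q * (starRingEnd ℂ) w).re := by
    rw [ellParam, toCircle_coe_eq, ← hw]
    change v 0 + ((starRingEnd ℂ) p * w).re - (v 0 + ((starRingEnd ℂ) p * 0).re) = _
    simp [hP, hQ]
    ring
  have e1 : ellParam p q v t 1 - ellMap p q v 0 1 = (P * w + Q * (starRingEnd ℂ) w).im := by
    rw [ellParam, toCircle_coe_eq, ← hw]
    change v 1 + ((starRingEnd ℂ) q * w).re - (v 1 + ((starRingEnd ℂ) q * 0).re) = _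
    simp [hP, hQ]
    ring
  have hPw : P * w = ‖P‖ * Complex.exp (α * Complex.I) := by
    conv_lhs => rw [← Complex.norm_mul_exp_arg_mul_I P]
    rw [hw, mul_assoc, ← Complex.exp_add, hα]
    congr 2
    push_cast
    ring
  have hre : Real.cos α * (P * w + Q * (starRingEnd ℂ) w).re +
      Real.sin α * (P * w + Q * (starRingEnd ℂ) w).im =
      ‖P‖ + ((starRingEnd ℂ) (Complex.exp (α * Complex.I)) * (Q * (starRingEnd ℂ) w)).re := by
    rw [hPw]
    set z := Q * (starRingEnd ℂ) w
    simp only [Complex.add_re, Complex.add_im, Complex.mul_re, Complex.mul_im, Complex.conj_re,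
      Complex.conj_im, Complex.exp_ofReal_mul_I_re, Complex.exp_ofReal_mul_I_im,
      Complex.ofReal_re, Complex.ofReal_im]
    linear_combination ‖P‖ * Real.cos_sq_add_sin_sq α
  rw [e0, e1, hre]
  have hb : |((starRingEnd ℂ) (Complex.exp (α * Complex.I)) * (Q * (starRingEnd ℂ) w)).re| ≤ ‖Q‖ := by
    refine (Complex.abs_re_le_norm _).trans_eq ?_
    rw [norm_mul, norm_mul, RCLike.norm_conj, RCLike.norm_conj, hw1,
      Complex.norm_exp_ofReal_mul_I, one_mul, mul_one]
  linarith [neg_le_of_abs_le hb]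

theorem isPositiveParametrization_ellParam (hD : 0 < ((starRingEnd ℂ) p * q).im) :
    IsPositiveParametrization (ellipse p q v) (ellParam p q v) :=
  isPositiveParametrization_of_convex isOpen_ellipse convex_ellipse continuous_ellParam
    (injective_ellParam hD) (range_ellParam hD) (ellMap_zero_mem hD) (exists_isAngle_ellParam hD)

/-- A nonzero linear form takes the same value at two points of the circle if and only if they
agree or are exchanged by the reflection in the axis of the form. -/
theorem re_conj_mul_toCircle_eq_iff {ω : ℂ} (hω : ω ≠ 0) (s t : UnitAddCircle) :
    ((starRingEnd ℂ) ω * (AddCircle.toCircle s : ℂ)).re =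
      ((starRingEnd ℂ) ω * (AddCircle.toCircle t : ℂ)).re ↔
      s = t ∨ s = ((ω.arg / Real.pi : ℝ) : UnitAddCircle) - t := by
  obtain ⟨x, rfl⟩ := QuotientAddGroup.mk_surjective s
  obtain ⟨y, rfl⟩ := QuotientAddGroup.mk_surjective t
  have key : ∀ x : ℝ, ((starRingEnd ℂ) ω * (AddCircle.toCircle (x : UnitAddCircle) : ℂ)).re =
      ‖ω‖ * Real.cos (2 * Real.pi * x - ω.arg) := by
    intro x
    have e : (starRingEnd ℂ) ω = ‖ω‖ * Complex.exp ((-ω.arg : ℝ) * Complex.I) := by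
      conv_lhs => rw [← Complex.norm_mul_exp_arg_mul_I ω]
      rw [map_mul, Complex.conj_ofReal, ← Complex.exp_conj, map_mul, Complex.conj_ofReal,
        Complex.conj_I]
      push_cast
      ring_nf
    rw [toCircle_coe_eq, e, mul_assoc, ← Complex.exp_add, ← add_mul, ← Complex.ofReal_add,
      Complex.re_ofReal_mul, Complex.exp_ofReal_mul_I_re]
    ring_nf
  change ((starRingEnd ℂ) ω * (AddCircle.toCircle (x : UnitAddCircle) : ℂ)).re =
    ((starRingEnd ℂ) ω * (AddCircle.toCircle (y : UnitAddCircle) : ℂ)).re ↔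
    (x : UnitAddCircle) = (y : UnitAddCircle) ∨
      (x : UnitAddCircle) = ((ω.arg / Real.pi : ℝ) : UnitAddCircle) - (y : UnitAddCircle)
  have hπ := Real.pi_ne_zero
  rw [key, key, mul_right_inj' (norm_ne_zero_iff.2 hω), Real.cos_eq_cos_iff, ← AddCircle.coe_sub,
    coe_eq_coe_iff_exists_int, coe_eq_coe_iff_exists_int]
  constructor
  · rintro ⟨k, h | h⟩
    · refine Or.inl ⟨-k, ?_⟩
      have : Real.pi * (x - y + k) = 0 := by linarith
      have := (mul_eq_zero.1 this).resolve_left hπ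
      push_cast
      linarith
    · refine Or.inr ⟨k, ?_⟩
      field_simp
      linarith
  · rintro (⟨n, h⟩ | ⟨n, h⟩)
    · exact ⟨-n, Or.inl (by push_cast; linear_combination (-2 * Real.pi) * h)⟩
    · refine ⟨n, Or.inr ?_⟩
      field_simp at h
      linarith

/-- The covector `ℓ⁺` in the coordinate of the ellipse. -/
def omegaPlus (p q : ℂ) (lam : ℝ) : ℂ := p / (lam : ℂ) + q / ((√(1 - lam ^ 2) : ℝ) : ℂ)

/-- The covector `ℓ⁻` in the coordinate of the ellipse. -/
def omegaMinus (p q : ℂ) (lam : ℝ) : ℂ := -(p / (lam : ℂ)) + q / ((√(1 - lam ^ 2) : ℝ) : ℂ)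

theorem ellPlus_ellMap (lam : ℝ) (w : ℂ) : ellPlus lam (ellMap p q v w) =
    ellPlus lam v + ((starRingEnd ℂ) (omegaPlus p q lam) * w).re := by
  have h0 : ellMap p q v w 0 = v 0 + ((starRingEnd ℂ) p * w).re := rfl
  have h1 : ellMap p q v w 1 = v 1 + ((starRingEnd ℂ) q * w).re := rfl
  rw [ellPlus, h0, h1, ellPlus, omegaPlus, map_add, map_div₀, map_div₀, Complex.conj_ofReal,
    Complex.conj_ofReal, add_mul, Complex.add_re, div_mul_eq_mul_div, div_mul_eq_mul_div,
    Complex.div_ofReal_re, Complex.div_ofReal_re]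
  ring

theorem ellMinus_ellMap (lam : ℝ) (w : ℂ) : ellMinus lam (ellMap p q v w) =
    ellMinus lam v + ((starRingEnd ℂ) (omegaMinus p q lam) * w).re := by
  have h0 : ellMap p q v w 0 = v 0 + ((starRingEnd ℂ) p * w).re := rfl
  have h1 : ellMap p q v w 1 = v 1 + ((starRingEnd ℂ) q * w).re := rfl
  rw [ellMinus, h0, h1, ellMinus, omegaMinus, map_add, map_neg, map_div₀, map_div₀,
    Complex.conj_ofReal, Complex.conj_ofReal, add_mul, neg_mul, Complex.add_re, Complex.neg_re,
    div_mul_eq_mul_div, div_mul_eq_mul_div, Complex.div_ofReal_re, Complex.div_ofReal_re]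
  ring

/-- The angle `ψ` with `tan ψ = (|q|² τ - |p|² / τ) / (2 D)`, `τ = λ / √(1 - λ²)`. The rotation
number is `ψ / π - 1 / 2`. -/
def ellAngle (p q : ℂ) (lam : ℝ) : ℝ :=
  Real.arctan ((Complex.normSq q * (lam / √(1 - lam ^ 2)) -
    Complex.normSq p / (lam / √(1 - lam ^ 2))) / (2 * ((starRingEnd ℂ) p * q).im))

theorem linear_form_mul_conj (a b : ℝ) :
    ((a : ℂ) * p + (b : ℂ) * q) * (starRingEnd ℂ) (-(a : ℂ) * p + (b : ℂ) * q) =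
      ((b ^ 2 * Complex.normSq q - a ^ 2 * Complex.normSq p : ℝ) : ℂ) -
        ((2 * a * b * ((starRingEnd ℂ) p * q).im : ℝ) : ℂ) * Complex.I := by
  apply Complex.ext
  · simp [Complex.normSq_apply, -Complex.ofReal_sub, -Complex.ofReal_mul, -Complex.ofReal_pow]
    ring
  · simp [Complex.normSq_apply, -Complex.ofReal_sub, -Complex.ofReal_mul, -Complex.ofReal_pow]
    ring

theorem omegaPlus_mul_conj_omegaMinus (hD : 0 < ((starRingEnd ℂ) p * q).im) {lam : ℝ}
    (hlam : lam ∈ Ioo (0 : ℝ) 1) : ∃ r : ℝ, 0 < r ∧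
      omegaPlus p q lam * (starRingEnd ℂ) (omegaMinus p q lam) =
        r * (Complex.cos ((ellAngle p q lam - Real.pi / 2 : ℝ) : ℂ) +
          Complex.sin ((ellAngle p q lam - Real.pi / 2 : ℝ) : ℂ) * Complex.I) := by
  have hm := sqrt_one_sub_sq_pos hlam
  have hl := hlam.1
  have hcos := Real.cos_arctan_pos ((Complex.normSq q * (lam / √(1 - lam ^ 2)) -
    Complex.normSq p / (lam / √(1 - lam ^ 2))) / (2 * ((starRingEnd ℂ) p * q).im))
  have htan := Real.tan_arctan ((Complex.normSq q * (lam / √(1 - lam ^ 2)) -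
    Complex.normSq p / (lam / √(1 - lam ^ 2))) / (2 * ((starRingEnd ℂ) p * q).im))
  rw [← ellAngle] at hcos htan
  rw [Real.tan_eq_sin_div_cos, div_eq_iff hcos.ne'] at htan
  rw [← Complex.ofReal_cos, ← Complex.ofReal_sin, Real.cos_sub_pi_div_two, Real.sin_sub_pi_div_two,
    htan]
  set c := Real.cos (ellAngle p q lam)
  set m := √(1 - lam ^ 2)
  refine ⟨2 * ((starRingEnd ℂ) p * q).im / (lam * m) / c, by positivity, ?_⟩
  have e : omegaPlus p q lam * (starRingEnd ℂ) (omegaMinus p q lam) =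
      ((Complex.normSq q / m ^ 2 - Complex.normSq p / lam ^ 2 : ℝ) : ℂ) -
        ((2 * ((starRingEnd ℂ) p * q).im / (lam * m) : ℝ) : ℂ) * Complex.I := by
    have h := linear_form_mul_conj (p := p) (q := q) lam⁻¹ m⁻¹
    have e1 : omegaPlus p q lam = ((lam⁻¹ : ℝ) : ℂ) * p + ((m⁻¹ : ℝ) : ℂ) * q := by
      rw [omegaPlus]; push_cast; ring
    have e2 : omegaMinus p q lam = -((lam⁻¹ : ℝ) : ℂ) * p + ((m⁻¹ : ℝ) : ℂ) * q := by
      rw [omegaMinus]; push_cast; ring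
    rw [e1, e2, h]
    push_cast
    ring
  rw [e]
  set D := ((starRingEnd ℂ) p * q).im
  have hc : (c : ℂ) ≠ 0 := by exact_mod_cast hcos.ne'
  have hD' : (D : ℂ) ≠ 0 := by exact_mod_cast hD.ne'
  have hm' : (m : ℂ) ≠ 0 := by exact_mod_cast hm.ne'
  have hl' : (lam : ℂ) ≠ 0 := by exact_mod_cast hl.ne'
  push_cast
  field_simp
  ring

theorem omegaPlus_ne_zero (hD : 0 < ((starRingEnd ℂ) p * q).im) {lam : ℝ}
    (hlam : lam ∈ Ioo (0 : ℝ) 1) : omegaPlus p q lam ≠ 0 := by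
  obtain ⟨r, hr, h⟩ := omegaPlus_mul_conj_omegaMinus hD hlam
  intro h0
  rw [h0, zero_mul, ← Complex.exp_mul_I] at h
  have hr' : (r : ℂ) ≠ 0 := by exact_mod_cast hr.ne'
  exact mul_ne_zero hr' (Complex.exp_ne_zero _) h.symm

theorem omegaMinus_ne_zero (hD : 0 < ((starRingEnd ℂ) p * q).im) {lam : ℝ}
    (hlam : lam ∈ Ioo (0 : ℝ) 1) : omegaMinus p q lam ≠ 0 := by
  obtain ⟨r, hr, h⟩ := omegaPlus_mul_conj_omegaMinus hD hlam
  intro h0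
  rw [h0, map_zero, mul_zero, ← Complex.exp_mul_I] at h
  have hr' : (r : ℂ) ≠ 0 := by exact_mod_cast hr.ne'
  exact mul_ne_zero hr' (Complex.exp_ne_zero _) h.symm

theorem isRotationNumber_ellipse (hD : 0 < ((starRingEnd ℂ) p * q).im) {lam : ℝ}
    (hlam : lam ∈ Ioo (0 : ℝ) 1) : IsRotationNumber (ellipse p q v) lam
      ((ellAngle p q lam / Real.pi - 1 / 2 : ℝ) : UnitAddCircle) := by
  have h := isRotationNumber_of_reflections isOpen_ellipse ⟨_, ellMap_zero_mem hD⟩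
    (isPositiveParametrization_ellParam (v := v) hD) (lam := lam)
    (c₁ := (((omegaPlus p q lam).arg / Real.pi : ℝ) : UnitAddCircle))
    (c₂ := (((omegaMinus p q lam).arg / Real.pi : ℝ) : UnitAddCircle))
    (fun s t => by
      rw [ellParam, ellParam, ellPlus_ellMap, ellPlus_ellMap, add_right_inj,
        re_conj_mul_toCircle_eq_iff (omegaPlus_ne_zero hD hlam)])
    (fun s t => by
      rw [ellParam, ellParam, ellMinus_ellMap, ellMinus_ellMap, add_right_inj,
        re_conj_mul_toCircle_eq_iff (omegaMinus_ne_zero hD hlam)])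
  rw [← AddCircle.coe_sub] at h
  convert h using 1
  obtain ⟨r, hr, hr'⟩ := omegaPlus_mul_conj_omegaMinus hD hlam
  have h1 : ((omegaPlus p q lam * (starRingEnd ℂ) (omegaMinus p q lam)).arg : Real.Angle) =
      (ellAngle p q lam - Real.pi / 2 : ℝ) := by
    rw [hr', ← Complex.ofReal_cos, ← Complex.ofReal_sin, ← Real.Angle.cos_coe,
      ← Real.Angle.sin_coe, Complex.arg_mul_cos_add_sin_mul_I_coe_angle hr]
  rw [Complex.arg_mul_coe_angle (omegaPlus_ne_zero hD hlam)
    ((map_ne_zero _).2 (omegaMinus_ne_zero hD hlam)), Complex.arg_conj_coe_angle,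
    ← Real.Angle.coe_neg, ← Real.Angle.coe_add, Real.Angle.angle_eq_iff_two_pi_dvd_sub] at h1
  obtain ⟨k, hk⟩ := h1
  rw [coe_eq_coe_iff_exists_int]
  refine ⟨-2 * k, ?_⟩
  have hπ := Real.pi_ne_zero
  push_cast
  field_simp
  linarith

theorem isRationalMod_rotationNumber_ellipse_iff (hD : 0 < ((starRingEnd ℂ) p * q).im) {lam : ℝ}
    (hlam : lam ∈ Ioo (0 : ℝ) 1) : IsRationalMod (rotationNumber (ellipse p q v) lam) ↔
      ∃ r : ℚ, (r : ℝ) = ellAngle p q lam / Real.pi := by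
  rw [(isRotationNumber_ellipse hD hlam).rotationNumber_eq, isRationalMod_coe_iff]
  constructor
  · rintro ⟨r, hr⟩
    exact ⟨r + 1 / 2, by push_cast; linarith⟩
  · rintro ⟨r, hr⟩
    exact ⟨r - 1 / 2, by push_cast; linarith⟩

/-- The rotation number is rational if and only if a power of `ω⁺ ω̄⁻` is real. -/
theorem exists_conj_pow_eq_iff (hD : 0 < ((starRingEnd ℂ) p * q).im) {lam : ℝ}
    (hlam : lam ∈ Ioo (0 : ℝ) 1) :
    (∃ N : ℕ, 2 ≤ N ∧ ((starRingEnd ℂ) (omegaPlus p q lam) * omegaMinus p q lam) ^ N =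
      (omegaPlus p q lam * (starRingEnd ℂ) (omegaMinus p q lam)) ^ N) ↔
      ∃ r : ℚ, (r : ℝ) = ellAngle p q lam / Real.pi := by
  obtain ⟨r, hr, h⟩ := omegaPlus_mul_conj_omegaMinus hD hlam
  set θ := ellAngle p q lam - Real.pi / 2 with hθ
  have hU : omegaPlus p q lam * (starRingEnd ℂ) (omegaMinus p q lam) =
      r * Complex.exp (θ * Complex.I) := by rw [h, Complex.exp_mul_I]
  have hconj : (starRingEnd ℂ) (omegaPlus p q lam) * omegaMinus p q lam =
      (starRingEnd ℂ) (omegaPlus p q lam * (starRingEnd ℂ) (omegaMinus p q lam)) := by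
    rw [map_mul, Complex.conj_conj]
  have hpow : ∀ N : ℕ, ((starRingEnd ℂ) (omegaPlus p q lam) * omegaMinus p q lam) ^ N =
      (omegaPlus p q lam * (starRingEnd ℂ) (omegaMinus p q lam)) ^ N ↔ Real.sin (N * θ) = 0 := by
    intro N
    rw [hconj, ← map_pow, Complex.conj_eq_iff_im, hU, mul_pow, ← Complex.exp_nat_mul, ← mul_assoc,
      ← Complex.ofReal_natCast, ← Complex.ofReal_mul, ← Complex.ofReal_pow, Complex.im_ofReal_mul,
      Complex.exp_ofReal_mul_I_im, mul_eq_zero]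
    exact or_iff_right (pow_ne_zero N hr.ne')
  simp only [hpow, Real.sin_eq_zero_iff]
  have hπ := Real.pi_ne_zero
  constructor
  · rintro ⟨N, hN, n, hn⟩
    have hN' : (N : ℝ) ≠ 0 := by exact_mod_cast (by omega : N ≠ 0)
    refine ⟨n / N + 1 / 2, ?_⟩
    push_cast
    field_simp
    linear_combination 2 * hn
  · rintro ⟨s, hs⟩
    refine ⟨2 * s.den, by have := s.den_pos; omega, 2 * s.num - s.den, ?_⟩
    have h1 : (s : ℝ) * s.den = s.num := by exact_mod_cast Rat.mul_den_eq_num s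
    rw [eq_div_iff hπ] at hs
    rw [hθ, ← hs]
    push_cast
    linear_combination (-2 * Real.pi) * h1

theorem strictMonoOn_ellAngle (hD : 0 < ((starRingEnd ℂ) p * q).im) :
    StrictMonoOn (fun lam => ellAngle p q lam / Real.pi) (Ioo 0 1) := by
  intro x hx y hy hxy
  have hq : 0 < Complex.normSq q := by
    refine Complex.normSq_pos.2 fun h => ?_
    simp [h] at hD
  have hp := Complex.normSq_nonneg p
  have hmono := strictMonoOn_mul_div_sqrt one_pos hx hy hxy
  simp only [one_mul] at hmono
  have hx0 : 0 < x / √(1 - x ^ 2) := div_pos hx.1 (sqrt_one_sub_sq_pos hx)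
  refine div_lt_div_of_pos_right (Real.arctan_strictMono ?_) Real.pi_pos
  refine div_lt_div_of_pos_right ?_ (by positivity)
  have h1 := mul_lt_mul_of_pos_left hmono hq
  have h2 := div_le_div_of_nonneg_left hp hx0 hmono.le
  linarith

theorem continuousOn_ellAngle :
    ContinuousOn (fun lam => ellAngle p q lam / Real.pi) (Ioo 0 1) := by
  have h := continuousOn_div_sqrt
  refine (Real.continuous_arctan.comp_continuousOn ?_).div_const _
  refine ContinuousOn.div_const ?_ _
  refine (h.const_mul _).sub (ContinuousOn.div continuousOn_const h fun x hx => ?_)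
  exact (div_pos hx.1 (sqrt_one_sub_sq_pos hx)).ne'

end EllipseGeometry

/-! ### Polynomials in a complex coordinate and its conjugate -/

section Polynomials

/-- Polynomials in two variables, which stand for a complex coordinate and its conjugate. -/
abbrev Poly := MvPolynomial (Fin 2) ℂ

/-- The coefficient of `X₀ ^ k X₁ ^ l`. -/
def coeff₂ (P : Poly) (k l : ℕ) : ℂ := P.coeff (Finsupp.single 0 k + Finsupp.single 1 l)

theorem finsupp_fin_two_eq (m : Fin 2 →₀ ℕ) :
    m = Finsupp.single 0 (m 0) + Finsupp.single 1 (m 1) := by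
  ext i
  fin_cases i <;> simp

theorem Poly.ext₂ {P Q : Poly} (h : ∀ k l, coeff₂ P k l = coeff₂ Q k l) : P = Q := by
  ext m
  rw [finsupp_fin_two_eq m]
  exact h _ _

theorem coeff₂_zero (k l : ℕ) : coeff₂ 0 k l = 0 := MvPolynomial.coeff_zero _

theorem coeff₂_add (P Q : Poly) (k l : ℕ) : coeff₂ (P + Q) k l = coeff₂ P k l + coeff₂ Q k l :=
  MvPolynomial.coeff_add _ _ _

theorem coeff₂_sub (P Q : Poly) (k l : ℕ) : coeff₂ (P - Q) k l = coeff₂ P k l - coeff₂ Q k l :=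
  MvPolynomial.coeff_sub _ _ _ _

theorem coeff₂_smul (c : ℂ) (P : Poly) (k l : ℕ) : coeff₂ (c • P) k l = c * coeff₂ P k l :=
  MvPolynomial.coeff_smul _ _ _

theorem coeff₂_pderiv_zero (P : Poly) (k l : ℕ) :
    coeff₂ (MvPolynomial.pderiv 0 P) k l = (k + 1) * coeff₂ P (k + 1) l := by
  rw [coeff₂, MvPolynomial.coeff_pderiv, coeff₂]
  have e : (Finsupp.single 0 k + Finsupp.single 1 l + Finsupp.single 0 1 : Fin 2 →₀ ℕ) =
      Finsupp.single 0 (k + 1) + Finsupp.single 1 l := by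
    rw [Finsupp.single_add]; abel
  rw [e]
  simp [mul_comm]

theorem coeff₂_pderiv_one (P : Poly) (k l : ℕ) :
    coeff₂ (MvPolynomial.pderiv 1 P) k l = (l + 1) * coeff₂ P k (l + 1) := by
  rw [coeff₂, MvPolynomial.coeff_pderiv, coeff₂]
  have e : (Finsupp.single 0 k + Finsupp.single 1 l + Finsupp.single 1 1 : Fin 2 →₀ ℕ) =
      Finsupp.single 0 k + Finsupp.single 1 (l + 1) := by
    rw [Finsupp.single_add]; abel
  rw [e]
  simp [mul_comm]

theorem coeff₂_X_zero_mul_X_one_mul (P : Poly) (k l : ℕ) :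
    coeff₂ (MvPolynomial.X 0 * MvPolynomial.X 1 * P) (k + 1) (l + 1) = coeff₂ P k l := by
  have e : (Finsupp.single 0 (k + 1) + Finsupp.single 1 (l + 1) : Fin 2 →₀ ℕ) =
      Finsupp.single 0 1 + (Finsupp.single 1 1 + (Finsupp.single 0 k + Finsupp.single 1 l)) := by
    rw [Finsupp.single_add, Finsupp.single_add]; abel
  rw [coeff₂, e, mul_assoc, MvPolynomial.coeff_X_mul, MvPolynomial.coeff_X_mul, coeff₂]

theorem coeff₂_X_zero_mul_X_one_mul_of_left (P : Poly) (l : ℕ) :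
    coeff₂ (MvPolynomial.X 0 * MvPolynomial.X 1 * P) 0 l = 0 := by
  rw [coeff₂, mul_assoc, MvPolynomial.coeff_X_mul', if_neg (by simp)]

theorem coeff₂_X_zero_mul_X_one_mul_of_right (P : Poly) (k : ℕ) :
    coeff₂ (MvPolynomial.X 0 * MvPolynomial.X 1 * P) k 0 = 0 := by
  rw [coeff₂, mul_comm (MvPolynomial.X 0), mul_assoc, MvPolynomial.coeff_X_mul', if_neg (by simp)]

theorem coeff₂_monomial (k l i j : ℕ) (c : ℂ) :
    coeff₂ (MvPolynomial.monomial (Finsupp.single 0 k + Finsupp.single 1 l) c) i j =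
      if k = i ∧ l = j then c else 0 := by
  rw [coeff₂, MvPolynomial.coeff_monomial]
  refine if_congr ⟨fun h => ?_, fun h => by rw [h.1, h.2]⟩ rfl rfl
  have h0 := DFunLike.congr_fun h 0
  have h1 := DFunLike.congr_fun h 1
  simp at h0 h1
  exact ⟨h0, h1⟩

/-- Polynomials of total degree less than `n`. -/
def polyLT (n : ℕ) : Submodule ℂ Poly where
  carrier := {P | ∀ k l, n ≤ k + l → coeff₂ P k l = 0}
  zero_mem' k l _ := coeff₂_zero k l
  add_mem' {P Q} hP hQ k l h := by rw [coeff₂_add, hP k l h, hQ k l h, add_zero]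
  smul_mem' c P hP k l h := by rw [coeff₂_smul, hP k l h, mul_zero]

theorem mem_polyLT {n : ℕ} {P : Poly} : P ∈ polyLT n ↔ ∀ k l, n ≤ k + l → coeff₂ P k l = 0 :=
  Iff.rfl

theorem exists_mem_polyLT (P : Poly) : ∃ n, P ∈ polyLT n := by
  refine ⟨P.totalDegree + 1, fun k l h => ?_⟩
  refine MvPolynomial.coeff_eq_zero_of_totalDegree_lt ?_
  have h2 : (Finsupp.single 0 k + Finsupp.single 1 l : Fin 2 →₀ ℕ).degree = k + l := by simp
  rw [Finsupp.degree_apply] at h2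
  exact (Nat.lt_of_succ_le h).trans_eq h2.symm

/-- A nonzero polynomial has a nonzero leading form. -/
theorem exists_leading {P : Poly} (hP : P ≠ 0) :
    ∃ n, P ∈ polyLT (n + 1) ∧ ∃ k l, k + l = n ∧ coeff₂ P k l ≠ 0 := by
  classical
  have hex := exists_mem_polyLT P
  have h0 : Nat.find hex ≠ 0 := by
    intro h
    have := Nat.find_spec hex
    rw [h] at this
    exact hP (Poly.ext₂ fun k l => by rw [this k l (Nat.zero_le _), coeff₂_zero])
  obtain ⟨n, hn⟩ := Nat.exists_eq_succ_of_ne_zero h0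
  have h1 := Nat.find_spec hex
  have h2 := Nat.find_min hex (m := n) (by omega)
  rw [hn] at h1
  refine ⟨n, h1, ?_⟩
  rw [mem_polyLT] at h2
  push Not at h2
  obtain ⟨k, l, hkl, hne⟩ := h2
  refine ⟨k, l, ?_, hne⟩
  by_contra h3
  exact hne (h1 k l (by omega))

instance finiteDimensional_polyLT (n : ℕ) : FiniteDimensional ℂ (polyLT n) := by
  let f : polyLT n →ₗ[ℂ] (Fin n × Fin n → ℂ) :=
    { toFun := fun P i => coeff₂ P.1 i.1 i.2
      map_add' := fun P Q => funext fun i => coeff₂_add _ _ _ _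
      map_smul' := fun c P => funext fun i => coeff₂_smul _ _ _ _ }
  refine FiniteDimensional.of_injective f fun P Q h => Subtype.ext (Poly.ext₂ fun k l => ?_)
  by_cases hkl : k < n ∧ l < n
  · exact congrFun h (⟨k, hkl.1⟩, ⟨l, hkl.2⟩)
  · rw [P.2 k l (by omega), Q.2 k l (by omega)]

/-- The derivative of polynomials that corresponds to a partial derivative of functions, when `c` is
the corresponding derivative of the complex coordinate. -/
def polyDeriv (c : ℂ) : Poly →ₗ[ℂ] Poly :=
  c • (MvPolynomial.pderiv 0 : Derivation ℂ Poly Poly).toLinearMap +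
    (starRingEnd ℂ) c • (MvPolynomial.pderiv 1 : Derivation ℂ Poly Poly).toLinearMap

theorem polyDeriv_apply (c : ℂ) (P : Poly) : polyDeriv c P =
    c • MvPolynomial.pderiv 0 P + (starRingEnd ℂ) c • MvPolynomial.pderiv 1 P := rfl

theorem coeff₂_polyDeriv (c : ℂ) (P : Poly) (k l : ℕ) : coeff₂ (polyDeriv c P) k l =
    c * ((k + 1) * coeff₂ P (k + 1) l) + (starRingEnd ℂ) c * ((l + 1) * coeff₂ P k (l + 1)) := by
  rw [polyDeriv_apply, coeff₂_add, coeff₂_smul, coeff₂_smul, coeff₂_pderiv_zero, coeff₂_pderiv_one]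

theorem coeff₂_polyDeriv_polyDeriv (c : ℂ) (P : Poly) (k l : ℕ) :
    coeff₂ (polyDeriv c (polyDeriv c P)) k l =
      c ^ 2 * ((k + 1) * (k + 2) * coeff₂ P (k + 2) l) +
      2 * (c * (starRingEnd ℂ) c) * ((k + 1) * (l + 1) * coeff₂ P (k + 1) (l + 1)) +
      (starRingEnd ℂ) c ^ 2 * ((l + 1) * (l + 2) * coeff₂ P k (l + 2)) := by
  simp only [coeff₂_polyDeriv]
  push_cast
  ring

/-- `P ↦ ∂² ((1 - X₀ X₁) P)`. -/
def polyForm (c : ℂ) : Poly →ₗ[ℂ] Poly :=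
  polyDeriv c ∘ₗ polyDeriv c ∘ₗ LinearMap.mulLeft ℂ (1 - MvPolynomial.X 0 * MvPolynomial.X 1 : Poly)

theorem polyForm_apply (c : ℂ) (P : Poly) : polyForm c P =
    polyDeriv c (polyDeriv c ((1 - MvPolynomial.X 0 * MvPolynomial.X 1) * P)) := rfl

theorem coeff₂_X_mul_eq_zero {n : ℕ} {P : Poly} (hP : P ∈ polyLT n) {k l : ℕ} (h : n + 2 ≤ k + l) :
    coeff₂ (MvPolynomial.X 0 * MvPolynomial.X 1 * P) k l = 0 := by
  rcases k with _ | k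
  · exact coeff₂_X_zero_mul_X_one_mul_of_left _ _
  rcases l with _ | l
  · exact coeff₂_X_zero_mul_X_one_mul_of_right _ _
  rw [coeff₂_X_zero_mul_X_one_mul]
  exact hP _ _ (by omega)

theorem polyForm_mem (c : ℂ) {n : ℕ} {P : Poly} (hP : P ∈ polyLT n) : polyForm c P ∈ polyLT n := by
  have key : ∀ k l, n + 2 ≤ k + l →
      coeff₂ ((1 - MvPolynomial.X 0 * MvPolynomial.X 1) * P) k l = 0 := by
    intro k l h
    rw [sub_mul, one_mul, coeff₂_sub, hP k l (by omega), coeff₂_X_mul_eq_zero hP h, sub_zero]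
  intro k l h
  rw [polyForm_apply, coeff₂_polyDeriv_polyDeriv, key _ _ (by omega), key _ _ (by omega),
    key _ _ (by omega)]
  ring

/-- The leading form of `∂² ((1 - X₀ X₁) P)`. -/
theorem coeff₂_polyForm (c : ℂ) {n : ℕ} {P : Poly} (hP : P ∈ polyLT (n + 1)) {k l : ℕ}
    (h : k + l = n) : coeff₂ (polyForm c P) k l =
      -coeff₂ (polyDeriv c (polyDeriv c (MvPolynomial.X 0 * MvPolynomial.X 1 * P))) k l := by
  rw [polyForm_apply, sub_mul, one_mul, map_sub, map_sub, coeff₂_sub,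
    coeff₂_polyDeriv_polyDeriv c P, hP _ _ (by omega), hP _ _ (by omega), hP _ _ (by omega)]
  ring

end Polynomials

/-! ### The recurrence for the leading form -/

section Recurrence

/-- A solution of a linear recurrence of second order with distinct characteristic roots
`r`, `s` which vanishes at `0` is proportional to `r ^ k - s ^ k`. -/
theorem mul_sub_eq_of_recurrence {d : ℕ → ℂ} {r s : ℂ} {N : ℕ} (h0 : d 0 = 0)
    (hd : ∀ k, k + 2 ≤ N → d (k + 2) = (r + s) * d (k + 1) - r * s * d k) :
    ∀ k ≤ N, d k * (r - s) = d 1 * (r ^ k - s ^ k) := by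
  intro k
  induction k using Nat.strong_induction_on with
  | _ k ih =>
    intro hk
    rcases k with _ | _ | k
    · simp [h0]
    · simp
    · have h1 := ih k (by omega) (by omega)
      have h2 := ih (k + 1) (by omega) (by omega)
      rw [hd k hk]
      linear_combination (r + s) * h2 - r * s * h1

theorem pow_eq_of_recurrence {d : ℕ → ℂ} {r s : ℂ} (hrs : r ≠ s) {N : ℕ} (h0 : d 0 = 0)
    (hN : d N = 0) (hd : ∀ k, k + 2 ≤ N → d (k + 2) = (r + s) * d (k + 1) - r * s * d k)
    (hne : ∃ k ≤ N, d k ≠ 0) : r ^ N = s ^ N := by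
  have key := mul_sub_eq_of_recurrence h0 hd
  obtain ⟨k, hk, hdk⟩ := hne
  have h1 : d 1 ≠ 0 := by
    intro h1
    have := key k hk
    rw [h1, zero_mul] at this
    exact (mul_ne_zero hdk (sub_ne_zero.2 hrs)) this
  have := key N le_rfl
  rw [hN, zero_mul] at this
  exact sub_eq_zero.1 ((mul_eq_zero.1 this.symm).resolve_left h1)

variable {c₀ c₁ μ r s : ℂ}

/-- The pencil `∂₁² - μ (∂₀² + ∂₁²)` applied to `(1 - X₀ X₁) P`. -/
def polyPencil (c₀ c₁ μ : ℂ) : Poly →ₗ[ℂ] Poly :=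
  polyForm c₁ - μ • (polyForm c₀ + polyForm c₁)

theorem polyPencil_apply (P : Poly) : polyPencil c₀ c₁ μ P =
    polyForm c₁ P - μ • (polyForm c₀ P + polyForm c₁ P) := rfl

/-- The coefficients of `X₀ ^ j X₁ ^ (n + 2 - j)` in `X₀ X₁ P`, with a normalization which turns the
action of a homogeneous operator with constant coefficients into a recurrence with constant
coefficients. -/
def leadSeq (P : Poly) (n j : ℕ) : ℂ :=
  j.factorial * (n + 2 - j).factorial *
    coeff₂ (MvPolynomial.X 0 * MvPolynomial.X 1 * P) j (n + 2 - j)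

theorem leadSeq_zero (P : Poly) (n : ℕ) : leadSeq P n 0 = 0 := by
  rw [leadSeq, coeff₂_X_zero_mul_X_one_mul_of_left, mul_zero]

theorem leadSeq_last (P : Poly) (n : ℕ) : leadSeq P n (n + 2) = 0 := by
  rw [leadSeq, Nat.sub_self, coeff₂_X_zero_mul_X_one_mul_of_right, mul_zero]

theorem leadSeq_succ (P : Poly) {n k l : ℕ} (h : k + l = n) : leadSeq P n (k + 1) =
    (k + 1).factorial * (l + 1).factorial * coeff₂ P k l := by
  have e : n + 2 - (k + 1) = l + 1 := by omega
  rw [leadSeq, e, coeff₂_X_zero_mul_X_one_mul]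

/-- The hypotheses say that `r` and `s` are the roots of the symbol of the pencil. -/
theorem coeff₂_polyPencil (h₁ : ((1 - μ) * c₁ ^ 2 - μ * c₀ ^ 2) * (r + s) =
      -(2 * ((1 - μ) * (c₁ * (starRingEnd ℂ) c₁) - μ * (c₀ * (starRingEnd ℂ) c₀))))
    (h₂ : ((1 - μ) * c₁ ^ 2 - μ * c₀ ^ 2) * (r * s) =
      (1 - μ) * (starRingEnd ℂ) c₁ ^ 2 - μ * (starRingEnd ℂ) c₀ ^ 2)
    {n : ℕ} {P : Poly} (hP : P ∈ polyLT (n + 1)) {k l : ℕ} (h : k + l = n) :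
    k.factorial * l.factorial * coeff₂ (polyPencil c₀ c₁ μ P) k l =
      -((1 - μ) * c₁ ^ 2 - μ * c₀ ^ 2) *
        (leadSeq P n (k + 2) - ((r + s) * leadSeq P n (k + 1) - r * s * leadSeq P n k)) := by
  have e0 : n + 2 - (k + 2) = l := by omega
  have e1 : n + 2 - (k + 1) = l + 1 := by omega
  have e2 : n + 2 - k = l + 2 := by omega
  rw [polyPencil_apply, coeff₂_sub, coeff₂_smul, coeff₂_add, coeff₂_polyForm _ hP h,
    coeff₂_polyForm _ hP h, coeff₂_polyDeriv_polyDeriv, coeff₂_polyDeriv_polyDeriv,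
    leadSeq, leadSeq, leadSeq, e0, e1, e2]
  set H : Poly := MvPolynomial.X 0 * MvPolynomial.X 1 * P
  simp only [Nat.factorial_succ]
  push_cast
  linear_combination (-(k.factorial : ℂ) * l.factorial * (k + 1) * (l + 1) *
    coeff₂ H (k + 1) (l + 1)) * h₁ + ((k.factorial : ℂ) * l.factorial * (l + 1) * (l + 2) *
    coeff₂ H k (l + 2)) * h₂

theorem exists_pow_eq_of_polyPencil_eq_zero (ha : (1 - μ) * c₁ ^ 2 - μ * c₀ ^ 2 ≠ 0) (hrs : r ≠ s)
    (h₁ : ((1 - μ) * c₁ ^ 2 - μ * c₀ ^ 2) * (r + s) =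
      -(2 * ((1 - μ) * (c₁ * (starRingEnd ℂ) c₁) - μ * (c₀ * (starRingEnd ℂ) c₀))))
    (h₂ : ((1 - μ) * c₁ ^ 2 - μ * c₀ ^ 2) * (r * s) =
      (1 - μ) * (starRingEnd ℂ) c₁ ^ 2 - μ * (starRingEnd ℂ) c₀ ^ 2)
    {P : Poly} (hP : P ≠ 0) (h : polyPencil c₀ c₁ μ P = 0) : ∃ N, 2 ≤ N ∧ r ^ N = s ^ N := by
  obtain ⟨n, hn, k, l, hkl, hne⟩ := exists_leading hP
  refine ⟨n + 2, by omega, pow_eq_of_recurrence hrs (leadSeq_zero P n) (leadSeq_last P n) ?_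
    ⟨k + 1, by omega, ?_⟩⟩
  · intro j hj
    have := coeff₂_polyPencil h₁ h₂ hn (show j + (n - j) = n by omega)
    rw [h, coeff₂_zero, mul_zero] at this
    exact sub_eq_zero.1 ((mul_eq_zero.1 this.symm).resolve_left (neg_ne_zero.2 ha))
  · rw [leadSeq_succ P hkl]
    exact mul_ne_zero (mul_ne_zero (by exact_mod_cast Nat.factorial_ne_zero _)
      (by exact_mod_cast Nat.factorial_ne_zero _)) hne

theorem polyPencil_mem {n : ℕ} {P : Poly} (hP : P ∈ polyLT n) : polyPencil c₀ c₁ μ P ∈ polyLT n :=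
  sub_mem (polyForm_mem _ hP) (Submodule.smul_mem _ _ (add_mem (polyForm_mem _ hP) (polyForm_mem _ hP)))

/-- A solution of the equation for the leading form completes to a solution: the pencil decreases
the degree of the leading form, so it is not injective. -/
theorem exists_polyPencil_eq_zero (hrs : r ≠ s)
    (h₁ : ((1 - μ) * c₁ ^ 2 - μ * c₀ ^ 2) * (r + s) =
      -(2 * ((1 - μ) * (c₁ * (starRingEnd ℂ) c₁) - μ * (c₀ * (starRingEnd ℂ) c₀))))
    (h₂ : ((1 - μ) * c₁ ^ 2 - μ * c₀ ^ 2) * (r * s) =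
      (1 - μ) * (starRingEnd ℂ) c₁ ^ 2 - μ * (starRingEnd ℂ) c₀ ^ 2)
    {N : ℕ} (hN : 2 ≤ N) (h : r ^ N = s ^ N) : ∃ P : Poly, P ≠ 0 ∧ polyPencil c₀ c₁ μ P = 0 := by
  obtain ⟨n, rfl⟩ := Nat.exists_eq_add_of_le' hN
  set f : Poly := ∑ i ∈ Finset.range (n + 1), MvPolynomial.monomial
    (Finsupp.single 0 i + Finsupp.single 1 (n - i))
    ((r ^ (i + 1) - s ^ (i + 1)) / ((i + 1).factorial * (n - i + 1).factorial)) with hf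
  have hfc : ∀ k l, coeff₂ f k l = if k + l = n then
      (r ^ (k + 1) - s ^ (k + 1)) / ((k + 1).factorial * (l + 1).factorial) else 0 := by
    intro k l
    have e : coeff₂ f k l = ∑ i ∈ Finset.range (n + 1), coeff₂ (MvPolynomial.monomial
        (Finsupp.single 0 i + Finsupp.single 1 (n - i)) ((r ^ (i + 1) - s ^ (i + 1)) /
          ((i + 1).factorial * (n - i + 1).factorial))) k l := MvPolynomial.coeff_sum _ _ _
    rw [e]
    simp only [coeff₂_monomial]
    split_ifs with hkl
    · rw [Finset.sum_eq_single k]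
      · have : n - k = l := by omega
        rw [if_pos ⟨rfl, this⟩, this]
      · intro i _ hi
        rw [if_neg fun h => hi h.1]
      · intro hk
        exact absurd (Finset.mem_range.2 (by omega)) hk
    · refine Finset.sum_eq_zero fun i hi => if_neg ?_
      rw [Finset.mem_range] at hi
      rintro ⟨h3, h4⟩
      omega
  have hfm : f ∈ polyLT (n + 1) := fun k l hkl => by rw [hfc, if_neg (by omega)]
  have hfn : f ∉ polyLT n := by
    intro hm
    have h0 := hm 0 n (by omega)
    rw [hfc, if_pos (zero_add n), zero_add, pow_one, pow_one, div_eq_zero_iff] at h0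
    rcases h0 with h0 | h0
    · exact hrs (sub_eq_zero.1 h0)
    · exact mul_ne_zero (by exact_mod_cast Nat.factorial_ne_zero _)
        (by exact_mod_cast Nat.factorial_ne_zero _) h0
  have hlead : ∀ j ≤ n + 2, leadSeq f n j = r ^ j - s ^ j := by
    intro j hj
    rcases j with _ | j
    · rw [leadSeq_zero]; simp
    rcases Nat.lt_or_ge n j with hj' | hj'
    · obtain rfl : j = n + 1 := by omega
      rw [leadSeq_last, h, sub_self]
    · have e : j + (n - j) = n := by omega
      rw [leadSeq_succ f e, hfc, if_pos e]
      have h3 : ((j + 1).factorial : ℂ) ≠ 0 := by exact_mod_cast Nat.factorial_ne_zero _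
      have h4 : ((n - j + 1).factorial : ℂ) ≠ 0 := by exact_mod_cast Nat.factorial_ne_zero _
      field_simp
  have hSf : polyPencil c₀ c₁ μ f ∈ polyLT n := by
    intro k l hkl
    rcases hkl.lt_or_eq with hlt | heq
    · exact polyPencil_mem hfm k l hlt
    · have := coeff₂_polyPencil h₁ h₂ hfm heq.symm
      rw [hlead _ (by omega), hlead _ (by omega), hlead _ (by omega)] at this
      have h3 : (k.factorial : ℂ) * l.factorial ≠ 0 :=
        mul_ne_zero (by exact_mod_cast Nat.factorial_ne_zero _)
          (by exact_mod_cast Nat.factorial_ne_zero _)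
      refine (mul_eq_zero.1 (this.trans ?_)).resolve_left h3
      ring
  set S : polyLT n →ₗ[ℂ] polyLT n := (polyPencil c₀ c₁ μ).restrict fun P hP => polyPencil_mem hP
  by_cases hinj : Function.Injective S
  · obtain ⟨g, hg⟩ := LinearMap.injective_iff_surjective.1 hinj ⟨_, hSf⟩
    have hg' : polyPencil c₀ c₁ μ g = polyPencil c₀ c₁ μ f := congrArg Subtype.val hg
    refine ⟨f - g, fun h0 => hfn ?_, by rw [map_sub, hg', sub_self]⟩
    rw [sub_eq_zero.1 h0]
    exact g.2
  · rw [← LinearMap.ker_eq_bot, Submodule.eq_bot_iff] at hinj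
    push Not at hinj
    obtain ⟨P, hP, hP0⟩ := hinj
    exact ⟨P, fun h0 => hP0 (Subtype.ext h0), congrArg Subtype.val (LinearMap.mem_ker.1 hP)⟩

end Recurrence

/-! ### Eigenfunctions of ellipses -/

section EllipseModes

variable {p q : ℂ} {v : Plane}

/-- The function on the plane given by a polynomial in the complex coordinate of the ellipse and its
conjugate. -/
def ellPoly (p q : ℂ) (v : Plane) (P : Poly) (x : Plane) : ℂ :=
  MvPolynomial.eval ![ellCoord p q v x, (starRingEnd ℂ) (ellCoord p q v x)] P

theorem isSmooth_ellCoord : IsSmooth (ellCoord p q v) := by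
  have e : ellCoord p q v = fun x => (-Complex.I * q * (((x 0 : ℝ) : ℂ) - (v 0 : ℂ)) +
      Complex.I * p * (((x 1 : ℝ) : ℂ) - (v 1 : ℂ))) / ((((starRingEnd ℂ) p * q).im : ℝ) : ℂ) := by
    funext x
    simp only [ellCoord, Complex.ofReal_sub]
  rw [e]
  exact ((contDiff_const.mul ((isSmooth_coord 0).sub contDiff_const)).add
    (contDiff_const.mul ((isSmooth_coord 1).sub contDiff_const))).div_const _

theorem isSmooth_conj_ellCoord : IsSmooth fun x => (starRingEnd ℂ) (ellCoord p q v x) :=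
  Complex.conjCLE.contDiff.comp isSmooth_ellCoord

/-- The partial derivatives of the complex coordinate of the ellipse. -/
def ellDeriv (p q : ℂ) (j : Fin 2) : ℂ :=
  ![-Complex.I * q, Complex.I * p] j / ((((starRingEnd ℂ) p * q).im : ℝ) : ℂ)

theorem partialDeriv_ellCoord (j : Fin 2) (x : Plane) :
    partialDeriv j (ellCoord p q v) x = ellDeriv p q j := by
  have h0 : HasFDerivAt (fun x : Plane => ((x 0 - v 0 : ℝ) : ℂ))
      (Complex.ofRealCLM.comp (EuclideanSpace.proj 0 : Plane →L[ℝ] ℝ)) x :=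
    Complex.ofRealCLM.hasFDerivAt.comp x
      ((EuclideanSpace.proj 0 : Plane →L[ℝ] ℝ).hasFDerivAt.sub_const (v 0))
  have h1 : HasFDerivAt (fun x : Plane => ((x 1 - v 1 : ℝ) : ℂ))
      (Complex.ofRealCLM.comp (EuclideanSpace.proj 1 : Plane →L[ℝ] ℝ)) x :=
    Complex.ofRealCLM.hasFDerivAt.comp x
      ((EuclideanSpace.proj 1 : Plane →L[ℝ] ℝ).hasFDerivAt.sub_const (v 1))
  have h := ((h0.const_mul (-Complex.I * q)).add (h1.const_mul (Complex.I * p))).mul_const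
    ((((starRingEnd ℂ) p * q).im : ℝ) : ℂ)⁻¹
  have h' : HasFDerivAt (ellCoord p q v) _ x := h
  rw [partialDeriv, h'.fderiv]
  fin_cases j
  · simp [ellDeriv]
    ring
  · simp [ellDeriv]
    ring

theorem ellPoly_add (P Q : Poly) (x : Plane) :
    ellPoly p q v (P + Q) x = ellPoly p q v P x + ellPoly p q v Q x := map_add _ _ _

theorem ellPoly_mul (P Q : Poly) (x : Plane) :
    ellPoly p q v (P * Q) x = ellPoly p q v P x * ellPoly p q v Q x := map_mul _ _ _

theorem ellPoly_smul (c : ℂ) (P : Poly) (x : Plane) :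
    ellPoly p q v (c • P) x = c * ellPoly p q v P x := by
  rw [MvPolynomial.smul_eq_C_mul, ellPoly_mul, ellPoly, MvPolynomial.eval_C]

theorem ellPoly_X_zero (x : Plane) : ellPoly p q v (MvPolynomial.X 0) x = ellCoord p q v x :=
  MvPolynomial.eval_X _

theorem ellPoly_X_one (x : Plane) :
    ellPoly p q v (MvPolynomial.X 1) x = (starRingEnd ℂ) (ellCoord p q v x) :=
  MvPolynomial.eval_X _

theorem isSmooth_ellPoly (P : Poly) : IsSmooth (ellPoly p q v P) := by
  induction P using MvPolynomial.induction_on with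
  | C a =>
    have : ellPoly p q v (MvPolynomial.C a) = fun _ => a := funext fun x => MvPolynomial.eval_C _
    rw [this]
    exact contDiff_const
  | add P Q hP hQ =>
    have : ellPoly p q v (P + Q) = fun x => ellPoly p q v P x + ellPoly p q v Q x :=
      funext fun x => ellPoly_add P Q x
    rw [this]
    exact ContDiff.add hP hQ
  | mul_X P i hP =>
    have : ellPoly p q v (P * MvPolynomial.X i) =
        fun x => ellPoly p q v P x * ellPoly p q v (MvPolynomial.X i) x :=
      funext fun x => ellPoly_mul P _ x
    rw [this]
    refine ContDiff.mul hP ?_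
    fin_cases i
    · exact (funext ellPoly_X_zero : ellPoly p q v (MvPolynomial.X 0) = _) ▸ isSmooth_ellCoord
    · exact (funext ellPoly_X_one : ellPoly p q v (MvPolynomial.X 1) = _) ▸ isSmooth_conj_ellCoord

theorem polyDeriv_mul (c : ℂ) (P Q : Poly) :
    polyDeriv c (P * Q) = polyDeriv c P * Q + P * polyDeriv c Q := by
  simp only [polyDeriv_apply, MvPolynomial.pderiv_mul, MvPolynomial.smul_eq_C_mul]
  ring

theorem partialDeriv_ellPoly (j : Fin 2) (P : Poly) :
    partialDeriv j (ellPoly p q v P) = ellPoly p q v (polyDeriv (ellDeriv p q j) P) := by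
  funext x
  induction P using MvPolynomial.induction_on with
  | C a =>
    have h1 : ellPoly p q v (MvPolynomial.C a) = fun _ => a := funext fun x => MvPolynomial.eval_C _
    rw [h1, polyDeriv_apply]
    simp [partialDeriv, ellPoly]
  | add P Q hP hQ =>
    have h1 : ellPoly p q v (P + Q) = fun x => ellPoly p q v P x + ellPoly p q v Q x :=
      funext fun x => ellPoly_add P Q x
    rw [h1, partialDeriv_add ((isSmooth_ellPoly P).differentiable x)
      ((isSmooth_ellPoly Q).differentiable x), hP, hQ, map_add, ellPoly_add]
  | mul_X P i hP =>
    have h1 : ellPoly p q v (P * MvPolynomial.X i) =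
        fun x => ellPoly p q v P x * ellPoly p q v (MvPolynomial.X i) x :=
      funext fun x => ellPoly_mul P _ x
    have h2 : partialDeriv j (ellPoly p q v (MvPolynomial.X i)) x =
        ellPoly p q v (polyDeriv (ellDeriv p q j) (MvPolynomial.X i)) x := by
      fin_cases i
      · have e : ellPoly p q v (MvPolynomial.X 0) = ellCoord p q v := funext ellPoly_X_zero
        change partialDeriv j (ellPoly p q v (MvPolynomial.X 0)) x =
          ellPoly p q v (polyDeriv (ellDeriv p q j) (MvPolynomial.X 0)) x
        rw [e, partialDeriv_ellCoord, polyDeriv_apply, MvPolynomial.pderiv_X_self,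
          MvPolynomial.pderiv_X_of_ne (by decide), smul_zero, add_zero, ellPoly_smul]
        simp [ellPoly]
      · have e : ellPoly p q v (MvPolynomial.X 1) = fun x => (starRingEnd ℂ) (ellCoord p q v x) :=
          funext ellPoly_X_one
        change partialDeriv j (ellPoly p q v (MvPolynomial.X 1)) x =
          ellPoly p q v (polyDeriv (ellDeriv p q j) (MvPolynomial.X 1)) x
        rw [e, partialDeriv_conj (isSmooth_ellCoord.differentiable x), partialDeriv_ellCoord,
          polyDeriv_apply, MvPolynomial.pderiv_X_self,
          MvPolynomial.pderiv_X_of_ne (by decide), smul_zero, zero_add, ellPoly_smul]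
        simp [ellPoly]
    rw [h1, partialDeriv_mul ((isSmooth_ellPoly P).differentiable x)
      ((isSmooth_ellPoly _).differentiable x), hP, h2, polyDeriv_mul, ellPoly_add, ellPoly_mul,
      ellPoly_mul]

/-- A polynomial is determined by its values on the ellipse, as a polynomial in the real
coordinates is determined by its values on a square. -/
theorem eq_zero_of_ellPoly_eq_zero (hD : 0 < ((starRingEnd ℂ) p * q).im) {P : Poly}
    (h : EqOn (ellPoly p q v P) 0 (ellipse p q v)) : P = 0 := by
  set S : Set ℂ := Complex.ofReal '' Ioo (0 : ℝ) (1 / 2) with hS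
  have hSinf : S.Infinite :=
    (Ioo_infinite (by norm_num)).image Complex.ofReal_injective.injOn
  let τ : Fin 2 → Poly := ![MvPolynomial.X 0 + MvPolynomial.C Complex.I * MvPolynomial.X 1,
    MvPolynomial.X 0 - MvPolynomial.C Complex.I * MvPolynomial.X 1]
  let σ : Fin 2 → Poly := ![MvPolynomial.C (1 / 2) * (MvPolynomial.X 0 + MvPolynomial.X 1),
    MvPolynomial.C (-Complex.I / 2) * (MvPolynomial.X 0 - MvPolynomial.X 1)]
  have hQ : MvPolynomial.bind₁ τ P = 0 := by
    refine MvPolynomial.funext_set (fun _ => S) (fun _ => hSinf) fun y hy => ?_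
    obtain ⟨a, ha, ha'⟩ := hy 0 (mem_univ _)
    obtain ⟨b, hb, hb'⟩ := hy 1 (mem_univ _)
    set z : ℂ := a + b * Complex.I with hz
    have hz1 : ‖z‖ < 1 := by
      calc ‖z‖ ≤ ‖(a : ℂ)‖ + ‖(b : ℂ) * Complex.I‖ := norm_add_le _ _
        _ = a + b := by
          rw [norm_mul, Complex.norm_I, mul_one, Complex.norm_real, Complex.norm_real,
            Real.norm_of_nonneg ha.1.le, Real.norm_of_nonneg hb.1.le]
        _ < 1 := by linarith [ha.2, hb.2]
    have hmem : ellMap p q v z ∈ ellipse p q v := by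
      change ‖ellCoord p q v (ellMap p q v z)‖ < 1
      rwa [ellCoord_ellMap hD]
    have h1 := h hmem
    rw [ellPoly, ellCoord_ellMap hD] at h1
    have hb : MvPolynomial.eval y (MvPolynomial.bind₁ τ P) =
        MvPolynomial.eval (fun i => MvPolynomial.eval y (τ i)) P :=
      MvPolynomial.eval₂Hom_bind₁ _ _ _ _
    rw [hb, map_zero, ← h1.trans (Pi.zero_apply _)]
    congr 2
    funext i
    fin_cases i
    · simp [τ, ← ha', ← hb', hz]
      ring
    · simp [τ, ← ha', ← hb', hz]
      ring
  have hid : MvPolynomial.bind₁ σ (MvPolynomial.bind₁ τ P) = P := by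
    rw [MvPolynomial.bind₁_bind₁]
    conv_rhs => rw [← MvPolynomial.aeval_X_left_apply P]
    change MvPolynomial.aeval _ P = _
    congr 2
    funext i
    have hI : (MvPolynomial.C Complex.I : Poly) * MvPolynomial.C (-Complex.I / 2) =
        MvPolynomial.C (1 / 2) := by
      rw [← MvPolynomial.C_mul]
      congr 1
      linear_combination (-1 / 2 : ℂ) * Complex.I_mul_I
    have h2 : (MvPolynomial.C (1 / 2) : Poly) + MvPolynomial.C (1 / 2) = 1 := by
      rw [← MvPolynomial.C_add, ← MvPolynomial.C_1]
      norm_num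
    fin_cases i
    · simp [τ, σ, -one_div]
      linear_combination (MvPolynomial.X 0 - MvPolynomial.X 1) * hI + MvPolynomial.X 0 * h2
    · simp [τ, σ, -one_div]
      linear_combination -(MvPolynomial.X 0 - MvPolynomial.X 1) * hI + MvPolynomial.X 1 * h2
  rw [← hid, hQ, map_zero]

/-- The polynomial `(1 - X₀ X₁) P`, which vanishes on the boundary of the ellipse. -/
def bdryPoly (P : Poly) : Poly := (1 - MvPolynomial.X 0 * MvPolynomial.X 1) * P

theorem ellPoly_bdryPoly (P : Poly) (x : Plane) : ellPoly p q v (bdryPoly P) x =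
    ((1 - Complex.normSq (ellCoord p q v x) : ℝ) : ℂ) * ellPoly p q v P x := by
  rw [bdryPoly, ellPoly_mul]
  congr 1
  simp [ellPoly, Complex.mul_conj]

theorem ellPoly_jet_mem_H10 (hD : 0 < ((starRingEnd ℂ) p * q).im) (P : Poly) :
    (isBoundedOpen_ellipse hD).jet (ellPoly p q v (bdryPoly P)) (isSmooth_ellPoly _) ∈
      H10 (ellipse p q v) := by
  set ρ : Plane → ℝ := fun x => 1 - Complex.normSq (ellCoord p q v x) with hρ
  have hρs : ContDiff ℝ ((⊤ : ℕ∞) : WithTop ℕ∞) ρ := by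
    have e : ρ = fun x => 1 - ‖ellCoord p q v x‖ ^ 2 := by
      funext x
      rw [hρ, ← Complex.normSq_eq_norm_sq]
    rw [e]
    exact contDiff_const.sub (ContDiff.norm_sq ℝ isSmooth_ellCoord)
  have hpos : ∀ x, x ∈ ellipse p q v ↔ 0 < ρ x := by
    intro x
    change ‖ellCoord p q v x‖ < 1 ↔ 0 < 1 - Complex.normSq (ellCoord p q v x)
    rw [Complex.normSq_eq_norm_sq, sub_pos, sq_lt_one_iff₀ (norm_nonneg _)]
  obtain ⟨C, hC⟩ := (isBoundedOpen_ellipse (v := v) hD).exists_bound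
    (isSmooth_ellPoly (p := p) (q := q) (v := v) P).continuous
  have hb : ∀ x ∈ ellipse p q v, ‖ellPoly p q v (bdryPoly P) x‖ ≤ C * ρ x := by
    intro x hx
    have h0 := (hpos x).1 hx
    rw [ellPoly_bdryPoly, norm_mul, Complex.norm_real, Real.norm_of_nonneg h0.le, mul_comm]
    exact mul_le_mul_of_nonneg_right (hC x hx) h0.le
  refine (isBoundedOpen_ellipse hD).jet_mem_H10 hρs hρs ?_ _ hb hb
  ext x
  rw [hpos]
  exact (and_self_iff).symm

/-- The element of `H¹₀` given by `(1 - |Z|²) P(Z, Z̄)`. -/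
def ellMode (v : Plane) (hD : 0 < ((starRingEnd ℂ) p * q).im) (P : Poly) : H10 (ellipse p q v) :=
  ⟨_, ellPoly_jet_mem_H10 hD P⟩

theorem ellMode_eq_zero (hD : 0 < ((starRingEnd ℂ) p * q).im) {P : Poly}
    (h : ellMode v hD P = 0) : P = 0 := by
  have h1 := (isBoundedOpen_ellipse hD).eqOn_zero_of_jet_eq_zero (ellPoly_jet_mem_H10 hD P) h
  refine eq_zero_of_ellPoly_eq_zero hD (v := v) fun x hx => ?_
  have h2 : ellPoly p q v (bdryPoly P) x = 0 := h1 hx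
  rw [ellPoly_bdryPoly] at h2
  refine (mul_eq_zero.1 h2).resolve_left ?_
  have h3 : ‖ellCoord p q v x‖ < 1 := hx
  have h4 : 0 < 1 - Complex.normSq (ellCoord p q v x) := by
    rwa [Complex.normSq_eq_norm_sq, sub_pos, sq_lt_one_iff₀ (norm_nonneg _)]
  exact_mod_cast h4.ne'

/-- The pairing of a polynomial with an element of `H¹₀`. -/
def ellPairing (hD : 0 < ((starRingEnd ℂ) p * q).im) (w : H10 (ellipse p q v)) : Poly →ₗ[ℂ] ℂ where
  toFun P := ∫ x in ellipse p q v, ellPoly p q v P x * (w : Jet (ellipse p q v)) none x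
  map_add' P Q := by
    simp only [ellPoly_add, add_mul]
    exact integral_add
      ((isBoundedOpen_ellipse hD).integrableOn_continuous_mul (isSmooth_ellPoly P).continuous
        ((isBoundedOpen_ellipse hD).integrable_L2 _))
      ((isBoundedOpen_ellipse hD).integrableOn_continuous_mul (isSmooth_ellPoly Q).continuous
        ((isBoundedOpen_ellipse hD).integrable_L2 _))
  map_smul' c P := by
    simp only [ellPoly_smul, mul_assoc, RingHom.id_apply, smul_eq_mul]
    exact integral_const_mul _ _

theorem partialDeriv_partialDeriv_bdryPoly (j : Fin 2) (P : Poly) (x : Plane) :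
    partialDeriv j (partialDeriv j (ellPoly p q v (bdryPoly P))) x =
      ellPoly p q v (polyForm (ellDeriv p q j) P) x := by
  rw [partialDeriv_ellPoly, partialDeriv_ellPoly]
  rfl

theorem lap_ellMode (hD : 0 < ((starRingEnd ℂ) p * q).im) (P : Poly) (w : H10 (ellipse p q v)) :
    (isBoundedOpen_ellipse hD).forms.lap (ellMode v hD P) w =
      ellPairing hD w ((polyForm (ellDeriv p q 0) + polyForm (ellDeriv p q 1)) P) := by
  have h := (isBoundedOpen_ellipse hD).lap_jet (ellPoly_jet_mem_H10 hD P) w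
  simp only [partialDeriv_partialDeriv_bdryPoly, ← ellPoly_add] at h
  exact h

theorem isEigenpair_ellMode (hD : 0 < ((starRingEnd ℂ) p * q).im) {P : Poly} {μ : ℂ}
    (h : polyPencil (ellDeriv p q 0) (ellDeriv p q 1) μ P = 0) :
    (isBoundedOpen_ellipse hD).forms.IsEigenpair μ (ellMode v hD P) := by
  refine (isBoundedOpen_ellipse hD).isEigenpair_jet _ fun x => ?_
  rw [partialDeriv_partialDeriv_bdryPoly, partialDeriv_partialDeriv_bdryPoly, ← ellPoly_add,
    ← ellPoly_smul]
  rw [polyPencil_apply, sub_eq_zero] at h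
  rw [← h]

/-- The Laplacian of `(1 - |Z|²) P` determines `P`, by uniqueness in the Dirichlet problem. -/
theorem eq_zero_of_polyLap_eq_zero (hD : 0 < ((starRingEnd ℂ) p * q).im) {P : Poly}
    (h : (polyForm (ellDeriv p q 0) + polyForm (ellDeriv p q 1)) P = 0) : P = 0 := by
  refine ellMode_eq_zero (v := 0) hD
    ((isBoundedOpen_ellipse hD).jet_eq_zero_of_laplacian_eq_zero _ fun x => ?_)
  rw [partialDeriv_partialDeriv_bdryPoly, partialDeriv_partialDeriv_bdryPoly, ← ellPoly_add,
    ← LinearMap.add_apply, h]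
  exact map_zero _

/-- There are no Jordan blocks on the polynomials, since there are none on `H¹₀`. -/
theorem eq_zero_of_polyPencil_jordan (hD : 0 < ((starRingEnd ℂ) p * q).im) {P Q : Poly} {μ : ℂ}
    (hP : polyPencil (ellDeriv p q 0) (ellDeriv p q 1) μ P = 0)
    (hQ : polyPencil (ellDeriv p q 0) (ellDeriv p q 1) μ Q =
      (polyForm (ellDeriv p q 0) + polyForm (ellDeriv p q 1)) P) : P = 0 := by
  refine ellMode_eq_zero (v := 0) hD ((isBoundedOpen_ellipse hD).jet_eq_zero_of_jordan (μ := μ)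
    (ellPoly_jet_mem_H10 hD Q) _ (fun x => ?_) fun x => ?_)
  · rw [partialDeriv_partialDeriv_bdryPoly, partialDeriv_partialDeriv_bdryPoly, ← ellPoly_add,
      ← ellPoly_smul]
    rw [polyPencil_apply, sub_eq_zero] at hP
    rw [← hP]
  · rw [partialDeriv_partialDeriv_bdryPoly, partialDeriv_partialDeriv_bdryPoly,
      partialDeriv_partialDeriv_bdryPoly, partialDeriv_partialDeriv_bdryPoly, ← ellPoly_add,
      ← ellPoly_add, ← ellPoly_smul, ← ellPoly_add]
    rw [polyPencil_apply, sub_eq_iff_eq_add, LinearMap.add_apply, add_comm] at hQ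
    rw [← hQ]

/-- The eigenpairs given by polynomials. -/
def ellEigenpairs (v : Plane) (hD : 0 < ((starRingEnd ℂ) p * q).im) :
    Set (ℂ × H10 (ellipse p q v)) :=
  {e | ∃ P : Poly, P ≠ 0 ∧ polyPencil (ellDeriv p q 0) (ellDeriv p q 1) e.1 P = 0 ∧
    e.2 = ellMode v hD P}

/-- The linear map `(∂₀² + ∂₁²)⁻¹ ∂₁²` on the polynomials of bounded degree is diagonalizable. -/
theorem iSup_eigenspace_eq_top (hD : 0 < ((starRingEnd ℂ) p * q).im) {n : ℕ}
    {L T : polyLT n →ₗ[ℂ] polyLT n}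
    (hL : ∀ P, (L P : Poly) = (polyForm (ellDeriv p q 0) + polyForm (ellDeriv p q 1)) P)
    (hT : ∀ P, (L (T P) : Poly) = polyForm (ellDeriv p q 1) P) :
    ⨆ μ, Module.End.eigenspace T μ = ⊤ := by
  have hpen : ∀ (μ : ℂ) (P Q : polyLT n), (T - algebraMap ℂ (Module.End ℂ (polyLT n)) μ) P = Q →
      polyPencil (ellDeriv p q 0) (ellDeriv p q 1) μ P =
        (polyForm (ellDeriv p q 0) + polyForm (ellDeriv p q 1)) Q := by
    rintro μ P Q rfl
    rw [polyPencil_apply, ← LinearMap.add_apply, ← hT, ← hL, ← hL, LinearMap.sub_apply, map_sub,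
      Module.algebraMap_end_apply, map_smul]
    rfl
  have hker : ∀ (μ : ℂ) (k : ℕ) (P : polyLT n),
      ((T - algebraMap ℂ (Module.End ℂ (polyLT n)) μ) ^ k) P = 0 →
        (T - algebraMap ℂ (Module.End ℂ (polyLT n)) μ) P = 0 := by
    intro μ k
    induction k with
    | zero =>
      intro P hP
      rw [pow_zero, Module.End.one_apply] at hP
      rw [hP, map_zero]
    | succ k ih =>
      intro P hP
      rw [pow_succ, Module.End.mul_apply] at hP
      have h1 := hpen μ _ 0 (ih _ hP)
      rw [ZeroMemClass.coe_zero, map_zero] at h1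
      exact Subtype.ext (eq_zero_of_polyPencil_jordan hD h1 (hpen μ P _ rfl))
  refine eq_top_iff.2 ((Module.End.iSup_maxGenEigenspace_eq_top T).symm.le.trans
    (iSup_mono fun μ P hP => ?_))
  obtain ⟨k, hk⟩ := (Module.End.mem_maxGenEigenspace _ _ _).1 hP
  rw [Module.End.mem_eigenspace_iff]
  have := hker μ k P (by rw [Algebra.algebraMap_eq_smul_one]; exact hk)
  rw [LinearMap.sub_apply, Module.algebraMap_end_apply, sub_eq_zero] at this
  exact this

theorem ellPairing_eq_zero (hD : 0 < ((starRingEnd ℂ) p * q).im) {w : H10 (ellipse p q v)}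
    (hw : ∀ e ∈ ellEigenpairs v hD, (isBoundedOpen_ellipse hD).forms.lap e.2 w = 0) (Q : Poly) :
    ellPairing hD w Q = 0 := by
  obtain ⟨n, hQ⟩ := exists_mem_polyLT Q
  let L : polyLT n →ₗ[ℂ] polyLT n := (polyForm (ellDeriv p q 0) + polyForm (ellDeriv p q 1)).restrict
    fun P hP => add_mem (polyForm_mem _ hP) (polyForm_mem _ hP)
  have hLinj : Function.Injective L := by
    rw [← LinearMap.ker_eq_bot, Submodule.eq_bot_iff]
    intro P hP
    exact Subtype.ext (eq_zero_of_polyLap_eq_zero hD (congrArg Subtype.val (LinearMap.mem_ker.1 hP)))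
  let e : polyLT n ≃ₗ[ℂ] polyLT n := LinearEquiv.ofInjectiveEndo L hLinj
  let N : polyLT n →ₗ[ℂ] polyLT n := (polyForm (ellDeriv p q 1)).restrict
    fun P hP => polyForm_mem _ hP
  let T : polyLT n →ₗ[ℂ] polyLT n := e.symm.toLinearMap ∘ₗ N
  have hLT : ∀ P, L (T P) = N P := fun P => e.apply_symm_apply (N P)
  have htop := iSup_eigenspace_eq_top (L := L) (T := T) hD (fun P => rfl)
    (fun P => congrArg Subtype.val (hLT P))
  have hle : ⨆ μ, Module.End.eigenspace T μ ≤
      LinearMap.ker ((ellPairing hD w) ∘ₗ (polyLT n).subtype ∘ₗ L) := by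
    refine iSup_le fun μ P hP => ?_
    rw [LinearMap.mem_ker]
    by_cases hP0 : P = 0
    · rw [hP0, map_zero]
    have h1 : polyPencil (ellDeriv p q 0) (ellDeriv p q 1) μ P = 0 := by
      have h2 := congrArg (fun R => (L R : Poly)) (Module.End.mem_eigenspace_iff.1 hP)
      simp only [hLT, map_smul] at h2
      exact sub_eq_zero.2 h2
    have h3 := hw (μ, ellMode v hD P) ⟨P, fun h => hP0 (Subtype.ext h), h1, rfl⟩
    rw [lap_ellMode] at h3
    exact h3
  rw [htop] at hle
  obtain ⟨P, hP⟩ := e.surjective ⟨Q, hQ⟩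
  have h := hle (Submodule.mem_top (x := P))
  have hP' : (L P : Poly) = Q := congrArg Subtype.val hP
  rw [← hP']
  exact h

/-- The polynomials of each degree are spanned by eigenvectors and are the Laplacians of such
polynomials, so an element of `H¹₀` orthogonal to all eigenvectors has vanishing moments. -/
theorem isComplete_ellEigenpairs (hD : 0 < ((starRingEnd ℂ) p * q).im) :
    (isBoundedOpen_ellipse hD).forms.IsComplete (ellEigenpairs v hD) := by
  have hΩ := isBoundedOpen_ellipse (v := v) hD
  constructor
  · rintro ⟨μ, u⟩ ⟨P, hP, h, rfl⟩
    exact ⟨isEigenpair_ellMode hD h, fun h0 => hP (ellMode_eq_zero hD h0)⟩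
  intro w hw
  have hae := hΩ.ae_eq_zero_of_moments (continuous_ellCoord (p := p) (q := q) (v := v))
    ((ellHomeo v hD).injective.injOn) (hΩ.integrable_L2 ((w : Jet (ellipse p q v)) none))
    fun m n => by
      have h := ellPairing_eq_zero hD hw (MvPolynomial.X 0 ^ m * MvPolynomial.X 1 ^ n)
      have e : ∀ x, ellPoly p q v (MvPolynomial.X 0 ^ m * MvPolynomial.X 1 ^ n) x =
          ellCoord p q v x ^ m * (starRingEnd ℂ) (ellCoord p q v x) ^ n := fun x => by
        simp [ellPoly]
      have h2 : ∫ x in ellipse p q v, ellPoly p q v (MvPolynomial.X 0 ^ m * MvPolynomial.X 1 ^ n) x *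
        (w : Jet (ellipse p q v)) none x = 0 := h
      simpa only [e] using h2
  exact hΩ.H10_eq_zero (IsBoundedOpen.eq_zero_of_ae _ hae)

/-- The leading form of an eigenpolynomial gives a solution of a recurrence with characteristic roots
`ω̄⁺ / ω⁺` and `ω̄⁻ / ω⁻` that vanishes at both ends; such a solution exists if and only if some powers
of the two roots agree. -/
theorem fst_image_ellEigenpairs (hD : 0 < ((starRingEnd ℂ) p * q).im) :
    Prod.fst '' ellEigenpairs v hD =
      {μ : ℂ | ∃ lam ∈ Ioo (0 : ℝ) 1, μ = ((lam ^ 2 : ℝ) : ℂ) ∧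
        ∃ r : ℚ, (r : ℝ) = ellAngle p q lam / Real.pi} := by
  have hroots : ∀ lam ∈ Ioo (0 : ℝ) 1, ∃ r s : ℂ,
      r = (starRingEnd ℂ) (omegaPlus p q lam) / omegaPlus p q lam ∧
      s = (starRingEnd ℂ) (omegaMinus p q lam) / omegaMinus p q lam ∧ r ≠ s ∧
      (1 - ((lam ^ 2 : ℝ) : ℂ)) * ellDeriv p q 1 ^ 2 - ((lam ^ 2 : ℝ) : ℂ) * ellDeriv p q 0 ^ 2 ≠ 0 ∧
      ((1 - ((lam ^ 2 : ℝ) : ℂ)) * ellDeriv p q 1 ^ 2 - ((lam ^ 2 : ℝ) : ℂ) * ellDeriv p q 0 ^ 2) *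
        (r + s) = -(2 * ((1 - ((lam ^ 2 : ℝ) : ℂ)) * (ellDeriv p q 1 * (starRingEnd ℂ) (ellDeriv p q 1)) -
          ((lam ^ 2 : ℝ) : ℂ) * (ellDeriv p q 0 * (starRingEnd ℂ) (ellDeriv p q 0)))) ∧
      ((1 - ((lam ^ 2 : ℝ) : ℂ)) * ellDeriv p q 1 ^ 2 - ((lam ^ 2 : ℝ) : ℂ) * ellDeriv p q 0 ^ 2) *
        (r * s) = (1 - ((lam ^ 2 : ℝ) : ℂ)) * (starRingEnd ℂ) (ellDeriv p q 1) ^ 2 -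
          ((lam ^ 2 : ℝ) : ℂ) * (starRingEnd ℂ) (ellDeriv p q 0) ^ 2 := by
    intro lam hlam
    have hm := sqrt_one_sub_sq_pos hlam
    have hm2 : √(1 - lam ^ 2) ^ 2 = 1 - lam ^ 2 := Real.sq_sqrt (Real.sqrt_pos.1 hm).le
    have hP0 := omegaPlus_ne_zero hD hlam
    have hM0 := omegaMinus_ne_zero hD hlam
    have hl' : (lam : ℂ) ≠ 0 := by exact_mod_cast hlam.1.ne'
    have hm' : ((√(1 - lam ^ 2) : ℝ) : ℂ) ≠ 0 := by exact_mod_cast hm.ne'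
    have hD' : ((((starRingEnd ℂ) p * q).im : ℝ) : ℂ) ≠ 0 := by exact_mod_cast hD.ne'
    have e1 : 1 - ((lam ^ 2 : ℝ) : ℂ) = ((√(1 - lam ^ 2) : ℝ) : ℂ) ^ 2 := by
      rw [← Complex.ofReal_pow, hm2]; push_cast; ring
    have c0 : ellDeriv p q 0 = -Complex.I * q / ((((starRingEnd ℂ) p * q).im : ℝ) : ℂ) := rfl
    have c1 : ellDeriv p q 1 = Complex.I * p / ((((starRingEnd ℂ) p * q).im : ℝ) : ℂ) := rfl
    have hIp : omegaPlus p q lam = p / (lam : ℂ) + q / ((√(1 - lam ^ 2) : ℝ) : ℂ) := rfl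
    have hIm : omegaMinus p q lam = -(p / (lam : ℂ)) + q / ((√(1 - lam ^ 2) : ℝ) : ℂ) := rfl
    have hcp : (starRingEnd ℂ) (omegaPlus p q lam) =
        (starRingEnd ℂ) p / (lam : ℂ) + (starRingEnd ℂ) q / ((√(1 - lam ^ 2) : ℝ) : ℂ) := by
      rw [hIp]; simp
    have hcm : (starRingEnd ℂ) (omegaMinus p q lam) =
        -((starRingEnd ℂ) p / (lam : ℂ)) + (starRingEnd ℂ) q / ((√(1 - lam ^ 2) : ℝ) : ℂ) := by
      rw [hIm]; simp
    have hc0 : (starRingEnd ℂ) (ellDeriv p q 0) = Complex.I * (starRingEnd ℂ) q /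
        ((((starRingEnd ℂ) p * q).im : ℝ) : ℂ) := by rw [c0]; simp
    have hc1 : (starRingEnd ℂ) (ellDeriv p q 1) = -Complex.I * (starRingEnd ℂ) p /
        ((((starRingEnd ℂ) p * q).im : ℝ) : ℂ) := by rw [c1]; simp
    -- The symbol of the pencil is a multiple of `(ω⁺ X - ω̄⁺ Y) (ω⁻ X - ω̄⁻ Y)`.
    have ha : (1 - ((lam ^ 2 : ℝ) : ℂ)) * ellDeriv p q 1 ^ 2 - ((lam ^ 2 : ℝ) : ℂ) * ellDeriv p q 0 ^ 2 =
        (lam : ℂ) ^ 2 * ((√(1 - lam ^ 2) : ℝ) : ℂ) ^ 2 / ((((starRingEnd ℂ) p * q).im : ℝ) : ℂ) ^ 2 *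
          (omegaPlus p q lam * omegaMinus p q lam) := by
      rw [e1, c0, c1, hIp, hIm, Complex.ofReal_pow]
      field_simp
      linear_combination (-(lam : ℂ) ^ 2 * q ^ 2 +
        ((√(1 - lam ^ 2) : ℝ) : ℂ) ^ 2 * p ^ 2) * Complex.I_sq
    refine ⟨_, _, rfl, rfl, ?_, ?_, ?_, ?_⟩
    · rw [Ne, div_eq_div_iff hP0 hM0]
      intro h
      obtain ⟨t, ht, ht'⟩ := omegaPlus_mul_conj_omegaMinus hD hlam
      have him : (omegaPlus p q lam * (starRingEnd ℂ) (omegaMinus p q lam)).im = 0 := by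
        rw [← Complex.conj_eq_iff_im, map_mul, Complex.conj_conj, h, mul_comm]
      rw [ht', ← Complex.exp_mul_I, Complex.im_ofReal_mul, Complex.exp_ofReal_mul_I_im,
        Real.sin_sub_pi_div_two] at him
      exact mul_ne_zero ht.ne' (neg_ne_zero.2 (Real.cos_arctan_pos _).ne') him
    · rw [ha]
      exact mul_ne_zero (div_ne_zero (mul_ne_zero (pow_ne_zero _ hl') (pow_ne_zero _ hm'))
        (pow_ne_zero _ hD')) (mul_ne_zero hP0 hM0)
    · have e2 : omegaPlus p q lam * omegaMinus p q lam *
          ((starRingEnd ℂ) (omegaPlus p q lam) / omegaPlus p q lam +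
            (starRingEnd ℂ) (omegaMinus p q lam) / omegaMinus p q lam) =
          (starRingEnd ℂ) (omegaPlus p q lam) * omegaMinus p q lam +
            omegaPlus p q lam * (starRingEnd ℂ) (omegaMinus p q lam) := by
        field_simp
      rw [ha, mul_assoc, e2, e1, hc0, hc1, c0, c1, hcp, hcm, hIp, hIm, Complex.ofReal_pow]
      field_simp
      ring_nf
      simp only [Complex.I_sq]
      ring
    · have e2 : omegaPlus p q lam * omegaMinus p q lam *
          ((starRingEnd ℂ) (omegaPlus p q lam) / omegaPlus p q lam *
            ((starRingEnd ℂ) (omegaMinus p q lam) / omegaMinus p q lam)) =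
          (starRingEnd ℂ) (omegaPlus p q lam) * (starRingEnd ℂ) (omegaMinus p q lam) := by
        field_simp
      rw [ha, mul_assoc, e2, e1, hc0, hc1, hcp, hcm, Complex.ofReal_pow]
      field_simp
      ring_nf
      simp only [Complex.I_sq]
      ring
  have hpow : ∀ lam ∈ Ioo (0 : ℝ) 1, ∀ N : ℕ,
      ((starRingEnd ℂ) (omegaPlus p q lam) / omegaPlus p q lam) ^ N =
        ((starRingEnd ℂ) (omegaMinus p q lam) / omegaMinus p q lam) ^ N ↔
      ((starRingEnd ℂ) (omegaPlus p q lam) * omegaMinus p q lam) ^ N =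
      (omegaPlus p q lam * (starRingEnd ℂ) (omegaMinus p q lam)) ^ N := by
    intro lam hlam N
    rw [div_pow, div_pow, div_eq_div_iff (pow_ne_zero _ (omegaPlus_ne_zero hD hlam))
      (pow_ne_zero _ (omegaMinus_ne_zero hD hlam)), ← mul_pow, ← mul_pow,
      mul_comm ((starRingEnd ℂ) (omegaMinus p q lam))]
  ext μ
  constructor
  · rintro ⟨⟨μ, u⟩, ⟨P, hP, h, rfl⟩, rfl⟩
    obtain ⟨m, hm, hm'⟩ := (isEigenpair_ellMode (v := v) hD h).exists_mem_Ioo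
      (fun h0 => hP (ellMode_eq_zero hD h0))
    obtain ⟨lam, hlam, rfl⟩ : ∃ lam ∈ Ioo (0 : ℝ) 1, m = lam ^ 2 :=
      ⟨√m, ⟨Real.sqrt_pos.2 hm.1, (Real.sqrt_lt' one_pos).2 (by simpa using hm.2)⟩,
        (Real.sq_sqrt hm.1.le).symm⟩
    refine ⟨lam, hlam, hm', (exists_conj_pow_eq_iff hD hlam).1 ?_⟩
    obtain ⟨r, s, hr, hs, hrs, ha, h₁, h₂⟩ := hroots lam hlam
    change μ = _ at hm'
    rw [hm'] at h
    obtain ⟨N, hN, hN'⟩ := exists_pow_eq_of_polyPencil_eq_zero ha hrs h₁ h₂ hP h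
    rw [hr, hs] at hN'
    exact ⟨N, hN, (hpow lam hlam N).1 hN'⟩
  · rintro ⟨lam, hlam, rfl, h⟩
    obtain ⟨N, hN, hN'⟩ := (exists_conj_pow_eq_iff hD hlam).2 h
    obtain ⟨r, s, hr, hs, hrs, ha, h₁, h₂⟩ := hroots lam hlam
    rw [← hpow lam hlam N, ← hr, ← hs] at hN'
    obtain ⟨P, hP, hP'⟩ := exists_polyPencil_eq_zero hrs h₁ h₂ hN hN'
    exact ⟨(_, ellMode v hD P), ⟨P, hP, hP', rfl⟩, rfl⟩

end EllipseModes

/-! ### The common conclusion -/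

/-- The statement for a domain with a complete family of eigenvectors whose eigenvalues are the
numbers `λ²` with `φ λ` rational, where `φ` is a strictly monotone function of `λ` which is
rational exactly when the rotation number is. -/
theorem spectral_description_of_isComplete {Ω : Set Plane} (hΩ : IsBoundedOpen Ω) {E : Set (ℂ × H10 Ω)}
    (hE : hΩ.forms.IsComplete E) {φ : ℝ → ℝ} (hc : ContinuousOn φ (Ioo 0 1))
    (hm : StrictMonoOn φ (Ioo 0 1)) (hφ : Prod.fst '' E = {μ : ℂ | ∃ lam ∈ Ioo (0 : ℝ) 1,
      μ = ((lam ^ 2 : ℝ) : ℂ) ∧ ∃ q : ℚ, (q : ℝ) = φ lam})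
    (hr : ∀ lam ∈ Ioo (0 : ℝ) 1, ∃ r, IsRotationNumber Ω lam r)
    (hrφ : ∀ lam ∈ Ioo (0 : ℝ) 1,
      (IsRationalMod (rotationNumber Ω lam) ↔ ∃ q : ℚ, (q : ℝ) = φ lam)) :
    (dirichletLaplacian Ω).IsInvertible ∧
    (∀ w z : Hm1 Ω, hm1Inner Ω (poincareOperator Ω w) z = hm1Inner Ω w (poincareOperator Ω z)) ∧
    (∀ lam ∈ Ioo (0 : ℝ) 1, IsRotationNumber Ω lam (rotationNumber Ω lam)) ∧
    spectrum ℂ (poincareOperator Ω) = Complex.ofReal '' Icc (0 : ℝ) 1 ∧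
    HasPurePointSpectrum (poincareOperator Ω) ∧
    closure (eigenvalues (poincareOperator Ω)) = Complex.ofReal '' Icc (0 : ℝ) 1 ∧
    eigenvalues (poincareOperator Ω) = {μ : ℂ | ∃ lam ∈ Ioo (0 : ℝ) 1,
      μ = ((lam ^ 2 : ℝ) : ℂ) ∧ IsRationalMod (rotationNumber Ω lam)} := by
  have hcl : closure (Prod.fst '' E) = Complex.ofReal '' Icc (0 : ℝ) 1 := by
    rw [hφ, closure_sq_eq_Icc hc hm]
  have heig := hΩ.eigenvalues_eq hE
  refine ⟨hΩ.dirichletLaplacian_isInvertible, hΩ.hm1Inner_poincareOperator, fun lam hlam => ?_,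
    hΩ.spectrum_eq hE hcl, hΩ.hasPurePointSpectrum hE, heig.symm ▸ hcl, ?_⟩
  · obtain ⟨r, h⟩ := hr lam hlam
    rwa [h.rotationNumber_eq]
  · rw [heig, hφ]
    ext μ
    exact exists_congr fun lam => and_congr_right fun hlam =>
      and_congr_right fun _ => (hrφ lam hlam).symm

end InternalWaves

end

theorem theorem2 (Ω : Set InternalWaves.Plane)
    (hΩ : InternalWaves.IsEllipse Ω ∨ InternalWaves.IsAxisParallelRectangle Ω) :
    -- the objects are well defined: `Δ_Ω` is invertible, `P` is self-adjoint on `H⁻¹(Ω)`, and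
    -- the rotation number exists for every `λ ∈ (0, 1)`
    (InternalWaves.dirichletLaplacian Ω).IsInvertible ∧
    (∀ w z : InternalWaves.Hm1 Ω,
      InternalWaves.hm1Inner Ω (InternalWaves.poincareOperator Ω w) z =
        InternalWaves.hm1Inner Ω w (InternalWaves.poincareOperator Ω z)) ∧
    (∀ lam ∈ Ioo (0 : ℝ) 1,
      InternalWaves.IsRotationNumber Ω lam (InternalWaves.rotationNumber Ω lam)) ∧
    -- the spectrum is `[0, 1]` and pure point, with eigenvalues dense in `[0, 1]`
    spectrum ℂ (InternalWaves.poincareOperator Ω) = Complex.ofReal '' Icc (0 : ℝ) 1 ∧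
    InternalWaves.HasPurePointSpectrum (InternalWaves.poincareOperator Ω) ∧
    closure (InternalWaves.eigenvalues (InternalWaves.poincareOperator Ω)) =
      Complex.ofReal '' Icc (0 : ℝ) 1 ∧
    -- the eigenvalues are exactly the `λ²` with `r(λ)` rational
    InternalWaves.eigenvalues (InternalWaves.poincareOperator Ω) =
      {μ : ℂ | ∃ lam ∈ Ioo (0 : ℝ) 1, μ = ((lam ^ 2 : ℝ) : ℂ) ∧
        InternalWaves.IsRationalMod (InternalWaves.rotationNumber Ω lam)} := by
  open InternalWaves in
  rcases hΩ with h | ⟨a₁, b₁, a₂, b₂, h₁, h₂, rfl⟩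
  · obtain ⟨p, q, v, hD, rfl⟩ := h.exists_eq_ellipse
    exact spectral_description_of_isComplete (isBoundedOpen_ellipse hD) (isComplete_ellEigenpairs hD)
      continuousOn_ellAngle (strictMonoOn_ellAngle hD) (fst_image_ellEigenpairs hD)
      (fun lam hlam => ⟨_, isRotationNumber_ellipse hD hlam⟩)
      (fun lam hlam => isRationalMod_rotationNumber_ellipse_iff hD hlam)
  · refine spectral_description_of_isComplete (isBoundedOpen_rect a₁ b₁ a₂ b₂)
      (isComplete_rectEigenpairs h₁ h₂)
      (φ := fun lam => (b₂ - a₂) / (b₁ - a₁) * (lam / √(1 - lam ^ 2)))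
      (continuousOn_const.mul continuousOn_div_sqrt)
      (strictMonoOn_mul_div_sqrt (div_pos (sub_pos.2 h₂) (sub_pos.2 h₁)))
      (fst_image_rectEigenpairs h₁ h₂) (fun lam hlam => ⟨_, isRotationNumber_rect h₁ h₂ hlam⟩)
      fun lam hlam => ?_
    refine (isRationalMod_rotationNumber_rect_iff h₁ h₂ hlam).trans ?_
    rw [div_mul_div_comm, mul_comm (b₂ - a₂), mul_comm (b₁ - a₁)]
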